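/- Let $P_\ell(z)=\frac{1}{2^\ell \ell!}\frac{d^\ell}{dz^\ell}(z^2-1)^\ell$ be the Legendre polynomials, let $\mathbb{S}^2\subset\mathbb{R}^3$ carry its surface measure $dy$ (of total mass $4\pi$), and let $p\ge 1$. *Kernels.* For $j=1,\dots,p$ let $k_j(z)=\sum_{\ell\ge 0}\phi_{\ell;j}\frac{2\ell+1}{4\pi}P_\ell(z)$, the (real) series converging unconditionally for every $z\in[-1,1]$; write $k=(k_1,\dots,k_p)'$ and let $(\Phi_j f)(x)=\int_{\mathbb{S}^2}k_j(\langle x,y\rangle)f(y)\,dy$, so that $\phi_{\ell;j}$ is the eigenvalue of $\Phi_j$ on spherical harmonics of degree $\ell$. *Innovations.* On a probability space let $\{Z(x,t):x\in\mathbb{S}^2,t\in\mathbb{Z}\}$ be a jointly measurable Gaussian spherical white noise: the fields $Z(\cdot,t)$, $t\in\mathbb{Z}$, are independent, and each is a zero-mean Gaussian field with covariance function $\sum_{\ell\ge 0}\frac{2\ell+1}{4\pi}C_{\ell;Z}P_\ell(\langle x,y\rangle)$, where $\sum_\ell \frac{2\ell+1}{4\pi}C_{\ell;Z}<\infty$.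 *Model.* Let $\{T(x,t)\}$ be a jointly measurable zero-mean Gaussian random field on $\mathbb{S}^2\times\mathbb{Z}$ with $\mathbb{E}[T(x,t)T(y,s)]=\Gamma_0(\langle x,y\rangle,t-s)$ for some function $\Gamma_0$, satisfying the spherical autoregression of order $p$ $$T_t(x)=\sum_{j=1}^p(\Phi_jT_{t-j})(x)+Z_t(x),\qquad (x,t)\in\mathbb{S}^2\times\mathbb{Z},$$ both in $L^2(\Omega)$ for every $(x,t)$ and in $L^2(\Omega\times\mathbb{S}^2)$ for every $t$, where $T_t=T(\cdot,t)$ and $Z_t=Z(\cdot,t)$. *Conditions.* 1. (Stationarity) There is $\delta>0$ such that $1-\phi_{\ell;1}w-\cdots-\phi_{\ell;p}w^p\neq 0$ for all $\ell\ge 0$ and all complex $w$ with $|w|\le 1+\delta$. 2. (Identifiability) $C_{\ell;Z}>0$ for all $\ell\ge 0$. 3. (Strong smoothness) There are $\gamma_j>0$ and $\beta_j>2$ with $|\phi_{\ell;j}|\le\gamma_j\ell^{-\beta_j}$ for all $\ell>0$, $j=1,\dots,p$. Put $\beta_*=\min_j\beta_j$. 4. $L_N$ are nonnegative integers with $L_N\sim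 N^d$ for some $d>\frac{1}{2\beta_*-2}$; that is, there are $c_1,c_2>0$ with $c_1N^d\le L_N\le c_2N^d$ for all sufficiently large $N$. *Estimator.* For $N>p$ let $\widehat k_N=(\widehat k_{1;N},\dots,\widehat k_{p;N})'$ be almost surely a minimizer, over all $p$-tuples $(h_1,\dots,h_p)$ of elements of $\mathrm{span}\{\frac{2\ell+1}{4\pi}P_\ell:\ \ell\le L_N\}$, of $$\sum_{t=1}^{N}\Big\|T_{t+p}-\sum_{j=1}^p\int_{\mathbb{S}^2}h_j(\langle\cdot,y\rangle)\,T_{t+p-j}(y)\,dy\Big\|^2_{L^2(\mathbb{S}^2)}.$$ Put $L_N(z)=\sum_{\ell=0}^{L_N}\frac{2\ell+1}{16\pi^2}P_\ell(z)^2$. *Conclusion.* For every fixed $z\in[-1,1]$, $$\sqrt{\frac{N}{L_N(z)}}\,\big(\widehat k_N(z)-k(z)\big)\longrightarrow\mathcal{N}_p(0_p,I_p)\quad\text{in distribution, as } N\to\infty.$$ -/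

import Mathlib

open MeasureTheory ProbabilityTheory Filter Topology
open scoped Asymptotics

noncomputable section

namespace SPHAR

/-- The unit sphere of `ℝ³` with its Euclidean norm. -/
abbrev S2 : Type := Metric.sphere (0 : EuclideanSpace ℝ (Fin 3)) 1

/-- Surface (Lebesgue) measure on the sphere; its total mass is `4π`. -/
def surface : Measure S2 := (volume : Measure (EuclideanSpace ℝ (Fin 3))).toSphere

/-- The inner product in `ℝ³` of two points of the sphere. -/
def dot (x y : S2) : ℝ :=
  inner ℝ (x : EuclideanSpace ℝ (Fin 3)) (y : EuclideanSpace ℝ (Fin 3))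

/-- The Legendre polynomial `P_ℓ(z) = (2^ℓ ℓ!)⁻¹ d^ℓ/dz^ℓ (z² - 1)^ℓ`. -/
def legendre (l : ℕ) : Polynomial ℝ :=
  Polynomial.C (1 / (2 ^ l * (l.factorial : ℝ))) *
    Polynomial.derivative^[l] ((Polynomial.X ^ 2 - 1) ^ l)

/-- The function `z ↦ (2ℓ+1)/(4π) P_ℓ(z)`. -/
def zonal (l : ℕ) (z : ℝ) : ℝ :=
  (2 * (l : ℝ) + 1) / (4 * Real.pi) * (legendre l).eval z

/-- The isotropic kernel operator `(Φ f)(x) = ∫_{S²} k(⟨x, y⟩) f(y) dy`. -/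
def kernelOp (k : ℝ → ℝ) (f : S2 → ℝ) (x : S2) : ℝ :=
  ∫ y, k (dot x y) * f y ∂surface

/-- `k` is, pointwise on `[-1, 1]`, the sum of the expansion
`k(z) = ∑ φ_ℓ (2ℓ+1)/(4π) P_ℓ(z)`. -/
def HasLegendreExpansion (k : ℝ → ℝ) (φ : ℕ → ℝ) : Prop :=
  ∀ z ∈ Set.Icc (-1 : ℝ) 1, HasSum (fun l => φ l * zonal l z) (k z)

/-- Zero-mean Gaussian space-time random field, isotropic in space and stationary in time. -/
structure IsGaussianIsotropicStationary {Ω : Type*} [MeasurableSpace Ω]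
    (T : Ω → S2 → ℤ → ℝ) (μ : Measure Ω) : Prop where
  measurable : Measurable (fun q : Ω × S2 × ℤ => T q.1 q.2.1 q.2.2)
  gaussian : IsGaussianProcess (fun (q : S2 × ℤ) (ω : Ω) => T ω q.1 q.2) μ
  mean_zero : ∀ x t, ∫ ω, T ω x t ∂μ = 0
  covariance : ∃ Γ₀ : ℝ → ℤ → ℝ, ∀ x t y s,
    ∫ ω, T ω x t * T ω y s ∂μ = Γ₀ (dot x y) (t - s)

/-- Gaussian spherical white noise with angular power spectrum `C`. -/
structure IsSphericalWhiteNoise {Ω : Type*} [MeasurableSpace Ω]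
    (Z : Ω → S2 → ℤ → ℝ) (C : ℕ → ℝ) (μ : Measure Ω) : Prop where
  measurable : Measurable (fun q : Ω × S2 × ℤ => Z q.1 q.2.1 q.2.2)
  gaussian : ∀ t, IsGaussianProcess (fun (x : S2) (ω : Ω) => Z ω x t) μ
  mean_zero : ∀ x t, ∫ ω, Z ω x t ∂μ = 0
  summable : Summable (fun l : ℕ => (2 * (l : ℝ) + 1) / (4 * Real.pi) * C l)
  covariance : ∀ x y t, HasSum (fun l => C l * zonal l (dot x y)) (∫ ω, Z ω x t * Z ω y t ∂μ)
  indep : iIndepFun (fun (t : ℤ) (ω : Ω) (x : S2) => Z ω x t) μ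

/-- The residual `T_t(x) - ∑_{j=1}^p (Φ_j T_{t-j})(x)`; the index `j : Fin p` stands for the
lag `j + 1`. -/
def residual {p : ℕ} (k : Fin p → ℝ → ℝ) (T : S2 → ℤ → ℝ) (t : ℤ) (x : S2) : ℝ :=
  T x t - ∑ j : Fin p, kernelOp (k j) (fun y => T y (t - ((j : ℤ) + 1))) x

/-- `T` is the spherical autoregression of order `p` with kernels `k` and innovations `Z`:
the equation holds in `L²(Ω)` for each `(x, t)`, and in `L²(Ω × S²)` for each `t`. -/
def IsSPHAR {Ω : Type*} [MeasurableSpace Ω] {p : ℕ} (k : Fin p → ℝ → ℝ)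
    (T Z : Ω → S2 → ℤ → ℝ) (μ : Measure Ω) : Prop :=
  (∀ x t, ∀ᵐ ω ∂μ, residual k (T ω) t x - Z ω x t = 0) ∧
  (∀ t, ∀ᵐ q ∂(μ.prod surface), residual k (T q.1) t q.2 - Z q.1 q.2 t = 0)

/-- The associated polynomials `1 - φ_{ℓ;1} w - ⋯ - φ_{ℓ;p} w^p` have no root in a common
enlargement of the closed unit disk. -/
def StationarityCondition {p : ℕ} (φ : ℕ → Fin p → ℝ) : Prop :=
  ∃ δ : ℝ, 0 < δ ∧ ∀ (l : ℕ) (w : ℂ), ‖w‖ ≤ 1 + δ →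
    1 - ∑ j : Fin p, (φ l j : ℂ) * w ^ ((j : ℕ) + 1) ≠ 0

/-- Strong smoothness: `|φ_{ℓ;j}| ≤ γ_j ℓ^{-β_j}` for `ℓ > 0`, with `γ_j > 0`, `β_j > 2`. -/
def StrongSmoothness {p : ℕ} (φ : ℕ → Fin p → ℝ) (β γ : Fin p → ℝ) : Prop :=
  ∀ j, 2 < β j ∧ 0 < γ j ∧ ∀ l : ℕ, 0 < l → |φ l j| ≤ γ j / (l : ℝ) ^ (β j)

/-- The span of the functions `(2ℓ+1)/(4π) P_ℓ`, `ℓ ≤ L`. -/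
def kernelSpace (L : ℕ) : Submodule ℝ (ℝ → ℝ) :=
  Submodule.span ℝ (zonal '' Set.Iic L)

/-- `∑_{t=1}^N ‖T_{t+p} - ∑_j Φ_j T_{t+p-j}‖²_{L²(S²)}` as a function of the kernels. -/
def leastSquares {p : ℕ} (N : ℕ) (T : S2 → ℤ → ℝ) (k : Fin p → ℝ → ℝ) : ℝ :=
  ∑ t ∈ Finset.Icc 1 N, ∫ x, (residual k T ((t : ℤ) + (p : ℤ)) x) ^ 2 ∂surface

/-- `khat` minimizes the least-squares functional over `p`-tuples from `kernelSpace L`. -/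
def IsKernelEstimate {p : ℕ} (N L : ℕ) (T : S2 → ℤ → ℝ) (khat : Fin p → ℝ → ℝ) : Prop :=
  (∀ j, khat j ∈ kernelSpace L) ∧
  ∀ k : Fin p → ℝ → ℝ, (∀ j, k j ∈ kernelSpace L) → leastSquares N T khat ≤ leastSquares N T k

/-- `∑_{ℓ=0}^L (2ℓ+1)/(16π²) P_ℓ(z)²`. -/
def normalizer (L : ℕ) (z : ℝ) : ℝ :=
  ∑ l ∈ Finset.range (L + 1), (2 * (l : ℝ) + 1) / (16 * Real.pi ^ 2) * ((legendre l).eval z) ^ 2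

end SPHAR

end

/-! In a real orthonormal system of spherical harmonics `Y_{lm}` every isotropic kernel operator is
diagonal. Hence the harmonic coefficients of `T`, divided by `√C_l`, are independent scalar Gaussian
autoregressions with unit innovations, and the `2l+1` series of degree `l` share the coefficient
vector `φ_l` (`IsSPHAR.isARSystem`). For the same reason the least-squares problem splits into one
`p × p` system per degree: if `x_l` is the estimation error of `φ_l`, then `Ĝ_l x_l = û_l`, where
`Ĝ_l` (`empCov`) is the empirical covariance matrix and `û_l` (`empCross`) the average of regressor
times innovation, both over `N(2l+1)` terms (`IsHarmonicSystem.empCov_mul`). The error at `z` is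
then `∑_{l≤L} x_l (2l+1)/(4π) P_l(z)` minus the tail of the true expansion.

Bias. There is one exponent `s` (`1/2` inside the interval, `1` at `±1`) such that `(2l+1)P_l(z) =
O(l^s)` and the normalizer is at least `c L^{2s}` (`zonal_growth`; the interior case rests on a
discrete Sonin function). In the standardized tail `s` cancels and `√N L^{1-β}` remains, which
vanishes because `d > 1/(2β-2)` (`tendsto_bias`).

Linearization. Replacing `Ĝ_l` by the true matrix `G_l` costs an error quadratic in `(Ĝ_l - G_l,
û_l)` (`sum_abs_sub_inv_mulVec_le`), of expected size `O(1/(N(2l+1)))` by Isserlis' formula. Summed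
against the weights `√(N/normalizer) (2l+1)|P_l(z)|`, this is `∑|P_l(z)| / √(N · normalizer)` up to
constants, which Cauchy–Schwarz bounds by a multiple of `√(∑ 1/(2l+1) / N)`. As `L_N` grows
polynomially, this tends to `0` (`IsARSystem.tendstoInMeasure_sub_linearPart`).

Central limit theorem. In a direction `c` the linear part is a sum of independent terms indexed by
`(l,m)`, with total variance the average of `cᵀG_l⁻¹c` with weights `(2l+1)P_l(z)²`. Since `φ_l →
0`, `G_l` tends to the identity, and the weights have divergent sum, so the variance tends to
`|c|²`. Single variances vanish uniformly and fourth moments are controlled by squared variances, so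
a Lyapunov argument on characteristic functions applies
(`IsARSystem.tendsto_integral_cexp_linearPart`). Lévy's theorem and Slutsky's lemma conclude. -/

namespace SPHAR

/-! ### Legendre polynomials: recursions, orthogonality and norms. -/

open Polynomial in
lemma iterate_derivative_X_mul (p : ℝ[X]) (n : ℕ) :
    derivative^[n + 1] (X * p) = X * derivative^[n + 1] p + ((n : ℝ[X]) + 1) * derivative^[n] p := by
  induction n generalizing p with
  | zero => simp [derivative_mul]; ring
  | succ n ih =>
    rw [Function.iterate_succ_apply' _ (n + 1), ih]
    simp only [derivative_add, derivative_mul, derivative_X, Function.iterate_succ_apply',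
      derivative_natCast, derivative_one]
    push_cast
    ring

/-- The primitive of `legendre (l + 1)` obtained from the Rodrigues formula. -/
noncomputable def legendrePrim (l : ℕ) : Polynomial ℝ :=
  Polynomial.C (1 / (2 ^ (l + 1) * ((l + 1).factorial : ℝ))) *
    Polynomial.derivative^[l] ((Polynomial.X ^ 2 - 1) ^ (l + 1))

open Polynomial in
lemma legendre_succ_succ (n : ℕ) :
    legendre (n + 2) = X * legendre (n + 1) + ((n : ℝ[X]) + 1) * legendrePrim n := by
  have h1 : derivative ((X ^ 2 - 1 : ℝ[X]) ^ (n + 2)) =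
      C (2 * ((n : ℝ) + 2)) * (X * (X ^ 2 - 1) ^ (n + 1)) := by
    simp [derivative_pow]; ring
  have h2 : (1 / (2 ^ (n + 2) * ((n + 2).factorial : ℝ))) * (2 * ((n : ℝ) + 2)) =
      1 / (2 ^ (n + 1) * ((n + 1).factorial : ℝ)) := by
    rw [Nat.factorial_succ (n + 1)]; push_cast; field_simp
    ring
  rw [legendre, Function.iterate_succ_apply, h1, iterate_derivative_C_mul, iterate_derivative_X_mul,
    ← mul_assoc, ← C_mul, h2, legendre, legendrePrim]
  ring

-- Two derivatives are carried out before the remaining `n`, and `x² = (x² - 1) + 1` splits the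
-- result into Rodrigues expressions for adjacent exponents.
open Polynomial in
lemma legendre_succ_succ' (n : ℕ) :
    legendre (n + 2) = (2 * (n : ℝ[X]) + 3) * legendrePrim n + legendre n := by
  have h1 : derivative (derivative ((X ^ 2 - 1 : ℝ[X]) ^ (n + 2))) =
      C (2 * ((n : ℝ) + 2) * (2 * n + 3)) * ((X ^ 2 - 1) ^ (n + 1)) +
      C (2 * ((n : ℝ) + 2) * (2 * (n + 1))) * ((X ^ 2 - 1) ^ n) := by
    have e2 : (C (2 : ℝ)) = 2 := map_ofNat C 2
    have e3 : (C (3 : ℝ)) = 3 := map_ofNat C 3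
    simp [derivative_pow, derivative_mul, e2, e3]; ring
  have h2 : (1 / (2 ^ (n + 2) * ((n + 2).factorial : ℝ))) * (2 * ((n : ℝ) + 2) * (2 * n + 3)) =
      (2 * n + 3) * (1 / (2 ^ (n + 1) * ((n + 1).factorial : ℝ))) := by
    rw [Nat.factorial_succ (n + 1)]; push_cast; field_simp
    ring
  have h3 : (1 / (2 ^ (n + 2) * ((n + 2).factorial : ℝ))) * (2 * ((n : ℝ) + 2) * (2 * (n + 1))) =
      (1 / (2 ^ n * (n.factorial : ℝ))) := by
    rw [Nat.factorial_succ (n + 1), Nat.factorial_succ n]; push_cast; field_simp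
    ring
  rw [legendre, Function.iterate_succ_apply, Function.iterate_succ_apply, h1, iterate_map_add,
    iterate_derivative_C_mul, iterate_derivative_C_mul, mul_add,
    ← mul_assoc, ← C_mul, h2, ← mul_assoc, ← C_mul, h3, legendre, legendrePrim]
  simp only [C_mul, C_add, C_ofNat, map_natCast]
  ring

lemma derivative_legendrePrim (n : ℕ) :
    Polynomial.derivative (legendrePrim n) = legendre (n + 1) := by
  rw [legendrePrim, legendre, Polynomial.derivative_C_mul, Function.iterate_succ_apply']

open Polynomial in
lemma legendre_zero : legendre 0 = 1 := by simp [legendre]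

open Polynomial in
lemma legendre_one : legendre 1 = X := by
  have e2 : (2 : ℝ[X]) = C 2 := (map_ofNat C 2).symm
  simp [legendre, ← mul_assoc]
  rw [one_add_one_eq_two, e2, ← C_mul]; simp

-- Bonnet's three-term recursion, obtained by eliminating `legendrePrim n` between the two preceding
-- formulas. The values at `±1`, the parity and the growth estimates all come from it.
open Polynomial in
lemma bonnet_poly (n : ℕ) :
    ((n : ℝ[X]) + 2) * legendre (n + 2) =
      (2 * (n : ℝ[X]) + 3) * X * legendre (n + 1) - ((n : ℝ[X]) + 1) * legendre n := by
  linear_combination (2 * (n : ℝ[X]) + 3) * legendre_succ_succ n -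
    ((n : ℝ[X]) + 1) * legendre_succ_succ' n

open Polynomial in
lemma bonnet (n : ℕ) (z : ℝ) :
    ((n : ℝ) + 2) * (legendre (n + 2)).eval z =
      (2 * n + 3) * z * (legendre (n + 1)).eval z - (n + 1) * (legendre n).eval z := by
  have := congrArg (Polynomial.eval z) (bonnet_poly n)
  simpa using this

open Polynomial in
lemma derivative_legendre_sub (n : ℕ) :
    (2 * (n : ℝ[X]) + 3) * legendre (n + 1) = derivative (legendre (n + 2) - legendre n) := by
  rw [legendre_succ_succ' n, add_sub_cancel_right, derivative_mul, derivative_legendrePrim]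
  simp

lemma legendre_eval_one (n : ℕ) : (legendre n).eval 1 = 1 := by
  induction n using Nat.twoStepInduction with
  | zero => simp [legendre_zero]
  | one => simp [legendre_one]
  | more n h1 h2 =>
    have := bonnet n 1
    rw [h1, h2] at this
    have h : (n : ℝ) + 2 ≠ 0 := by positivity
    apply mul_left_cancel₀ h
    rw [this]; ring

lemma legendre_eval_neg (n : ℕ) (z : ℝ) : (legendre n).eval (-z) = (-1) ^ n * (legendre n).eval z := by
  induction n using Nat.twoStepInduction with
  | zero => simp [legendre_zero]
  | one => simp [legendre_one]
  | more n h1 h2 =>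
    have := bonnet n (-z)
    have h3 := bonnet n z
    rw [h1, h2] at this
    have h : (n : ℝ) + 2 ≠ 0 := by positivity
    apply mul_left_cancel₀ h
    rw [this]
    linear_combination (-(-1) ^ n) * h3

lemma natDegree_legendre_le (n : ℕ) : (legendre n).natDegree ≤ n := by
  refine (Polynomial.natDegree_C_mul_le _ _).trans
    ((Polynomial.natDegree_iterate_derivative _ _).trans ?_)
  have : ((Polynomial.X ^ 2 - 1 : Polynomial ℝ) ^ n).natDegree ≤ n * 2 :=
    (Polynomial.natDegree_pow_le).trans (Nat.mul_le_mul_left _ (by compute_degree))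
  omega

lemma integral_derivative_mul (f g : Polynomial ℝ) :
    ∫ z in (-1 : ℝ)..1, (Polynomial.derivative f).eval z * g.eval z =
      f.eval 1 * g.eval 1 - f.eval (-1) * g.eval (-1) -
        ∫ z in (-1 : ℝ)..1, f.eval z * (Polynomial.derivative g).eval z := by
  have := intervalIntegral.integral_mul_deriv_eq_deriv_mul (a := -1) (b := 1)
    (u := fun z => g.eval z) (v := fun z => f.eval z) (u' := fun z => (Polynomial.derivative g).eval z)
    (v' := fun z => (Polynomial.derivative f).eval z) (fun x _ => g.hasDerivAt x)
    (fun x _ => f.hasDerivAt x) (by apply Continuous.intervalIntegrable; fun_prop)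
    (by apply Continuous.intervalIntegrable; fun_prop)
  simp only [mul_comm (Polynomial.eval _ g), mul_comm (Polynomial.eval _ (Polynomial.derivative g))]
    at this
  rw [this]

/-- Integration by parts: `(2n+3) P_{n+1}` is the derivative of `P_{n+2} - P_n`, which vanishes at
`±1`. Each use lowers the degree of `f`, which drives the orthogonality proof. -/
lemma integral_legendre_mul_eq_integral (n : ℕ) (f : Polynomial ℝ) :
    (2 * (n : ℝ) + 3) * ∫ z in (-1 : ℝ)..1, (legendre (n + 1)).eval z * f.eval z =
      -∫ z in (-1 : ℝ)..1, (legendre (n + 2) - legendre n).eval z *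
        (Polynomial.derivative f).eval z := by
  have h := integral_derivative_mul (legendre (n + 2) - legendre n) f
  rw [← derivative_legendre_sub n] at h
  simp only [Polynomial.eval_sub, legendre_eval_one, legendre_eval_neg] at h ⊢
  rw [← intervalIntegral.integral_const_mul]
  simpa [mul_assoc, pow_succ] using h

/-- Legendre polynomials are orthogonal to polynomials of lower degree. -/
lemma integral_legendre_mul_eq_zero (n : ℕ) (f : Polynomial ℝ) (hf : f.natDegree < n) :
    ∫ z in (-1 : ℝ)..1, (legendre n).eval z * f.eval z = 0 := by
  -- Induction on a bound for the degree of `f`, with the index `n` free: integration by parts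
  -- trades index `n + 1` and `f` for indices `n + 2`, `n` and `f'`, whose degree is still below
  -- both.
  obtain ⟨k, hk⟩ : ∃ k, f.natDegree ≤ k := ⟨_, le_rfl⟩
  induction k generalizing n f with
  | zero =>
    have hf0 : Polynomial.derivative f = 0 :=
      Polynomial.derivative_of_natDegree_zero (by omega)
    obtain _ | n := n
    · omega
    · have h := integral_legendre_mul_eq_integral n f
      have h2 : (2 * (n : ℝ) + 3) ≠ 0 := by positivity
      apply mul_left_cancel₀ h2
      simpa [hf0] using h
  | succ k ih =>
    by_cases hf0 : f.natDegree = 0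
    · exact ih n f hf (by omega)
    have hd := Polynomial.natDegree_derivative_lt hf0
    obtain _ | n := n
    · omega
    · have h := integral_legendre_mul_eq_integral n f
      have h2 : (2 * (n : ℝ) + 3) ≠ 0 := by positivity
      apply mul_left_cancel₀ h2
      simp only [Polynomial.eval_sub, sub_mul] at h
      rw [h, intervalIntegral.integral_sub, ih (n + 2) _ (by omega) (by omega),
        ih n _ (by omega) (by omega)]
      · simp
      all_goals apply Continuous.intervalIntegrable; fun_prop

/-- Integrate `P_{n+2}' P_{n+1}` by parts. The boundary contributes `2`, the integral of `P_{n+2}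
P_{n+1}'` vanishes by degree, and `P_{n+2}' = (2n+3) P_{n+1} + P_n'` where `P_n'` is orthogonal to
`P_{n+1}`. -/
lemma integral_legendre_sq (n : ℕ) :
    ∫ z in (-1 : ℝ)..1, (legendre n).eval z * (legendre n).eval z = 2 / (2 * n + 1) := by
  obtain _ | n := n
  · simp [legendre_zero]; norm_num
  have hD := natDegree_legendre_le
  have hd : ∀ k, (Polynomial.derivative (legendre k)).natDegree < k + 1 := fun k =>
    lt_of_le_of_lt (Polynomial.natDegree_derivative_le _) (by have := hD k; omega)
  have h := integral_derivative_mul (legendre (n + 2)) (legendre (n + 1))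
  have h0 := integral_legendre_mul_eq_zero (n + 2) _ (hd (n + 1))
  have h1 := integral_legendre_mul_eq_zero (n + 1) _ (hd n)
  have h4 : ∀ z, (Polynomial.derivative (legendre (n + 2))).eval z * (legendre (n + 1)).eval z =
      (2 * n + 3) * ((legendre (n + 1)).eval z * (legendre (n + 1)).eval z) +
      (legendre (n + 1)).eval z * (Polynomial.derivative (legendre n)).eval z := by
    intro z
    have := congrArg (Polynomial.eval z) (derivative_legendre_sub n)
    simp at this
    linear_combination (-(legendre (n + 1)).eval z) * this
  simp only [h4] at h
  rw [intervalIntegral.integral_add, h1, h0, intervalIntegral.integral_const_mul] at h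
  · simp only [legendre_eval_one, legendre_eval_neg] at h
    have h5 : ((-1 : ℝ) ^ (n + 2) * 1) * ((-1) ^ (n + 1) * 1) = -1 := by
      have : ((-1 : ℝ) ^ n) ^ 2 = 1 := by rw [← pow_mul, mul_comm, pow_mul]; simp
      linear_combination (-1) * this
    rw [h5] at h
    push_cast
    rw [eq_div_iff (by positivity)]
    linarith
  all_goals apply Continuous.intervalIntegrable; fun_prop

end SPHAR


/-! ### The Sonin function and the size of `P_n(z)` for `|z| < 1`. -/

namespace SPHAR

/-- A discrete Sonin function of the Legendre recursion. -/
noncomputable def sonin (z : ℝ) (n : ℕ) : ℝ :=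
  ((n : ℝ) + 3 / 2) * (legendre (n + 1)).eval z ^ 2
    - 2 * z * (n + 1) * ((legendre (n + 1)).eval z * (legendre n).eval z)
    + (n + 1 / 2) * (legendre n).eval z ^ 2
    + (legendre (n + 1)).eval z ^ 2 / (4 * n + 2) + (legendre n).eval z ^ 2 / (4 * n + 6)

/-- By Bonnet's recursion the quadratic form in two consecutive values is conserved up to the
correction terms; only the coefficient of `P_{n+1}²` changes, from `1/(4n+2)` to `1/(4n+10)`. The
decrement is thus explicit, with a coefficient of order `n⁻²`. -/
lemma sonin_succ (z : ℝ) (n : ℕ) :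
    sonin z (n + 1) =
      sonin z n - 8 / ((4 * n + 2) * (4 * n + 10)) * (legendre (n + 1)).eval z ^ 2 := by
  have h := bonnet n z
  simp only [sonin]
  push_cast
  set a := (legendre n).eval z
  set b := (legendre (n + 1)).eval z
  set c := (legendre (n + 2)).eval z
  have h1 : (4 * (n : ℝ) + 2) ≠ 0 := by positivity
  have h2 : (4 * (n : ℝ) + 6) ≠ 0 := by positivity
  have h3 : (4 * (n : ℝ) + 10) ≠ 0 := by positivity
  have key : ((n : ℝ) + 5 / 2) * c ^ 2 - 2 * z * (n + 2) * (c * b) + (n + 3 / 2) * b ^ 2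
      + c ^ 2 / (4 * n + 6) =
      ((n : ℝ) + 3 / 2) * b ^ 2 - 2 * z * (n + 1) * (b * a) + (n + 1 / 2) * a ^ 2
      + a ^ 2 / (4 * n + 6) := by
    apply mul_left_cancel₀ h2
    field_simp
    linear_combination (8 * ((n + 2) * c - (n + 1) * a)) * h
  have e1 : (4 * ((n : ℝ) + 1) + 2) = 4 * n + 6 := by ring
  have e2 : (4 * ((n : ℝ) + 1) + 6) = 4 * n + 10 := by ring
  have e3 : b ^ 2 / (4 * n + 10) = b ^ 2 / (4 * n + 2) - 8 / ((4 * n + 2) * (4 * n + 10)) * b ^ 2 := by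
    field_simp; ring
  rw [e1, e2, e3]
  linear_combination key

lemma sonin_antitone (z : ℝ) : Antitone (sonin z) :=
  antitone_nat_of_succ_le fun n => by
    rw [sonin_succ]
    have : 0 ≤ 8 / ((4 * (n : ℝ) + 2) * (4 * n + 10)) * (legendre (n + 1)).eval z ^ 2 := by positivity
    linarith

/-- The form dominates `(n+1)(1-|z|)(a² + b²) - a²/2`; the hypothesis on `n` lets half of the first
term absorb the second. -/
lemma le_sonin (z : ℝ) (n : ℕ) (hn : 1 ≤ (n + 1) * (1 - |z|)) :
    (n + 1) * ((1 - |z|) / 2) * ((legendre n).eval z ^ 2 + (legendre (n + 1)).eval z ^ 2)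
      ≤ sonin z n := by
  simp only [sonin]
  set a := (legendre n).eval z
  set b := (legendre (n + 1)).eval z
  have h1 : 0 ≤ b ^ 2 / (4 * (n : ℝ) + 2) := by positivity
  have h2 : 0 ≤ a ^ 2 / (4 * (n : ℝ) + 6) := by positivity
  have h3 : 2 * z * (b * a) ≤ |z| * (a ^ 2 + b ^ 2) := by
    have : z * (b * a) ≤ |z| * (|b| * |a|) := by
      rw [← abs_mul, ← abs_mul]; exact le_abs_self _
    have h4 : |z| * (2 * (|b| * |a|)) ≤ |z| * (a ^ 2 + b ^ 2) := by
      apply mul_le_mul_of_nonneg_left _ (abs_nonneg _)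
      nlinarith [sq_nonneg (|b| - |a|), sq_abs a, sq_abs b]
    linarith
  have h5 := mul_le_mul_of_nonneg_left h3 (by positivity : (0 : ℝ) ≤ n + 1)
  have h6 := mul_nonneg (sub_nonneg.2 hn) (sq_nonneg a)
  have h7 := mul_nonneg (sub_nonneg.2 hn) (sq_nonneg b)
  have h8 := sq_nonneg b
  linarith

lemma sonin_le (z : ℝ) (hz : |z| ≤ 1) (n : ℕ) :
    sonin z n ≤ 4 * (n + 1) * ((legendre n).eval z ^ 2 + (legendre (n + 1)).eval z ^ 2) := by
  simp only [sonin]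
  set a := (legendre n).eval z
  set b := (legendre (n + 1)).eval z
  have h1 : b ^ 2 / (4 * (n : ℝ) + 2) ≤ b ^ 2 / 2 := by
    apply div_le_div_of_nonneg_left (by positivity) (by norm_num); linarith [(Nat.cast_nonneg n : (0 : ℝ) ≤ n)]
  have h2 : a ^ 2 / (4 * (n : ℝ) + 6) ≤ a ^ 2 / 2 := by
    apply div_le_div_of_nonneg_left (by positivity) (by norm_num); linarith [(Nat.cast_nonneg n : (0 : ℝ) ≤ n)]
  have h3 : -(2 * z * (b * a)) ≤ (a ^ 2 + b ^ 2) := by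
    have : -(z * (b * a)) ≤ |z| * (|b| * |a|) := by
      rw [← abs_mul, ← abs_mul]; exact neg_le_abs _
    have h4 : |z| * (|b| * |a|) ≤ 1 * (|b| * |a|) := by gcongr
    nlinarith [sq_nonneg (|b| - |a|), sq_abs a, sq_abs b]
  have h5 := mul_le_mul_of_nonneg_left h3 (by positivity : (0 : ℝ) ≤ n + 1)
  have h6 := mul_nonneg (Nat.cast_nonneg n : (0 : ℝ) ≤ n) (sq_nonneg a)
  have h7 := mul_nonneg (Nat.cast_nonneg n : (0 : ℝ) ≤ n) (sq_nonneg b)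
  have h8 := sq_nonneg b
  have h9 := sq_nonneg a
  linarith

lemma legendre_sq_add_sq_pos (z : ℝ) (n : ℕ) :
    0 < (legendre n).eval z ^ 2 + (legendre (n + 1)).eval z ^ 2 := by
  induction n with
  | zero => simp [legendre_zero]; positivity
  | succ n ih =>
    by_contra hcon
    have h1 : (legendre (n + 1)).eval z = 0 := by
      apply pow_eq_zero_iff (two_ne_zero) |>.1
      nlinarith [sq_nonneg ((legendre (n + 1)).eval z), sq_nonneg ((legendre (n + 1 + 1)).eval z)]
    have h2 : (legendre (n + 2)).eval z = 0 := by
      apply pow_eq_zero_iff (two_ne_zero) |>.1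
      nlinarith [sq_nonneg ((legendre (n + 1)).eval z), sq_nonneg ((legendre (n + 1 + 1)).eval z)]
    have h := bonnet n z
    rw [h1, h2] at h
    have h3 : (legendre n).eval z = 0 := by
      have : ((n : ℝ) + 1) ≠ 0 := by positivity
      apply mul_left_cancel₀ this
      linarith
    rw [h1, h3] at ih
    simp at ih

/-- The Sonin function is comparable to `(n+1)(P_n² + P_{n+1}²)`. It decreases, which gives the
upper bound, and loses at most a fraction `1/(n+2)²` at each step; the corresponding infinite
product is positive, so it stays away from `0`. Single values may vanish, so only pairs are bounded
below. -/
lemma legendre_sq_growth {z : ℝ} (hz : |z| < 1) :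
    ∃ c C : ℝ, 0 < c ∧ 0 < C ∧ ∃ n₀ : ℕ, ∀ n ≥ n₀, (n + 1) * (legendre n).eval z ^ 2 ≤ C ∧
      c ≤ (n + 1) * ((legendre n).eval z ^ 2 + (legendre (n + 1)).eval z ^ 2) := by
  set κ := (1 - |z|) / 2 with hκ
  have hκ0 : 0 < κ := by rw [hκ]; linarith
  -- Then `(n+1)κ ≥ 2`, which implies the hypothesis of `le_sonin` and also `2 P_{n+1}² ≤ sonin z
  -- n`.
  obtain ⟨n₀, hn₀⟩ := exists_nat_ge (2 / κ)
  have hge : ∀ n ≥ n₀, 2 ≤ ((n : ℝ) + 1) * κ := by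
    intro n hn
    rw [div_le_iff₀ hκ0] at hn₀
    have : (n₀ : ℝ) ≤ n := by exact_mod_cast hn
    nlinarith
  have hlow : ∀ n ≥ n₀, (n + 1) * κ * ((legendre n).eval z ^ 2 + (legendre (n + 1)).eval z ^ 2)
      ≤ sonin z n := fun n hn => le_sonin z n (by have := hge n hn; rw [hκ] at this; linarith)
  have hpos : ∀ n ≥ n₀, 0 < sonin z n := fun n hn =>
    lt_of_lt_of_le (mul_pos (by positivity) (legendre_sq_add_sq_pos z n)) (hlow n hn)
  -- The factor `u_n = 1 + 1/(n+1)` solves `u_{n+1} = (1 - 1/(n+2)²) u_n`, so the comparison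
  -- telescopes.
  have hmono : ∀ n ≥ n₀, sonin z n₀ / 2 * (1 + 1 / (n + 1)) ≤ sonin z n := by
    intro n hn
    induction n, hn using Nat.le_induction with
    | base =>
      have h1 : 1 / ((n₀ : ℝ) + 1) ≤ 1 := by
        rw [div_le_one (by positivity)]; linarith [(Nat.cast_nonneg n₀ : (0 : ℝ) ≤ n₀)]
      have := hpos n₀ le_rfl
      nlinarith
    | succ n hn ih =>
      have h1 : 8 / ((4 * n + 2) * (4 * n + 10)) * (legendre (n + 1)).eval z ^ 2 ≤
          1 / ((n : ℝ) + 2) ^ 2 * sonin z n := by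
        have h2 : 2 * (legendre (n + 1)).eval z ^ 2 ≤ sonin z n := by
          refine le_trans ?_ (hlow n hn)
          have := hge n hn
          nlinarith [sq_nonneg ((legendre n).eval z), sq_nonneg ((legendre (n + 1)).eval z)]
        have h3 : 8 / ((4 * (n : ℝ) + 2) * (4 * n + 10)) ≤ 2 * (1 / ((n : ℝ) + 2) ^ 2) := by
          rw [mul_one_div, div_le_div_iff₀ (by positivity) (by positivity)]
          nlinarith [(Nat.cast_nonneg n : (0 : ℝ) ≤ n)]
        calc _ ≤ 2 * (1 / ((n : ℝ) + 2) ^ 2) * (legendre (n + 1)).eval z ^ 2 := by gcongr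
          _ = 1 / ((n : ℝ) + 2) ^ 2 * (2 * (legendre (n + 1)).eval z ^ 2) := by ring
          _ ≤ _ := by gcongr
      rw [sonin_succ]
      have h4 : (1 - 1 / ((n : ℝ) + 2) ^ 2) * (sonin z n₀ / 2 * (1 + 1 / (n + 1))) ≤
          (1 - 1 / ((n : ℝ) + 2) ^ 2) * sonin z n := by
        apply mul_le_mul_of_nonneg_left ih
        rw [sub_nonneg, div_le_one (by positivity)]
        nlinarith [(Nat.cast_nonneg n : (0 : ℝ) ≤ n)]
      have h5 : (1 - 1 / ((n : ℝ) + 2) ^ 2) * (1 + 1 / (n + 1)) = 1 + 1 / (((n + 1 : ℕ) : ℝ) + 1) := by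
        push_cast
        field_simp
        ring
      rw [← h5]
      linarith
  refine ⟨sonin z n₀ / 8, sonin z n₀ / κ, by have := hpos n₀ le_rfl; positivity,
    div_pos (hpos n₀ le_rfl) hκ0, n₀, fun n hn => ⟨?_, ?_⟩⟩
  · rw [le_div_iff₀ hκ0]
    have := (hlow n hn).trans (sonin_antitone z hn)
    nlinarith [mul_nonneg (mul_nonneg (by positivity : (0 : ℝ) ≤ n + 1) hκ0.le)
      (sq_nonneg ((legendre (n + 1)).eval z))]
  · have h1 := sonin_le z hz.le n
    have h2 := hmono n hn
    have h3 : 0 ≤ sonin z n₀ / 2 * (1 / ((n : ℝ) + 1)) := by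
      have := hpos n₀ le_rfl; positivity
    linarith

end SPHAR


/-! ### Growth of the normalizer, truncation bias and size of the truncation level. -/

namespace SPHAR

lemma normalizer_eq (L : ℕ) (z : ℝ) :
    normalizer L z =
      (∑ l ∈ Finset.range (L + 1), (2 * (l : ℝ) + 1) * ((legendre l).eval z) ^ 2) /
        (16 * Real.pi ^ 2) := by
  rw [normalizer, Finset.sum_div]
  exact Finset.sum_congr rfl fun l _ => by ring

lemma normalizer_pos (L : ℕ) (z : ℝ) : 0 < normalizer L z := by
  rw [normalizer, Finset.sum_range_succ']
  have h : 0 < (2 * ((0 : ℕ) : ℝ) + 1) / (16 * Real.pi ^ 2) * (legendre 0).eval z ^ 2 := by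
    simp [legendre_zero]; positivity
  have : 0 ≤ ∑ l ∈ Finset.range L, (2 * ((l + 1 : ℕ) : ℝ) + 1) / (16 * Real.pi ^ 2) *
      (legendre (l + 1)).eval z ^ 2 := Finset.sum_nonneg fun l _ => by positivity
  linarith

/-- Since individual terms may vanish, the sum is bounded below two terms at a time. -/
lemma sum_range_ge_of_pair {q : ℕ → ℝ} (hq : ∀ n, 0 ≤ q n) {c : ℝ} (hc : 0 ≤ c) {n₀ : ℕ}
    (h : ∀ n ≥ n₀, c ≤ q n + q (n + 1)) (M : ℕ) :
    c * ((M : ℝ) - n₀ - 1) / 2 ≤ ∑ l ∈ Finset.range M, q l := by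
  induction M using Nat.twoStepInduction with
  | zero => 
    simp; nlinarith [mul_nonneg hc (Nat.cast_nonneg n₀ : (0 : ℝ) ≤ n₀)]
  | one => 
    have := hq 0
    simp; nlinarith [mul_nonneg hc (Nat.cast_nonneg n₀ : (0 : ℝ) ≤ n₀)]
  | more n h1 _ =>
    rw [Finset.sum_range_succ, Finset.sum_range_succ]
    by_cases hn : n₀ ≤ n
    · have := h n hn
      push_cast
      linarith
    · have h3 : ((n : ℝ) + 2) - n₀ - 1 ≤ 0 := by
        have : (n : ℝ) + 1 ≤ n₀ := by exact_mod_cast (by omega : n + 1 ≤ n₀)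
        linarith
      have h4 : 0 ≤ ∑ l ∈ Finset.range n, q l := Finset.sum_nonneg fun i _ => hq i
      have := hq n
      have := hq (n + 1)
      push_cast
      nlinarith

/-- Inside the interval `P_l = O(l^{-1/2})` and consecutive pairs are that large, so `s = 1/2`; at
the endpoints `|P_l| = 1`, so `s = 1`. What matters is that the same `s` governs the zonal functions
and the square root of the normalizer, so that it cancels in the bias. -/
lemma zonal_growth {z : ℝ} (hz : z ∈ Set.Icc (-1 : ℝ) 1) :
    ∃ s c C : ℝ, 0 < s ∧ s ≤ 1 ∧ 0 < c ∧ 0 < C ∧ ∀ᶠ l : ℕ in atTop,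
      |zonal l z| ≤ C * (l : ℝ) ^ s ∧ c * (l : ℝ) ^ (2 * s) ≤ normalizer l z := by
  by_cases h1 : |z| < 1
  · obtain ⟨c, C, hc, hC, n₀, h⟩ := legendre_sq_growth h1
    refine ⟨1 / 2, c / (4 * (16 * Real.pi ^ 2)), 3 / (4 * Real.pi) * √C, by norm_num, by norm_num,
      by positivity, by positivity, ?_⟩
    -- Beyond `2 n₀` the loss from the first `n₀` terms is at most half: `l - n₀ ≥ l/2`.
    filter_upwards [eventually_ge_atTop (2 * n₀ + 1)] with l hl
    have hl1 : (1 : ℝ) ≤ l := by exact_mod_cast (by omega : 1 ≤ l)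
    constructor
    · have h2 := (h l (by omega)).1
      rw [zonal, abs_mul, abs_of_pos (by positivity), ← Real.sqrt_eq_rpow]
      have h3 : √(l : ℝ) * |(legendre l).eval z| ≤ √C := by
        rw [← Real.sqrt_sq_eq_abs, ← Real.sqrt_mul (by positivity)]
        apply Real.sqrt_le_sqrt
        nlinarith [sq_nonneg ((legendre l).eval z)]
      have h4 : (2 * (l : ℝ) + 1) ≤ 3 * (√l * √l) := by
        rw [Real.mul_self_sqrt (by positivity)]; linarith
      calc (2 * (l : ℝ) + 1) / (4 * Real.pi) * |(legendre l).eval z|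
          ≤ (3 * (√l * √l)) / (4 * Real.pi) * |(legendre l).eval z| := by gcongr
        _ = 3 / (4 * Real.pi) * √l * (√l * |(legendre l).eval z|) := by ring
        _ ≤ 3 / (4 * Real.pi) * √l * √C := by gcongr
        _ = _ := by ring
    · rw [normalizer_eq, show (2 : ℝ) * (1 / 2) = 1 by norm_num, Real.rpow_one]
      rw [div_mul_eq_mul_div, mul_comm 4, ← div_div]
      have h5 := sum_range_ge_of_pair
        (q := fun l => (2 * (l : ℝ) + 1) * ((legendre l).eval z) ^ 2)
        (fun n => by positivity) hc.le (n₀ := n₀) (fun n hn => by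
          have := (h n hn).2
          push_cast
          nlinarith [mul_nonneg (Nat.cast_nonneg n : (0 : ℝ) ≤ n) (sq_nonneg ((legendre n).eval z)),
            mul_nonneg (Nat.cast_nonneg n : (0 : ℝ) ≤ n) (sq_nonneg ((legendre (n + 1)).eval z)),
            sq_nonneg ((legendre (n + 1)).eval z)]) (l + 1)
      have h6 : 2 * (n₀ : ℝ) + 1 ≤ l := by exact_mod_cast hl
      have h7 : c * l / 4 ≤ c * (((l + 1 : ℕ) : ℝ) - n₀ - 1) / 2 := by
        push_cast
        nlinarith
      rw [div_right_comm]
      gcongr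
      exact h7.trans h5
  · have hsq : ∀ l : ℕ, (legendre l).eval z ^ 2 = 1 := by
      intro l
      have : z = 1 ∨ z = -1 := by
        have := abs_le.2 hz
        have h2 : |z| = 1 := le_antisymm this (not_lt.1 h1)
        exact (abs_eq zero_le_one).1 h2
      rcases this with rfl | rfl
      · simp [legendre_eval_one]
      · rw [legendre_eval_neg, legendre_eval_one, mul_one, ← pow_mul, mul_comm, pow_mul]; simp
    refine ⟨1, 1 / (16 * Real.pi ^ 2), 3 / (4 * Real.pi), by norm_num, by norm_num, by positivity,
      by positivity, ?_⟩
    filter_upwards [eventually_ge_atTop 1] with l hl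
    have hl1 : (1 : ℝ) ≤ l := by exact_mod_cast hl
    constructor
    · rw [zonal, abs_mul, abs_of_pos (by positivity), ← Real.sqrt_sq_eq_abs, hsq, Real.sqrt_one,
        mul_one, Real.rpow_one, div_mul_eq_mul_div]
      gcongr
      linarith
    · rw [normalizer_eq, mul_one, one_div_mul_eq_div]
      simp only [hsq, mul_one]
      gcongr
      have : ∀ M : ℕ, ∑ l ∈ Finset.range M, (2 * (l : ℝ) + 1) = (M : ℝ) ^ 2 := by
        intro M
        induction M with
        | zero => simp
        | succ M ih => rw [Finset.sum_range_succ, ih]; push_cast; ring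
      rw [this, show (2 : ℝ) = ((2 : ℕ) : ℝ) by norm_num, Real.rpow_natCast]
      push_cast
      nlinarith

lemma tendsto_normalizer {z : ℝ} (hz : z ∈ Set.Icc (-1 : ℝ) 1) :
    Tendsto (fun L => normalizer L z) atTop atTop := by
  obtain ⟨s, c, C, hs, -, hc, -, h⟩ := zonal_growth hz
  refine tendsto_atTop_mono' _ (h.mono fun _ h => h.2) ?_
  exact ((tendsto_rpow_atTop (by positivity)).comp tendsto_natCast_atTop_atTop).const_mul_atTop hc

lemma sum_rpow_tail_le {α : ℝ} (hα : 1 < α) {a b : ℕ} (ha : 0 < a) (hab : a ≤ b) :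
    ∑ i ∈ Finset.Ico a b, (((i + 1 : ℕ) : ℝ)) ^ (-α) ≤ (a : ℝ) ^ (1 - α) / (α - 1) := by
  have h1 := AntitoneOn.sum_le_integral_Ico (f := fun x : ℝ => x ^ (-α)) hab (by
    intro x hx y hy hxy
    have hx0 : (0 : ℝ) < x := lt_of_lt_of_le (by exact_mod_cast ha) hx.1
    exact Real.rpow_le_rpow_of_nonpos hx0 hxy (by linarith))
  refine h1.trans ?_
  have ha' : (0 : ℝ) < a := by exact_mod_cast ha
  have hab' : (a : ℝ) ≤ b := by exact_mod_cast hab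
  rw [integral_rpow (Or.inr ⟨by linarith, by
    rw [Set.uIcc_of_le hab']; exact fun h => absurd h.1 (not_le.2 ha')⟩)]
  rw [show -α + 1 = -(α - 1) by ring, div_neg, ← neg_div, neg_sub, neg_sub]
  have : 0 ≤ (b : ℝ) ^ (1 - α) := by positivity
  have : 0 < α - 1 := by linarith
  gcongr
  linarith

/-- The truncation error of a smooth kernel is `O(L^{s+1-β})`. -/
lemma abs_sub_sum_le_of_smooth {z s C β γ kz : ℝ} {φ : ℕ → ℝ} (hβ : 1 < β - s) (hC : 0 ≤ C)
    {n₀ : ℕ} (hz : ∀ l ≥ n₀, |zonal l z| ≤ C * (l : ℝ) ^ s)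
    (hφ : ∀ l : ℕ, 0 < l → |φ l| ≤ γ / (l : ℝ) ^ β)
    (hk : HasSum (fun l => φ l * zonal l z) kz) (L : ℕ) (hL : 0 < L) (hLn : n₀ ≤ L) :
    |kz - ∑ l ∈ Finset.range (L + 1), φ l * zonal l z| ≤
      γ * C / (β - s - 1) * (L : ℝ) ^ (s + 1 - β) := by
  have hγ : 0 ≤ γ := by
    have := (abs_nonneg _).trans (hφ 1 one_pos)
    simpa using this
  have ht := ((hk.tendsto_sum_nat.sub_const
    (∑ l ∈ Finset.range (L + 1), φ l * zonal l z)).abs)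
  refine le_of_tendsto ht ?_
  filter_upwards [eventually_ge_atTop (L + 1)] with M hM
  obtain ⟨M, rfl⟩ : ∃ M', M = M' + 1 := ⟨M - 1, by omega⟩
  rw [← Finset.sum_Ico_eq_sub _ hM]
  refine (Finset.abs_sum_le_sum_abs _ _).trans ?_
  rw [← Finset.sum_Ico_add' (fun l => |φ l * zonal l z|) L M 1]
  have : ∀ i ∈ Finset.Ico L M, |φ (i + 1) * zonal (i + 1) z| ≤
      γ * C * (((i + 1 : ℕ) : ℝ)) ^ (-(β - s)) := by
    intro i hi
    have hi' := Finset.mem_Ico.1 hi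
    rw [abs_mul]
    have h1 := hφ (i + 1) (Nat.succ_pos i)
    have h2 := hz (i + 1) (by omega)
    calc _ ≤ γ / (((i + 1 : ℕ) : ℝ)) ^ β * (C * (((i + 1 : ℕ) : ℝ)) ^ s) := by gcongr
      _ = _ := by
        rw [show -(β - s) = s - β by ring, Real.rpow_sub (by positivity)]
        ring
  refine (Finset.sum_le_sum this).trans ?_
  rw [← Finset.mul_sum]
  have h3 := sum_rpow_tail_le hβ hL (by omega : L ≤ M)
  calc _ ≤ γ * C * ((L : ℝ) ^ (1 - (β - s)) / (β - s - 1)) := by gcongr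
    _ = _ := by rw [show 1 - (β - s) = s + 1 - β by ring]; ring

lemma tendsto_of_isTheta_rpow {d : ℝ} (hd0 : 0 < d) {L : ℕ → ℕ}
    (hL : (fun N : ℕ => (L N : ℝ)) =Θ[atTop] (fun N : ℕ => (N : ℝ) ^ d)) :
    Tendsto L atTop atTop := by
  obtain ⟨c₁, hc₁, hL1⟩ := hL.2.exists_pos
  rw [Asymptotics.isBigOWith_iff] at hL1
  have h1 : Tendsto (fun N : ℕ => (1 / c₁) * (N : ℝ) ^ d) atTop atTop :=
    ((tendsto_rpow_atTop hd0).comp tendsto_natCast_atTop_atTop).const_mul_atTop (by positivity)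
  refine tendsto_natCast_atTop_iff.1 (tendsto_atTop_mono' _ ?_ h1)
  filter_upwards [hL1] with N hN
  rw [Real.norm_of_nonneg (by positivity), Real.norm_of_nonneg (by positivity)] at hN
  rw [one_div_mul_eq_div, div_le_iff₀ hc₁]
  linarith

/-- The bias of the truncated kernel is negligible at the scale of the limit theorem. -/
lemma tendsto_bias {z : ℝ} (hz : z ∈ Set.Icc (-1 : ℝ) 1) {β γ d kz : ℝ} {φ : ℕ → ℝ} (hβ : 2 < β)
    (hφ : ∀ l : ℕ, 0 < l → |φ l| ≤ γ / (l : ℝ) ^ β)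
    (hk : HasSum (fun l => φ l * zonal l z) kz) {L : ℕ → ℕ}
    (hd : 1 / (2 * β - 2) < d)
    (hL : (fun N : ℕ => (L N : ℝ)) =Θ[atTop] (fun N : ℕ => (N : ℝ) ^ d)) :
    Tendsto (fun N : ℕ => √((N : ℝ) / normalizer (L N) z) *
      (kz - ∑ l ∈ Finset.range (L N + 1), φ l * zonal l z)) atTop (𝓝 0) := by
  obtain ⟨s, c, C, hs, hs1, hc, hC, h⟩ := zonal_growth hz
  obtain ⟨n₀, hn₀⟩ := eventually_atTop.1 h
  have hγ : 0 ≤ γ := by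
    have := (abs_nonneg _).trans (hφ 1 one_pos)
    simpa using this
  have hd0 : 0 < d := lt_of_le_of_lt (by apply div_nonneg zero_le_one; linarith) hd
  obtain ⟨c₁, hc₁, hL1⟩ := hL.2.exists_pos
  rw [Asymptotics.isBigOWith_iff] at hL1
  have hLtop' := tendsto_of_isTheta_rpow hd0 hL
  set D := γ * C / (β - s - 1) with hD
  have hD0 : 0 ≤ D := by
    rw [hD]; apply div_nonneg (by positivity); linarith
  -- After cancellation of `s` the standardized bias is of order `√N L^{1-β}`; negativity of its
  -- exponent in `N` is precisely `d > 1/(2β-2)`.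
  have hexp : 1 / 2 + d * (1 - β) < 0 := by
    rw [div_lt_iff₀ (by linarith)] at hd
    linarith
  have hlim : Tendsto (fun N : ℕ => (D / √c * c₁ ^ (β - 1)) * (N : ℝ) ^ (1 / 2 + d * (1 - β)))
      atTop (𝓝 0) := by
    have h1 : Tendsto (fun N : ℕ => (N : ℝ) ^ (-(-(1 / 2 + d * (1 - β))))) atTop (𝓝 0) :=
      (tendsto_rpow_neg_atTop (by linarith)).comp tendsto_natCast_atTop_atTop
    have h2 := h1.const_mul (D / √c * c₁ ^ (β - 1))
    simpa using h2
  refine squeeze_zero_norm' ?_ hlim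
  filter_upwards [hL1, hLtop'.eventually_ge_atTop (n₀ + 1), eventually_ge_atTop 1] with N hN hLN hN1
  rw [Real.norm_of_nonneg (by positivity), Real.norm_of_nonneg (by positivity)] at hN
  have hN0 : (0 : ℝ) < N := by exact_mod_cast hN1
  have hL0 : (0 : ℝ) < L N := by exact_mod_cast (by omega : 0 < L N)
  rw [norm_mul, Real.norm_of_nonneg (by positivity), Real.norm_eq_abs]
  have hb := abs_sub_sum_le_of_smooth (by linarith) hC.le (fun l hl => (hn₀ l hl).1) hφ hk (L N)
    (by omega) (by omega)
  rw [← hD] at hb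
  have hnorm := (hn₀ (L N) (by omega)).2
  have h1 : √((N : ℝ) / normalizer (L N) z) ≤ √N / (√c * (L N : ℝ) ^ s) := by
    rw [Real.sqrt_div hN0.le]
    have : √c * (L N : ℝ) ^ s ≤ √(normalizer (L N) z) := by
      apply Real.le_sqrt_of_sq_le
      rw [mul_pow, Real.sq_sqrt hc.le, ← Real.rpow_natCast, ← Real.rpow_mul hL0.le, mul_comm s]
      exact_mod_cast hnorm
    gcongr
  have h2 : (L N : ℝ) ^ (1 - β) ≤ c₁ ^ (β - 1) * (N : ℝ) ^ (d * (1 - β)) := by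
    have h3 : (N : ℝ) ^ d / c₁ ≤ L N := by rw [div_le_iff₀ hc₁]; linarith
    calc (L N : ℝ) ^ (1 - β) ≤ ((N : ℝ) ^ d / c₁) ^ (1 - β) :=
          Real.rpow_le_rpow_of_nonpos (by positivity) h3 (by linarith)
      _ = _ := by
        rw [Real.div_rpow (by positivity) hc₁.le, ← Real.rpow_mul hN0.le,
          show (1 - β) = -(β - 1) by ring, Real.rpow_neg hc₁.le, div_inv_eq_mul]
        ring
  calc _ ≤ √N / (√c * (L N : ℝ) ^ s) * (D * (L N : ℝ) ^ (s + 1 - β)) := by gcongr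
    _ = √N * (D / √c) * (L N : ℝ) ^ (1 - β) := by
      rw [show s + 1 - β = (1 - β) + s by ring, Real.rpow_add hL0]
      have : (L N : ℝ) ^ s ≠ 0 := by positivity
      field_simp
    _ ≤ √N * (D / √c) * (c₁ ^ (β - 1) * (N : ℝ) ^ (d * (1 - β))) := by gcongr
    _ = _ := by
      rw [Real.rpow_add hN0, ← Real.sqrt_eq_rpow]; ring

/-- `∑_{l ≤ L_N} 1/(2l+1) = o(N)` when `L_N` grows polynomially. -/
lemma tendsto_sum_inv_div {d : ℝ} {L : ℕ → ℕ}
    (hL : (fun N : ℕ => (L N : ℝ)) =Θ[atTop] (fun N : ℕ => (N : ℝ) ^ d)) :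
    Tendsto (fun N : ℕ => (∑ l ∈ Finset.range (L N + 1), 1 / (2 * (l : ℝ) + 1)) / N) atTop
      (𝓝 0) := by
  obtain ⟨c₁, hc₁, hL1⟩ := hL.1.exists_pos
  rw [Asymptotics.isBigOWith_iff] at hL1
  have hlog : Tendsto (fun N : ℕ => (1 + Real.log (c₁ + 1)) * (N : ℝ)⁻¹ + |d| * (Real.log N / N))
      atTop (𝓝 0) := by
    have h1 : Tendsto (fun N : ℕ => (N : ℝ)⁻¹) atTop (𝓝 0) := tendsto_inv_atTop_nhds_zero_nat
    have h2 : Tendsto (fun N : ℕ => Real.log N / N) atTop (𝓝 0) := by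
      have := (Real.isLittleO_log_id_atTop.tendsto_div_nhds_zero).comp tendsto_natCast_atTop_atTop
      exact this
    have := (h1.const_mul (1 + Real.log (c₁ + 1))).add (h2.const_mul |d|)
    simpa using this
  refine squeeze_zero' (Eventually.of_forall fun N => by positivity) ?_ hlog
  filter_upwards [hL1, eventually_ge_atTop 1] with N hN hN1
  have hN0 : (1 : ℝ) ≤ N := by exact_mod_cast hN1
  rw [Real.norm_of_nonneg (by positivity), Real.norm_of_nonneg (by positivity)] at hN
  have h3 : ∑ l ∈ Finset.range (L N + 1), 1 / (2 * (l : ℝ) + 1) ≤ 1 + Real.log (L N + 1) := by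
    have := harmonic_le_one_add_log (L N + 1)
    rw [harmonic] at this
    push_cast at this
    refine le_trans (Finset.sum_le_sum fun l _ => ?_) this
    rw [one_div]
    gcongr
    linarith [(Nat.cast_nonneg l : (0 : ℝ) ≤ l)]
  have h4 : Real.log (L N + 1) ≤ Real.log (c₁ + 1) + |d| * Real.log N := by
    rw [← Real.log_rpow (by linarith), ← Real.log_mul (by positivity) (by positivity)]
    apply Real.log_le_log (by positivity)
    have h5 : (N : ℝ) ^ d ≤ (N : ℝ) ^ |d| := Real.rpow_le_rpow_of_exponent_le hN0 (le_abs_self d)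
    have h6 : 1 ≤ (N : ℝ) ^ |d| := Real.one_le_rpow hN0 (abs_nonneg d)
    nlinarith
  calc _ ≤ (1 + (Real.log (c₁ + 1) + |d| * Real.log N)) / N := by gcongr; linarith
    _ = _ := by ring

end SPHAR


/-! ### Surface measure: rotation invariance and moments of a coordinate. -/

namespace SPHAR

instance : IsFiniteMeasure surface := by unfold surface; infer_instance

/-- The action of a linear isometry on the sphere. -/
noncomputable def rot (U : EuclideanSpace ℝ (Fin 3) ≃ₗᵢ[ℝ] EuclideanSpace ℝ (Fin 3)) (y : S2) : S2 :=
  ⟨U y, by simp⟩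

lemma continuous_rot (U : EuclideanSpace ℝ (Fin 3) ≃ₗᵢ[ℝ] EuclideanSpace ℝ (Fin 3)) :
    Continuous (rot U) := by
  unfold rot; fun_prop

-- The surface measure of a set is read off from the volume of the cone over it. Invariance under
-- isometries thus reduces to that of volume, once cones are seen to commute with isometries.
open scoped Pointwise in
lemma rot_image (U : EuclideanSpace ℝ (Fin 3) ≃ₗᵢ[ℝ] EuclideanSpace ℝ (Fin 3)) (s : Set S2) :
    Set.Ioo (0 : ℝ) 1 • ((Subtype.val '' (rot U ⁻¹' s) : Set (EuclideanSpace ℝ (Fin 3)))) =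
      U ⁻¹' (Set.Ioo (0 : ℝ) 1 • (Subtype.val '' s)) := by
  ext v
  simp only [Set.mem_smul, Set.mem_image, Set.mem_preimage]
  constructor
  · rintro ⟨r, hr, _, ⟨y, hy, rfl⟩, rfl⟩
    exact ⟨r, hr, _, ⟨rot U y, hy, rfl⟩, by simp [rot]⟩
  · rintro ⟨r, hr, _, ⟨y, hy, rfl⟩, h⟩
    refine ⟨r, hr, _, ⟨rot U.symm y, ?_, rfl⟩, ?_⟩
    · have : rot U (rot U.symm y) = y := by ext; simp [rot]
      rwa [this]
    · apply U.injective
      rw [← h]; simp [rot]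

lemma measurePreserving_rot (U : EuclideanSpace ℝ (Fin 3) ≃ₗᵢ[ℝ] EuclideanSpace ℝ (Fin 3)) :
    MeasurePreserving (rot U) surface surface := by
  refine ⟨(continuous_rot U).measurable, ?_⟩
  ext s hs
  rw [Measure.map_apply (continuous_rot U).measurable hs, surface,
    Measure.toSphere_apply' _ hs, Measure.toSphere_apply' _ ((continuous_rot U).measurable hs),
    rot_image]
  congr 1
  exact (U.measurePreserving).measure_preimage_equiv (f := U.toHomeomorph.toMeasurableEquiv) _

lemma integral_comp_rot (U : EuclideanSpace ℝ (Fin 3) ≃ₗᵢ[ℝ] EuclideanSpace ℝ (Fin 3))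
    (f : S2 → ℝ) : ∫ y, f (rot U y) ∂surface = ∫ y, f y ∂surface := by
  let e : S2 ≃ₜ S2 := 
    { toFun := rot U, invFun := rot U.symm, left_inv := fun y => by ext; simp [rot]
      right_inv := fun y => by ext; simp [rot]
      continuous_toFun := continuous_rot U, continuous_invFun := continuous_rot _ }
  exact (measurePreserving_rot U).integral_comp e.measurableEmbedding f

/-- Half of the Gaussian moment of order `n`. -/
noncomputable def halfGaussianMoment (n : ℕ) : ℝ :=
  ∫ r in Set.Ioi (0 : ℝ), r ^ n * Real.exp (-(1 / 2) * r ^ 2)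

lemma halfGaussianMoment_eq (n : ℕ) : halfGaussianMoment n =
    (1 / 2 : ℝ) ^ (-((n : ℝ) + 1) / 2) * (1 / 2) * Real.Gamma (((n : ℝ) + 1) / 2) := by
  rw [← integral_rpow_mul_exp_neg_mul_rpow (by norm_num) (by linarith [(Nat.cast_nonneg n : (0:ℝ) ≤ n)])
    (by norm_num), halfGaussianMoment]
  simp

lemma halfGaussianMoment_pos (n : ℕ) : 0 < halfGaussianMoment n := by
  rw [halfGaussianMoment_eq]
  have : 0 < Real.Gamma (((n : ℝ) + 1) / 2) := Real.Gamma_pos_of_pos (by positivity)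
  positivity

lemma halfGaussianMoment_add_two (n : ℕ) :
    halfGaussianMoment (n + 2) = (n + 1) * halfGaussianMoment n := by
  rw [halfGaussianMoment_eq, halfGaussianMoment_eq]
  push_cast
  rw [show ((n : ℝ) + 2 + 1) / 2 = ((n : ℝ) + 1) / 2 + 1 by ring, Real.Gamma_add_one (by positivity),
    show -((n : ℝ) + 2 + 1) / 2 = -((n : ℝ) + 1) / 2 - 1 by ring, Real.rpow_sub (by norm_num),
    Real.rpow_one]
  ring

lemma integral_pow_mul_exp (n : ℕ) :
    ∫ r : ℝ, r ^ n * Real.exp (-(1 / 2) * r ^ 2) = (1 + (-1) ^ n) * halfGaussianMoment n := by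
  have hint : Integrable (fun r : ℝ => r ^ n * Real.exp (-(1 / 2) * r ^ 2)) := by
    have := integrable_rpow_mul_exp_neg_mul_sq (b := 1 / 2) (by norm_num) (s := n)
      (by linarith [(Nat.cast_nonneg n : (0:ℝ) ≤ n)])
    simpa using this
  rw [← intervalIntegral.integral_Iic_add_Ioi (b := 0) hint.integrableOn hint.integrableOn]
  have h := integral_comp_neg_Ioi 0 (fun r : ℝ => r ^ n * Real.exp (-(1 / 2) * r ^ 2))
  rw [neg_zero] at h
  rw [← h, halfGaussianMoment, add_mul, one_mul, ← integral_const_mul, add_comm]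
  congr 2
  ext r
  rw [neg_pow r, neg_sq]; ring

/-- Polar coordinates for a Gaussian weight: homogeneity contributes `r^n` and the Jacobian `r²`,
hence the moment of order `n + 2`. Computing the same integral in Cartesian coordinates then
determines the spherical moment. -/
lemma integral_sphere_mul_halfGaussianMoment (n : ℕ) :
    (∫ y : S2, (y : EuclideanSpace ℝ (Fin 3)) 0 ^ n ∂surface) * halfGaussianMoment (n + 2) =
      ∫ v : EuclideanSpace ℝ (Fin 3), v 0 ^ n * Real.exp (-(1 / 2) * ‖v‖ ^ 2) := by
  set f : EuclideanSpace ℝ (Fin 3) → ℝ := fun v => v 0 ^ n * Real.exp (-(1 / 2) * ‖v‖ ^ 2) with hf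
  have h1 := (volume : Measure (EuclideanSpace ℝ (Fin 3))).measurePreserving_homeomorphUnitSphereProd
  have h2 := h1.symm (e := (homeomorphUnitSphereProd (EuclideanSpace ℝ (Fin 3))).toMeasurableEquiv)
  have h3 := h2.integral_comp
    (homeomorphUnitSphereProd (EuclideanSpace ℝ (Fin 3))).symm.measurableEmbedding
    (fun v => f v)
  have h4 : ∫ v : EuclideanSpace ℝ (Fin 3), f v =
      ∫ v : ({(0)}ᶜ : Set (EuclideanSpace ℝ (Fin 3))), f v ∂(volume.comap Subtype.val) := by
    rw [integral_subtype_comap (measurableSet_singleton _).compl, restrict_compl_singleton]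
  rw [h4, ← h3]
  have h5 : ∀ q : S2 × Set.Ioi (0 : ℝ),
      f ((homeomorphUnitSphereProd (EuclideanSpace ℝ (Fin 3))).toMeasurableEquiv.symm q) =
      ((q.1 : EuclideanSpace ℝ (Fin 3)) 0 ^ n) *
        ((q.2 : ℝ) ^ n * Real.exp (-(1 / 2) * (q.2 : ℝ) ^ 2)) := by
    intro q
    have : ((homeomorphUnitSphereProd (EuclideanSpace ℝ (Fin 3))).toMeasurableEquiv.symm q :
        EuclideanSpace ℝ (Fin 3)) = (q.2 : ℝ) • (q.1 : EuclideanSpace ℝ (Fin 3)) :=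
      homeomorphUnitSphereProd_symm_apply_coe _ q
    rw [this, hf]
    have h6 : ‖(q.1 : EuclideanSpace ℝ (Fin 3))‖ = 1 := by simp
    simp only [PiLp.smul_apply, smul_eq_mul, norm_smul, h6, mul_one, Real.norm_eq_abs, sq_abs,
      mul_pow]
    ring
  simp_rw [h5]
  rw [integral_prod_mul (fun y : S2 => (y : EuclideanSpace ℝ (Fin 3)) 0 ^ n)
    (fun r : Set.Ioi (0 : ℝ) => (r : ℝ) ^ n * Real.exp (-(1 / 2) * (r : ℝ) ^ 2))]
  congr 1
  simp only [Measure.volumeIoiPow, ENNReal.ofReal]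
  rw [integral_withDensity_eq_integral_smul (by
    exact (measurable_subtype_coe.pow_const _).real_toNNReal)]
  rw [integral_subtype_comap measurableSet_Ioi fun a : ℝ ↦
    Real.toNNReal (a ^ (Module.finrank ℝ (EuclideanSpace ℝ (Fin 3)) - 1)) •
      (a ^ n * Real.exp (-(1 / 2) * a ^ 2)), halfGaussianMoment]
  refine setIntegral_congr_fun measurableSet_Ioi fun x hx ↦ ?_
  simp only [finrank_euclideanSpace, Fintype.card_fin, Nat.add_one_sub_one]
  rw [NNReal.smul_def, Real.coe_toNNReal _ (pow_nonneg (le_of_lt hx) _), smul_eq_mul]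
  ring

lemma integral_coord_pow_mul_exp (n : ℕ) :
    ∫ v : EuclideanSpace ℝ (Fin 3), v 0 ^ n * Real.exp (-(1 / 2) * ‖v‖ ^ 2) =
      (1 + (-1) ^ n) * halfGaussianMoment n * (2 * Real.pi) := by
  have h := (EuclideanSpace.volume_preserving_symm_measurableEquiv_toLp (Fin 3)).symm.integral_comp
    (MeasurableEquiv.measurableEmbedding _)
    (fun v : EuclideanSpace ℝ (Fin 3) => v 0 ^ n * Real.exp (-(1 / 2) * ‖v‖ ^ 2))
  rw [← h]
  have h2 := integral_fintype_prod_volume_eq_prod (𝕜 := ℝ) (ι := Fin 3) (E := fun _ => ℝ)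
    (fun i r => (if i = 0 then r ^ n else 1) * Real.exp (-(1 / 2) * r ^ 2))
  have h3 : ∫ r : ℝ, Real.exp (-(1 / 2) * r ^ 2) = √(2 * Real.pi) := by
    rw [integral_gaussian]; congr 1; ring
  simp only [Fin.prod_univ_three, if_true, show (1 : Fin 3) ≠ 0 by decide,
    show (2 : Fin 3) ≠ 0 by decide, if_false, one_mul, h3] at h2
  rw [integral_pow_mul_exp, mul_assoc, Real.mul_self_sqrt (by positivity)] at h2
  rw [← h2]
  congr 1
  ext v
  simp [EuclideanSpace.norm_sq_eq, Fin.sum_univ_three, mul_add, Real.exp_add]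
  ring

/-- Both orthogonal pairs extend to orthonormal bases, and the isometry maps one basis to the other.
It makes integrals depending only on such a pair constant. -/
lemma exists_rot_pair {x e x' e' : S2} (h : dot x e = 0) (h' : dot x' e' = 0) :
    ∃ U : EuclideanSpace ℝ (Fin 3) ≃ₗᵢ[ℝ] EuclideanSpace ℝ (Fin 3), rot U x = x' ∧ rot U e = e' := by
  have key : ∀ x e : S2, dot x e = 0 → ∃ b : OrthonormalBasis (Fin 3) ℝ (EuclideanSpace ℝ (Fin 3)),
      b 0 = x ∧ b 1 = e := by
    intro x e h
    let v : Fin 3 → EuclideanSpace ℝ (Fin 3) := ![x, e, 0]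
    obtain ⟨b, hb⟩ := Orthonormal.exists_orthonormalBasis_extension_of_card_eq (𝕜 := ℝ)
      (E := EuclideanSpace ℝ (Fin 3)) (ι := Fin 3) (by simp) (v := v) (s := {0, 1}) (by
        rw [orthonormal_iff_ite]
        have h2 : inner ℝ (e : EuclideanSpace ℝ (Fin 3)) (x : EuclideanSpace ℝ (Fin 3)) = 0 := by
          rw [real_inner_comm]; exact h
        have h3 : inner ℝ (x : EuclideanSpace ℝ (Fin 3)) (e : EuclideanSpace ℝ (Fin 3)) = 0 := h
        rintro ⟨i, rfl | rfl⟩ ⟨j, rfl | rfl⟩ <;> simp [v, h2, h3, Subtype.ext_iff])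
    exact ⟨b, hb 0 (by simp), hb 1 (by simp)⟩
  obtain ⟨b, hb0, hb1⟩ := key x e h
  obtain ⟨b', hb0', hb1'⟩ := key x' e' h'
  refine ⟨b.equiv b' (Equiv.refl _), ?_, ?_⟩
  · ext1; rw [← hb0', rot]; simp only [← hb0]; simp
  · ext1; rw [← hb1', rot]; simp only [← hb1]; simp

lemma exists_orthogonal (x : S2) : ∃ e : S2, dot x e = 0 := by
  have h : 0 < Module.finrank ℝ (ℝ ∙ (x : EuclideanSpace ℝ (Fin 3)))ᗮ := by
    have := Submodule.finrank_add_finrank_orthogonal (ℝ ∙ (x : EuclideanSpace ℝ (Fin 3)))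
    have h2 := finrank_span_le_card (R := ℝ) ({(x : EuclideanSpace ℝ (Fin 3))} : Set _)
    simp at this h2
    omega
  have := Module.nontrivial_of_finrank_pos h
  obtain ⟨⟨v, hv⟩, hv0⟩ := exists_ne (0 : (ℝ ∙ (x : EuclideanSpace ℝ (Fin 3)))ᗮ)
  have hv0' : v ≠ 0 := fun h => hv0 (by simp [h])
  refine ⟨⟨‖v‖⁻¹ • v, by simp [norm_smul, hv0']⟩, ?_⟩
  rw [dot, inner_smul_right, Submodule.mem_orthogonal_singleton_iff_inner_right.1 hv, mul_zero]

lemma dot_rot (U : EuclideanSpace ℝ (Fin 3) ≃ₗᵢ[ℝ] EuclideanSpace ℝ (Fin 3)) (x y : S2) :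
    dot (rot U x) (rot U y) = dot x y := by
  simp [dot, rot]

lemma continuous_dot (x : S2) : Continuous (dot x) := by unfold dot; fun_prop

lemma dot_comm (x y : S2) : dot x y = dot y x := real_inner_comm _ _

lemma dot_self (x : S2) : dot x x = 1 := by simp [dot]

lemma dot_mem_Icc (x y : S2) : dot x y ∈ Set.Icc (-1 : ℝ) 1 := by
  have := abs_real_inner_le_norm (x : EuclideanSpace ℝ (Fin 3)) (y : EuclideanSpace ℝ (Fin 3))
  simp at this
  exact abs_le.1 this

/-- Moments of the zonal coordinate (Archimedes' theorem). -/
lemma integral_dot_pow (x : S2) (n : ℕ) :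
    ∫ y, dot x y ^ n ∂surface = 2 * Real.pi * ∫ z in (-1 : ℝ)..1, z ^ n := by
  obtain ⟨e, he⟩ := exists_orthogonal x
  let x0 : S2 := ⟨EuclideanSpace.single 0 1, by simp⟩
  obtain ⟨e0, he0⟩ := exists_orthogonal x0
  obtain ⟨U, hU, -⟩ := exists_rot_pair he0 he
  rw [← integral_comp_rot U, ← hU]
  simp_rw [dot_rot]
  have h := integral_sphere_mul_halfGaussianMoment n
  rw [integral_coord_pow_mul_exp, halfGaussianMoment_add_two] at h
  have h2 := (halfGaussianMoment_pos n).ne'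
  have h3 : ∀ y : S2, dot x0 y = (y : EuclideanSpace ℝ (Fin 3)) 0 := by
    intro y; simp [dot, x0, EuclideanSpace.inner_single_left]
  simp_rw [h3]
  rw [integral_pow]
  have h4 : ((n : ℝ) + 1) ≠ 0 := by positivity
  apply mul_right_cancel₀ (mul_ne_zero h4 h2)
  rw [h]
  field_simp
  rw [pow_succ]
  ring

end SPHAR


/-! ### Spherical convolution of zonal polynomials. -/

namespace SPHAR

lemma integrable_of_continuous {f : S2 → ℝ} (hf : Continuous f) : Integrable f surface :=
  hf.integrable_of_hasCompactSupport (HasCompactSupport.of_compactSpace f)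

lemma continuous_dot' (x : S2) : Continuous (fun y => dot y x) := by unfold dot; fun_prop

attribute [fun_prop] continuous_dot continuous_dot'

/-- Rotation invariance makes the moment independent of the orthogonal pair; replacing `e` by `-e`
kills odd powers. -/
lemma exists_mixedMoment (n k : ℕ) : ∃ M : ℝ, (Odd k → M = 0) ∧ ∀ x e : S2, dot x e = 0 →
    ∫ y, dot x y ^ n * dot e y ^ k ∂surface = M := by
  let x0 : S2 := ⟨EuclideanSpace.single 0 1, by simp⟩
  obtain ⟨e0, he0⟩ := exists_orthogonal x0
  have key : ∀ x e : S2, dot x e = 0 →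
      ∫ y, dot x y ^ n * dot e y ^ k ∂surface = ∫ y, dot x0 y ^ n * dot e0 y ^ k ∂surface := by
    intro x e he
    obtain ⟨U, hU1, hU2⟩ := exists_rot_pair he0 he
    rw [← integral_comp_rot U, ← hU1, ← hU2]
    simp_rw [dot_rot]
  refine ⟨_, fun hk => ?_, key⟩
  let e1 : S2 := -e0
  have h1 : ∀ y, dot e1 y = - dot e0 y := fun y => by simp [dot, e1]
  have h := key x0 e1 (by rw [dot_comm, h1, dot_comm, he0, neg_zero])
  simp_rw [h1, hk.neg_pow, mul_neg, integral_neg] at h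
  linarith

lemma exists_orthogonal_decomposition (x w : S2) : ∃ (e : S2) (s : ℝ), dot x e = 0 ∧
    s ^ 2 = 1 - dot x w ^ 2 ∧ ∀ y, dot w y = dot x w * dot x y + s * dot e y := by
  set v : EuclideanSpace ℝ (Fin 3) := w - dot x w • (x : EuclideanSpace ℝ (Fin 3)) with hv
  have hxv : inner ℝ (x : EuclideanSpace ℝ (Fin 3)) v = 0 := by
    rw [hv, inner_sub_right, inner_smul_right]
    have h1 := dot_self x
    simp only [dot] at h1 ⊢
    rw [h1]; ring
  have hnorm : ‖v‖ ^ 2 = 1 - dot x w ^ 2 := by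
    rw [← real_inner_self_eq_norm_sq]
    nth_rw 1 [hv]
    rw [inner_sub_left, inner_smul_left, hxv, hv, inner_sub_right, inner_smul_right]
    have h1 := dot_self w
    have h2 := dot_comm w x
    simp only [dot] at h1 h2 ⊢
    rw [h1, h2]; simp; ring
  -- When `w = ±x`, any orthogonal direction serves, with `s = 0`.
  by_cases hv0 : v = 0
  · obtain ⟨e, he⟩ := exists_orthogonal x
    refine ⟨e, 0, he, by rw [← hnorm, hv0]; simp, fun y => ?_⟩
    have : (w : EuclideanSpace ℝ (Fin 3)) = dot x w • (x : EuclideanSpace ℝ (Fin 3)) :=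
      sub_eq_zero.1 hv0
    simp only [dot, zero_mul, add_zero] at this ⊢
    nth_rw 1 [this]
    rw [inner_smul_left]; simp
  · refine ⟨⟨‖v‖⁻¹ • v, by simp [norm_smul, hv0]⟩, ‖v‖, ?_, hnorm, fun y => ?_⟩
    · rw [dot, inner_smul_right, hxv, mul_zero]
    · have h3 : (w : EuclideanSpace ℝ (Fin 3)) = dot x w • (x : EuclideanSpace ℝ (Fin 3)) + v := by
        rw [hv]; abel
      have h4 : ‖v‖ ≠ 0 := norm_ne_zero_iff.2 hv0
      simp only [dot] at h3 ⊢
      nth_rw 1 [h3]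
      rw [inner_add_left, inner_smul_left, inner_smul_left]
      simp [h4]

-- Write `w = ⟨x,w⟩ x + s e` and expand `⟨y,w⟩^m`. Odd powers of `⟨e,y⟩` integrate to zero, and even
-- powers of `s` are powers of `1 - ⟨x,w⟩²`, so the result is a polynomial in `⟨x,w⟩`. Its degree
-- bound involves only `m`; this asymmetry is what later lets Legendre polynomials annihilate lower
-- degrees.
open Polynomial in
lemma exists_conv_pow (n m : ℕ) : ∃ h : ℝ[X], h.natDegree ≤ m ∧ ∀ x w : S2,
    ∫ y, dot x y ^ n * dot y w ^ m ∂surface = h.eval (dot x w) := by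
  choose M hM0 hM using exists_mixedMoment
  refine ⟨∑ k ∈ Finset.range (m + 1), if Even k then
    C ((m.choose k : ℝ) * M (n + (m - k)) k) * X ^ (m - k) * (1 - X ^ 2) ^ (k / 2) else 0, ?_, ?_⟩
  · refine natDegree_sum_le_of_forall_le _ _ fun k hk => ?_
    have hk' := Finset.mem_range.1 hk
    split_ifs with he
    · refine natDegree_mul_le.trans ?_
      have h1 : (C ((m.choose k : ℝ) * M (n + (m - k)) k) * X ^ (m - k)).natDegree ≤ m - k :=
        natDegree_C_mul_X_pow_le _ _
      have h2 : ((1 - X ^ 2 : ℝ[X]) ^ (k / 2)).natDegree ≤ (k / 2) * 2 :=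
        natDegree_pow_le.trans (Nat.mul_le_mul_left _ (by compute_degree))
      omega
    · simp
  · intro x w
    obtain ⟨e, s, he, hs, hw⟩ := exists_orthogonal_decomposition x w
    have h1 : ∀ y, dot x y ^ n * dot y w ^ m = ∑ k ∈ Finset.range (m + 1),
        (dot x w ^ (m - k) * s ^ k * (m.choose k)) * (dot x y ^ (n + (m - k)) * dot e y ^ k) := by
      intro y
      rw [dot_comm y w, hw, add_comm, add_pow, Finset.mul_sum]
      refine Finset.sum_congr rfl fun k _ => ?_
      rw [mul_pow, mul_pow, pow_add]; ring
    simp_rw [h1]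
    rw [integral_finsetSum _ fun k _ => integrable_of_continuous (by fun_prop), eval_finsetSum]
    refine Finset.sum_congr rfl fun k _ => ?_
    rw [integral_const_mul, hM _ _ x e he]
    split_ifs with hk
    · obtain ⟨r, rfl⟩ := hk
      simp [← two_mul, pow_mul, hs]; ring
    · rw [hM0 _ _ (Nat.not_even_iff_odd.1 hk)]; simp

open Polynomial in
/-- The spherical convolution of zonal polynomials is a zonal polynomial of no larger degree. -/
lemma exists_conv (f g : ℝ[X]) : ∃ h : ℝ[X], h.natDegree ≤ g.natDegree ∧ ∀ x w : S2,
    ∫ y, f.eval (dot x y) * g.eval (dot y w) ∂surface = h.eval (dot x w) := by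
  choose h hd h_eq using exists_conv_pow
  refine ⟨∑ i ∈ Finset.range (f.natDegree + 1), ∑ j ∈ Finset.range (g.natDegree + 1),
    C (f.coeff i * g.coeff j) * h i j, ?_, fun x w => ?_⟩
  · refine natDegree_sum_le_of_forall_le _ _ fun i _ => natDegree_sum_le_of_forall_le _ _
      fun j hj => (natDegree_C_mul_le _ _).trans ((hd i j).trans ?_)
    have := Finset.mem_range.1 hj; omega
  · simp_rw [f.eval_eq_sum_range, g.eval_eq_sum_range, Finset.sum_mul_sum]
    rw [integral_finsetSum _ fun k _ => integrable_of_continuous (by fun_prop), eval_finsetSum]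
    refine Finset.sum_congr rfl fun i _ => ?_
    rw [integral_finsetSum _ fun k _ => integrable_of_continuous (by fun_prop), eval_finsetSum]
    refine Finset.sum_congr rfl fun j _ => ?_
    rw [eval_mul, eval_C, ← h_eq, ← integral_const_mul]
    congr 1
    ext y
    ring

lemma integral_eval_dot (f : Polynomial ℝ) (x : S2) :
    ∫ y, f.eval (dot x y) ∂surface = 2 * Real.pi * ∫ z in (-1 : ℝ)..1, f.eval z := by
  simp_rw [f.eval_eq_sum_range]
  rw [integral_finsetSum _ fun k _ => integrable_of_continuous (by fun_prop),
    intervalIntegral.integral_finsetSum fun k _ => by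
      apply Continuous.intervalIntegrable; fun_prop, Finset.mul_sum]
  refine Finset.sum_congr rfl fun i _ => ?_
  rw [integral_const_mul, integral_dot_pow, intervalIntegral.integral_const_mul]
  ring

lemma exists_dot_eq {z : ℝ} (hz : z ∈ Set.Icc (-1 : ℝ) 1) : ∃ x w : S2, dot x w = z := by
  let x0 : S2 := ⟨EuclideanSpace.single 0 1, by simp⟩
  obtain ⟨e0, he0⟩ := exists_orthogonal x0
  have h1 : z ^ 2 ≤ 1 := by nlinarith [hz.1, hz.2]
  have h0 := he0
  have hx := dot_self x0
  have he := dot_self e0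
  have h0' := dot_comm x0 e0
  refine ⟨x0, ⟨z • x0 + √(1 - z ^ 2) • e0, ?_⟩, ?_⟩
  · rw [mem_sphere_zero_iff_norm, ← sq_eq_sq₀ (norm_nonneg _) zero_le_one,
      ← real_inner_self_eq_norm_sq, inner_add_left, inner_add_right, inner_add_right]
    simp only [inner_smul_left, inner_smul_right]
    simp only [dot] at h0 hx he h0'
    rw [← h0', h0, hx, he]
    have := Real.mul_self_sqrt (sub_nonneg.2 h1)
    simp; linarith
  · simp only [dot] at h0 hx ⊢
    rw [inner_add_right, inner_smul_right, inner_smul_right, h0, hx]; simp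

lemma polynomial_eq_of_eqOn {f g : Polynomial ℝ}
    (h : ∀ z ∈ Set.Icc (-1 : ℝ) 1, f.eval z = g.eval z) : f = g :=
  Polynomial.eq_of_infinite_eval_eq f g ((Set.Icc_infinite (by norm_num)).mono h)

lemma eq_zero_of_integral_sq {f : Polynomial ℝ} (h : ∫ z in (-1 : ℝ)..1, f.eval z * f.eval z = 0) :
    f = 0 := by
  refine polynomial_eq_of_eqOn fun z hz => ?_
  by_contra hne
  have : 0 < ∫ z in (-1 : ℝ)..1, f.eval z * f.eval z := by
    refine intervalIntegral.integral_pos (by norm_num) (by fun_prop)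
      (fun z _ => mul_self_nonneg _) ⟨z, hz, ?_⟩
    simp at hne
    exact mul_self_pos.2 hne
  linarith

/-- Fubini for triple spherical convolutions, evaluated on the diagonal. -/
lemma integral_conv_mul {f g h r s : Polynomial ℝ}
    (hr : ∀ x w : S2, ∫ y, f.eval (dot x y) * g.eval (dot y w) ∂surface = r.eval (dot x w))
    (hs : ∀ x w : S2, ∫ y, g.eval (dot x y) * h.eval (dot y w) ∂surface = s.eval (dot x w)) :
    ∫ z in (-1 : ℝ)..1, r.eval z * h.eval z = ∫ z in (-1 : ℝ)..1, f.eval z * s.eval z := by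
  obtain ⟨x, -, -⟩ := exists_dot_eq (z := 1) (by norm_num)
  have h1 : ∀ a b : Polynomial ℝ, ∫ y, a.eval (dot x y) * b.eval (dot y x) ∂surface =
      2 * Real.pi * ∫ z in (-1 : ℝ)..1, a.eval z * b.eval z := by
    intro a b
    have := integral_eval_dot (a * b) x
    simp only [Polynomial.eval_mul] at this
    rw [← this]
    simp_rw [dot_comm _ x]
  have hpi : (2 * Real.pi) ≠ 0 := by positivity
  apply mul_left_cancel₀ hpi
  rw [← h1, ← h1]
  simp_rw [← hr, ← hs, ← integral_mul_const, ← integral_const_mul]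
  rw [integral_integral_swap]
  · simp_rw [mul_assoc]
  · apply Continuous.integrable_of_hasCompactSupport
    · unfold Function.uncurry dot; fun_prop
    · exact HasCompactSupport.of_compactSpace _

/-- Convolution with a Legendre polynomial annihilates polynomials of lower degree. -/
lemma legendre_conv_eq_zero (n : ℕ) (f : Polynomial ℝ) (hf : f.natDegree < n) (x w : S2) :
    ∫ y, (legendre n).eval (dot x y) * f.eval (dot y w) ∂surface = 0 := by
  -- With `r = P_n * f` and `s = f * r`, Fubini gives `∫ r² = ∫ P_n s`, which is zero because `s`
  -- has degree at most that of `f`.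
  obtain ⟨r, hrd, hr⟩ := exists_conv (legendre n) f
  obtain ⟨s, hsd, hs⟩ := exists_conv r f
  have hs' : ∀ x w : S2, ∫ y, f.eval (dot x y) * r.eval (dot y w) ∂surface = s.eval (dot x w) := by
    intro x w
    rw [dot_comm, ← hs]
    congr 1; ext y; rw [dot_comm x y, dot_comm y w]; ring
  have h1 := integral_conv_mul hr hs'
  rw [integral_legendre_mul_eq_zero n s (by omega)] at h1
  rw [hr, eq_zero_of_integral_sq h1]; simp

/-- If the degree dropped, `P_n` would be orthogonal to itself. -/
lemma natDegree_legendre (n : ℕ) : (legendre n).natDegree = n := by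
  refine le_antisymm (natDegree_legendre_le n) (not_lt.1 fun h => ?_)
  have h1 := integral_legendre_mul_eq_zero n _ h
  rw [integral_legendre_sq] at h1
  have : (0 : ℝ) < 2 / (2 * n + 1) := by positivity
  linarith

/-- The convolution has degree at most `n` and is orthogonal to all lower degrees, hence is a
multiple of `P_n`. The factor is found by taking `w = x`, where the integral is the squared norm. -/
lemma legendre_conv_self (n : ℕ) (x w : S2) :
    ∫ y, (legendre n).eval (dot x y) * (legendre n).eval (dot y w) ∂surface =
      4 * Real.pi / (2 * n + 1) * (legendre n).eval (dot x w) := by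
  obtain ⟨q, hqd, hq⟩ := exists_conv (legendre n) (legendre n)
  rw [natDegree_legendre] at hqd
  have horth : ∀ f : Polynomial ℝ, f.natDegree < n → ∫ z in (-1 : ℝ)..1, q.eval z * f.eval z = 0 := by
    intro f hf
    have := integral_conv_mul (s := 0) (h := f) hq (fun x w => by
      rw [legendre_conv_eq_zero n f hf]; simp)
    simpa using this
  have hlead : (legendre n).leadingCoeff ≠ 0 := by
    intro h
    have h1 := integral_legendre_sq n
    rw [Polynomial.leadingCoeff_eq_zero.1 h] at h1
    have : (0 : ℝ) < 2 / (2 * n + 1) := by positivity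
    simp at h1; linarith
  set α := q.coeff n / (legendre n).leadingCoeff with hα
  have hq' : q = Polynomial.C α * legendre n := by
    rcases Nat.eq_zero_or_pos n with hn | hn
    · subst hn
      rw [Polynomial.eq_C_of_natDegree_eq_zero (p := q) (by omega), legendre_zero, mul_one, hα,
        legendre_zero]
      simp
    have hdeg : (q - Polynomial.C α * legendre n).natDegree < n := by
      suffices h : (q - Polynomial.C α * legendre n).natDegree ≤ n - 1 by omega
      rw [Polynomial.natDegree_le_iff_coeff_eq_zero]
      intro k hk
      rcases (by omega : n ≤ k).eq_or_lt with rfl | hk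
      · rw [Polynomial.coeff_sub, Polynomial.coeff_C_mul, hα]
        have : (legendre n).coeff n = (legendre n).leadingCoeff := by
          rw [Polynomial.leadingCoeff, natDegree_legendre]
        rw [this]; field_simp; simp
      · rw [Polynomial.coeff_eq_zero_of_natDegree_lt]
        refine lt_of_le_of_lt (Polynomial.natDegree_sub_le _ _) (max_lt (by omega) ?_)
        refine lt_of_le_of_lt (Polynomial.natDegree_C_mul_le _ _) (by rw [natDegree_legendre]; omega)
    rw [← sub_eq_zero]
    apply eq_zero_of_integral_sq
    have h1 := horth _ hdeg
    have h2 := integral_legendre_mul_eq_zero n _ hdeg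
    set g := q - Polynomial.C α * legendre n with hg
    have h3 : ∀ z, g.eval z * g.eval z = q.eval z * g.eval z -
        α * ((legendre n).eval z * g.eval z) := by
      intro z; nth_rw 1 [hg]; simp; ring
    simp_rw [h3]
    rw [intervalIntegral.integral_sub, intervalIntegral.integral_const_mul, h1, h2]
    · simp
    all_goals apply Continuous.intervalIntegrable; fun_prop
  have h1 := hq x x
  have h2 := integral_eval_dot (legendre n * legendre n) x
  simp only [Polynomial.eval_mul] at h2
  simp_rw [dot_comm _ x] at h1
  rw [h2, dot_self, hq', integral_legendre_sq] at h1
  simp [legendre_eval_one] at h1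
  rw [hq, hq', Polynomial.eval_mul, Polynomial.eval_C, ← h1]
  ring

/-- Reproducing property of the zonal kernels. -/
lemma integral_zonal_mul_zonal (l l' : ℕ) (x w : S2) :
    ∫ y, zonal l (dot x y) * zonal l' (dot y w) ∂surface =
      if l = l' then zonal l (dot x w) else 0 := by
  have h : ∀ y, zonal l (dot x y) * zonal l' (dot y w) =
      ((2 * (l : ℝ) + 1) / (4 * Real.pi) * ((2 * (l' : ℝ) + 1) / (4 * Real.pi))) *
        ((legendre l).eval (dot x y) * (legendre l').eval (dot y w)) := by
    intro y; simp only [zonal]; ring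
  simp_rw [h]
  rw [integral_const_mul]
  split_ifs with hl
  · subst hl
    rw [legendre_conv_self, zonal]
    field_simp
  · rcases lt_or_gt_of_ne hl with h1 | h1
    · have := legendre_conv_eq_zero l' (legendre l) (by rwa [natDegree_legendre]) w x
      simp_rw [dot_comm _ x, dot_comm w] at this
      simp_rw [mul_comm (Polynomial.eval _ (legendre l))]
      rw [this, mul_zero]
    · rw [legendre_conv_eq_zero l _ (by rwa [natDegree_legendre]), mul_zero]

lemma zonal_one (l : ℕ) : zonal l 1 = (2 * (l : ℝ) + 1) / (4 * Real.pi) := by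
  simp [zonal, legendre_eval_one]

lemma surface_real_univ : surface.real Set.univ = 4 * Real.pi := by
  obtain ⟨x, -, -⟩ := exists_dot_eq (z := 1) (by norm_num)
  have := integral_dot_pow x 0
  simp at this
  linarith

end SPHAR


/-! ### Spherical harmonics, addition formula and Funk–Hecke formula. -/

namespace SPHAR

/-- The zonal function with pole `w`, as a continuous function on the sphere. -/
noncomputable def zonalMap (l : ℕ) (w : S2) : C(S2, ℝ) :=
  ⟨fun y => zonal l (dot y w), by unfold zonal; fun_prop⟩

/-- Spherical harmonics of degree `l`. -/
noncomputable def harmonics (l : ℕ) : Submodule ℝ C(S2, ℝ) :=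
  Submodule.span ℝ (Set.range (zonalMap l))

/-- A zonal function is a polynomial of degree at most `l` in three coordinate functions, so the
span lies in a finite-dimensional space. -/
lemma harmonics_le_fg (l : ℕ) : ∃ U : Submodule ℝ C(S2, ℝ), U.FG ∧ harmonics l ≤ U := by
  let coord : Fin 3 → C(S2, ℝ) := fun i => ⟨fun y => (y : EuclideanSpace ℝ (Fin 3)) i, by fun_prop⟩
  let W : Submodule ℝ C(S2, ℝ) := Submodule.span ℝ (Set.range coord)
  refine ⟨⨆ k ∈ Finset.range (l + 1), W ^ k, Submodule.fg_biSup _ _ fun k _ =>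
    (Submodule.fg_span (Set.finite_range coord)).pow k, Submodule.span_le.2 ?_⟩
  rintro _ ⟨w, rfl⟩
  let dw : C(S2, ℝ) := ⟨fun y => dot y w, by fun_prop⟩
  have hdw : dw ∈ W := by
    have : dw = ∑ i, (w : EuclideanSpace ℝ (Fin 3)) i • coord i := by
      ext y
      simp [dw, coord, dot, PiLp.inner_apply, Fin.sum_univ_three]
    rw [this]
    exact Submodule.sum_mem _ fun i _ => Submodule.smul_mem _ _ (Submodule.subset_span ⟨i, rfl⟩)
  have h : zonalMap l w = ∑ k ∈ Finset.range (l + 1),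
      ((2 * (l : ℝ) + 1) / (4 * Real.pi) * (legendre l).coeff k) • dw ^ k := by
    ext y
    simp only [zonalMap, ContinuousMap.coe_mk, zonal, Polynomial.eval_eq_sum_range,
      natDegree_legendre, Finset.mul_sum, ContinuousMap.coe_sum, ContinuousMap.coe_smul,
      ContinuousMap.coe_pow, Finset.sum_apply, Pi.smul_apply, Pi.pow_apply, smul_eq_mul, dw]
    exact Finset.sum_congr rfl fun k _ => by ring
  rw [h]
  refine Submodule.sum_mem _ fun k hk => Submodule.smul_mem _ _ ?_
  exact (le_iSup₂_of_le k hk le_rfl : W ^ k ≤ _) (Submodule.pow_mem_pow W hdw k)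

lemma harmonics_fg (l : ℕ) : (harmonics l).FG := by
  obtain ⟨U, hU, hle⟩ := harmonics_le_fg l
  have : FiniteDimensional ℝ U := Module.Finite.iff_fg.2 hU
  have := Submodule.finiteDimensional_of_le hle
  exact Module.Finite.iff_fg.1 this

/-- The reproducing property on spherical harmonics. -/
lemma integral_zonal_mul_harmonic (l l' : ℕ) (f : C(S2, ℝ)) (hf : f ∈ harmonics l') (x : S2) :
    ∫ y, zonal l (dot x y) * f y ∂surface = if l = l' then f x else 0 := by
  have hc : Continuous fun y => zonal l (dot x y) := by unfold zonal; fun_prop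
  induction hf using Submodule.span_induction with
  | mem f hf =>
    obtain ⟨w, rfl⟩ := hf
    have := integral_zonal_mul_zonal l l' x w
    simp only [zonalMap, ContinuousMap.coe_mk]
    rw [this]
    split_ifs with h
    · rw [h]
    · rfl
  | zero => simp
  | add f g _ _ h1 h2 =>
    simp only [ContinuousMap.add_apply, mul_add]
    rw [integral_add (integrable_of_continuous (by fun_prop))
      (integrable_of_continuous (by fun_prop)), h1, h2]
    split_ifs <;> simp
  | smul c f _ h1 =>
    simp only [ContinuousMap.smul_apply, smul_eq_mul, mul_left_comm _ c]
    rw [integral_const_mul, h1]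
    split_ifs <;> simp

lemma integral_harmonic_mul_harmonic {l l' : ℕ} (hl : l ≠ l') (f g : C(S2, ℝ))
    (hf : f ∈ harmonics l) (hg : g ∈ harmonics l') : ∫ y, f y * g y ∂surface = 0 := by
  induction hf using Submodule.span_induction with
  | mem f hf =>
    obtain ⟨w, rfl⟩ := hf
    have := integral_zonal_mul_harmonic l l' g hg w
    rw [if_neg hl] at this
    rw [← this]
    simp_rw [dot_comm w]; rfl
  | zero => simp
  | add f g _ _ h1 h2 =>
    simp only [ContinuousMap.add_apply, add_mul]
    rw [integral_add (integrable_of_continuous (by fun_prop))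
      (integrable_of_continuous (by fun_prop)), h1, h2, add_zero]
  | smul c f _ h1 =>
    simp only [ContinuousMap.smul_apply, smul_eq_mul, mul_assoc]
    rw [integral_const_mul, h1, mul_zero]

/-- In `L²` the zonal function with pole `w` represents evaluation at `w` on the span, so for any
orthonormal basis Parseval's identity for two zonal functions is the addition formula. The dimension
`2l + 1` follows by integrating that formula over the diagonal, where the kernel is `(2l+1)/(4π)`.
-/
lemma exists_harmonic_basis (l : ℕ) : ∃ Y : Fin (2 * l + 1) → C(S2, ℝ),
    (∀ m, Y m ∈ harmonics l) ∧
    (∀ m m', ∫ y, Y m y * Y m' y ∂surface = if m = m' then 1 else 0) ∧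
    ∀ x y, ∑ m, Y m x * Y m y = zonal l (dot x y) := by
  let Φ : C(S2, ℝ) →L[ℝ] Lp ℝ 2 surface := ContinuousMap.toLp 2 surface ℝ
  have hinner : ∀ f g : C(S2, ℝ), inner ℝ (Φ f) (Φ g) = ∫ y, f y * g y ∂surface := by
    intro f g
    rw [ContinuousMap.inner_toLp]
    simp [mul_comm]
  let H : Submodule ℝ (Lp ℝ 2 surface) := (harmonics l).map (Φ : C(S2, ℝ) →ₗ[ℝ] Lp ℝ 2 surface)
  have hH : FiniteDimensional ℝ H := Module.Finite.iff_fg.2 ((harmonics_fg l).map _)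
  let b := stdOrthonormalBasis ℝ H
  have hex : ∀ i, ∃ f ∈ harmonics l, Φ f = b i := fun i => (b i).2
  choose f hf hfb using hex
  have horth : ∀ i j, ∫ y, f i y * f j y ∂surface = if i = j then 1 else 0 := by
    intro i j
    rw [← hinner, hfb, hfb]
    have := orthonormal_iff_ite.1 b.orthonormal i j
    simpa using this
  have hadd : ∀ x w, ∑ i, f i x * f i w = zonal l (dot x w) := by
    intro x w
    have hmem : ∀ w, Φ (zonalMap l w) ∈ H := fun w =>
      ⟨_, Submodule.subset_span ⟨w, rfl⟩, rfl⟩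
    have h1 := b.sum_inner_mul_inner ⟨_, hmem x⟩ ⟨_, hmem w⟩
    have h2 : ∀ i x, inner ℝ ((b i : H) : Lp ℝ 2 surface) (Φ (zonalMap l x)) = f i x := by
      intro i x
      rw [← hfb, hinner]
      have := integral_zonal_mul_harmonic l l (f i) (hf i) x
      rw [if_pos rfl] at this
      rw [← this]
      congr 1; ext y; rw [mul_comm, dot_comm]; rfl
    have h3 : inner ℝ (Φ (zonalMap l x)) (Φ (zonalMap l w)) = zonal l (dot x w) := by
      rw [hinner]
      have := integral_zonal_mul_zonal l l x w
      rw [if_pos rfl] at this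
      rw [← this]
      congr 1; ext y; rw [dot_comm x]; rfl
    simp only [Submodule.coe_inner] at h1
    rw [h3] at h1
    rw [← h1]
    refine Finset.sum_congr rfl fun i _ => ?_
    rw [h2, real_inner_comm, h2]
  have hcard : Module.finrank ℝ H = 2 * l + 1 := by
    have h1 : ∫ x, ∑ i, f i x * f i x ∂surface = Module.finrank ℝ H := by
      rw [integral_finsetSum _ fun i _ => integrable_of_continuous (by fun_prop)]
      simp [horth]
    simp_rw [hadd, dot_self, zonal_one] at h1
    rw [integral_const, surface_real_univ, smul_eq_mul] at h1
    have h2 : (Module.finrank ℝ H : ℝ) = ((2 * l + 1 : ℕ) : ℝ) := by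
      rw [← h1]; push_cast; field_simp
    exact_mod_cast h2
  let e := finCongr hcard
  refine ⟨fun m => f (e.symm m), fun m => hf _, fun m m' => ?_, fun x y => ?_⟩
  · rw [horth]; simp
  · rw [← hadd x y]
    exact Equiv.sum_comp e.symm (fun i => f i x * f i y)

/-- A real orthonormal system of spherical harmonics satisfying the addition formula. -/
structure IsHarmonicSystem (Y : (l : ℕ) → Fin (2 * l + 1) → C(S2, ℝ)) : Prop where
  orthonormal : ∀ (i j : Σ l : ℕ, Fin (2 * l + 1)),
    ∫ y, Y i.1 i.2 y * Y j.1 j.2 y ∂surface = if i = j then 1 else 0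
  addition : ∀ l x y, ∑ m, Y l m x * Y l m y = zonal l (dot x y)

lemma exists_isHarmonicSystem : ∃ Y, IsHarmonicSystem Y := by
  choose Y hmem horth hadd using exists_harmonic_basis
  refine ⟨Y, ?_, hadd⟩
  rintro ⟨l, m⟩ ⟨l', m'⟩
  by_cases h : l = l'
  · subst h
    simp [horth]
  · rw [integral_harmonic_mul_harmonic h _ _ (hmem l m) (hmem l' m'), if_neg]
    simp [h]

variable {Y : (l : ℕ) → Fin (2 * l + 1) → C(S2, ℝ)}

lemma IsHarmonicSystem.integral_zonal_mul (hY : IsHarmonicSystem Y) (l : ℕ)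
    (i : Σ l : ℕ, Fin (2 * l + 1)) (x : S2) :
    ∫ y, zonal l (dot x y) * Y i.1 i.2 y ∂surface = if l = i.1 then Y i.1 i.2 x else 0 := by
  simp_rw [← hY.addition, Finset.sum_mul, mul_assoc]
  rw [integral_finsetSum _ fun i _ => integrable_of_continuous (by fun_prop)]
  simp_rw [integral_const_mul]
  have h := fun m => hY.orthonormal ⟨l, m⟩ i
  simp only at h
  simp_rw [h]
  obtain ⟨l', m'⟩ := i
  by_cases hl : l = l'
  · subst hl; simp
  · simp [hl]

/-- Cauchy–Schwarz in the addition formula; it amounts to `|P_l| ≤ 1` on `[-1, 1]`. -/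
lemma abs_zonal_le (l : ℕ) (x y : S2) : |zonal l (dot x y)| ≤ (2 * (l : ℝ) + 1) / (4 * Real.pi) := by
  obtain ⟨Y, hY⟩ := exists_isHarmonicSystem
  have h : zonal l (dot x y) ^ 2 ≤ ((2 * (l : ℝ) + 1) / (4 * Real.pi)) ^ 2 := by
    rw [← hY.addition]
    refine (Finset.sum_mul_sq_le_sq_mul_sq _ _ _).trans (le_of_eq ?_)
    simp_rw [sq (Y l _ _)]
    rw [hY.addition, hY.addition, dot_self, dot_self, zonal_one, sq]
  exact abs_le_of_sq_le_sq h (by positivity)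

/-- Funk–Hecke formula for absolutely convergent Legendre expansions. -/
lemma IsHarmonicSystem.integral_kernel_mul (hY : IsHarmonicSystem Y) {k : ℝ → ℝ} {φ : ℕ → ℝ}
    (hk : HasLegendreExpansion k φ) (hφ : Summable fun l => |φ l| * (2 * (l : ℝ) + 1))
    (i : Σ l : ℕ, Fin (2 * l + 1)) (x : S2) :
    ∫ y, k (dot x y) * Y i.1 i.2 y ∂surface = φ i.1 * Y i.1 i.2 x := by
  have hint : ∀ l, Integrable (fun y => φ l * zonal l (dot x y) * Y i.1 i.2 y) surface := by
    intro l
    refine integrable_of_continuous ?_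
    unfold zonal; fun_prop
  have h1 := hasSum_integral_of_summable_integral_norm hint (by
    have hs : Summable fun l => |φ l| * (2 * (l : ℝ) + 1) *
        ((1 / (4 * Real.pi)) * ∫ y, ‖Y i.1 i.2 y‖ ∂surface) := hφ.mul_right _
    refine Summable.of_nonneg_of_le (fun l => integral_nonneg fun _ => norm_nonneg _) (fun l => ?_) hs
    calc ∫ y, ‖φ l * zonal l (dot x y) * Y i.1 i.2 y‖ ∂surface
        ≤ ∫ y, |φ l| * ((2 * (l : ℝ) + 1) / (4 * Real.pi)) * ‖Y i.1 i.2 y‖ ∂surface := by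
          refine integral_mono (hint l).norm (integrable_of_continuous (by fun_prop)) fun y => ?_
          simp only [norm_mul, Real.norm_eq_abs]
          gcongr
          exact abs_zonal_le _ _ _
      _ = _ := by rw [integral_const_mul]; ring)
  have h2 : ∀ y, ∑' l, φ l * zonal l (dot x y) * Y i.1 i.2 y = k (dot x y) * Y i.1 i.2 y := by
    intro y
    exact ((hk _ (dot_mem_Icc x y)).mul_right _).tsum_eq
  simp_rw [h2] at h1
  refine h1.unique ?_
  have h3 : ∀ l, ∫ y, φ l * zonal l (dot x y) * Y i.1 i.2 y ∂surface =
      if l = i.1 then φ i.1 * Y i.1 i.2 x else 0 := by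
    intro l
    simp_rw [mul_assoc]
    rw [integral_const_mul, hY.integral_zonal_mul]
    split_ifs with h
    · rw [h]
    · simp
  simp_rw [h3]
  exact hasSum_ite_eq _ _

/-- Absolutely convergent Legendre expansions define continuous kernels on the sphere. -/
lemma continuous_kernel {k : ℝ → ℝ} {φ : ℕ → ℝ} (hk : HasLegendreExpansion k φ)
    (hφ : Summable fun l => |φ l| * (2 * (l : ℝ) + 1)) :
    Continuous fun q : S2 × S2 => k (dot q.1 q.2) := by
  have h2 : (fun q : S2 × S2 => k (dot q.1 q.2)) =
      fun q => ∑' l, φ l * zonal l (dot q.1 q.2) := by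
    ext q
    exact (hk _ (dot_mem_Icc _ _)).tsum_eq.symm
  rw [h2]
  refine continuous_tsum (u := fun l => |φ l| * (2 * (l : ℝ) + 1) * (1 / (4 * Real.pi)))
    (fun l => by unfold zonal dot; fun_prop) (hφ.mul_right _) fun l q => ?_
  rw [norm_mul, Real.norm_eq_abs, Real.norm_eq_abs, mul_assoc, mul_one_div]
  gcongr
  exact abs_zonal_le _ _ _

/-- The terms are `O(l^{1-β})`, so `β > 2` is used here. The consequence is uniform convergence of
the kernel expansions, hence continuous kernels and termwise integration. -/
lemma summable_of_smooth {φ : ℕ → ℝ} {β γ : ℝ} (hβ : 2 < β)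
    (hφ : ∀ l : ℕ, 0 < l → |φ l| ≤ γ / (l : ℝ) ^ β) :
    Summable fun l => |φ l| * (2 * (l : ℝ) + 1) := by
  rw [← summable_nat_add_iff 1]
  have hs : Summable fun l : ℕ => 3 * γ * (((l + 1 : ℕ) : ℝ)) ^ (1 - β) :=
    (((summable_nat_add_iff 1).2 (Real.summable_nat_rpow.2 (by linarith : 1 - β < -1)))).mul_left _
  refine Summable.of_nonneg_of_le (fun l => by positivity) (fun l => ?_) hs
  have h1 := hφ (l + 1) (Nat.succ_pos l)
  have h0 : (1 : ℝ) ≤ ((l + 1 : ℕ) : ℝ) := by push_cast; linarith [(Nat.cast_nonneg l : (0:ℝ) ≤ l)]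
  rw [Real.rpow_sub (by linarith), Real.rpow_one]
  calc _ ≤ γ / ((l + 1 : ℕ) : ℝ) ^ β * (3 * ((l + 1 : ℕ) : ℝ)) := by
        gcongr
        · exact (abs_nonneg _).trans h1
        · linarith
    _ = _ := by ring

end SPHAR


/-! ### The Gaussian Hilbert space of a process. -/

namespace SPHAR

section GaussianHilbert

variable {Ω : Type*} [MeasurableSpace Ω] {μ : Measure Ω}

/-- Cauchy–Schwarz inequality for real integrals. -/
lemma sq_integral_mul_le {f g : Ω → ℝ} (hf : MemLp f 2 μ) (hg : MemLp g 2 μ) :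
    (∫ ω, f ω * g ω ∂μ) ^ 2 ≤ (∫ ω, f ω ^ 2 ∂μ) * ∫ ω, g ω ^ 2 ∂μ := by
  have hfg : Integrable (fun ω => f ω * g ω) μ := hf.integrable_mul hg
  have h : ∀ t : ℝ, 0 ≤ (∫ ω, f ω ^ 2 ∂μ) * (t * t) + (2 * ∫ ω, f ω * g ω ∂μ) * t +
      ∫ ω, g ω ^ 2 ∂μ := by
    intro t
    have h1 : ∫ ω, (t * f ω + g ω) ^ 2 ∂μ = (∫ ω, f ω ^ 2 ∂μ) * (t * t) +
        (2 * ∫ ω, f ω * g ω ∂μ) * t + ∫ ω, g ω ^ 2 ∂μ := by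
      have h2 : ∀ ω, (t * f ω + g ω) ^ 2 = (t * t) * f ω ^ 2 + (2 * t) * (f ω * g ω) + g ω ^ 2 := by
        intro ω; ring
      simp_rw [h2]
      have h3 : Integrable (fun ω => (t * t) * f ω ^ 2) μ := hf.integrable_sq.const_mul _
      have h4 : Integrable (fun ω => (2 * t) * (f ω * g ω)) μ := hfg.const_mul _
      rw [integral_add (h3.add h4 : Integrable (fun ω => _ + _) μ) hg.integrable_sq,
        integral_add h3 h4, integral_const_mul, integral_const_mul]
      ring
    rw [← h1]
    exact integral_nonneg fun ω => sq_nonneg _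
  have := discrim_le_zero h
  rw [discrim] at this
  nlinarith

lemma abs_integral_mul_le {f g : Ω → ℝ} (hf : MemLp f 2 μ) (hg : MemLp g 2 μ) :
    |∫ ω, f ω * g ω ∂μ| ≤ √(∫ ω, f ω ^ 2 ∂μ) * √(∫ ω, g ω ^ 2 ∂μ) := by
  rw [← Real.sqrt_mul (integral_nonneg fun ω => sq_nonneg _)]
  exact Real.abs_le_sqrt (sq_integral_mul_le hf hg)

/-- The closed subspace of `L²` spanned by a process. -/
noncomputable def gaussianSpace {S : Type*} (ξ : S → Ω → ℝ) (hξ : ∀ s, MemLp (ξ s) 2 μ) :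
    Submodule ℝ (Lp ℝ 2 μ) :=
  (Submodule.span ℝ (Set.range fun s => (hξ s).toLp)).topologicalClosure

/-- A closed span is its double orthogonal complement. Membership of an integral of the process then
follows from Fubini, with no approximation by finite sums. -/
lemma mem_gaussianSpace_of_orthogonal {S : Type*} {ξ : S → Ω → ℝ} (hξ : ∀ s, MemLp (ξ s) 2 μ)
    {η : Ω → ℝ} (hη : MemLp η 2 μ)
    (h : ∀ ζ : Ω → ℝ, MemLp ζ 2 μ → (∀ s, ∫ ω, ζ ω * ξ s ω ∂μ = 0) → ∫ ω, ζ ω * η ω ∂μ = 0) :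
    hη.toLp ∈ gaussianSpace ξ hξ := by
  have hinner : ∀ (ζ : Lp ℝ 2 μ) (f : Ω → ℝ) (hf : MemLp f 2 μ),
      inner ℝ hf.toLp ζ = ∫ ω, ζ ω * f ω ∂μ := by
    intro ζ f hf
    rw [L2.inner_def]
    refine integral_congr_ae ?_
    filter_upwards [hf.coeFn_toLp] with ω hω
    rw [hω]; rfl
  rw [gaussianSpace, ← Submodule.orthogonal_orthogonal_eq_closure, Submodule.mem_orthogonal]
  intro ζ hζ
  rw [real_inner_comm, hinner]
  refine h ζ (Lp.memLp ζ) fun s => ?_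
  rw [← hinner ζ _ (hξ s)]
  exact (Submodule.mem_orthogonal _ _).1 hζ _ (Submodule.subset_span ⟨s, rfl⟩)

variable [IsProbabilityMeasure μ]

lemma integral_abs_le_norm (u : Lp ℝ 2 μ) : ∫ ω, |u ω| ∂μ ≤ ‖u‖ := by
  have h1 := abs_integral_mul_le (μ := μ) (Lp.memLp u).abs (memLp_const (1 : ℝ))
  simp only [mul_one, one_pow, Pi.abs_apply, sq_abs] at h1
  rw [integral_const, probReal_univ, one_smul, Real.sqrt_one, mul_one] at h1
  have h2 : ∫ ω, u ω ^ 2 ∂μ = ‖u‖ ^ 2 := by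
    rw [← real_inner_self_eq_norm_sq, L2.inner_def]
    congr 1; ext ω; simp [sq]
  rw [h2, Real.sqrt_sq (norm_nonneg _)] at h1
  exact (le_abs_self _).trans h1

/-- The map is Lipschitz in `L²`, so the identity expressing that an element is centred Gaussian is
a closed condition and passes from the span to its closure. -/
lemma continuous_integral_cexp (t : ℝ) :
    Continuous fun u : Lp ℝ 2 μ => ∫ ω, Complex.exp (t * u ω * Complex.I) ∂μ := by
  have hint : ∀ u : Lp ℝ 2 μ, Integrable (fun ω => Complex.exp (t * u ω * Complex.I)) μ := by
    intro u
    refine Integrable.of_bound (C := 1) ?_ (Eventually.of_forall fun ω => ?_)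
    · have := (Lp.aestronglyMeasurable u).aemeasurable
      exact (by fun_prop : AEMeasurable (fun ω => Complex.exp (t * u ω * Complex.I)) μ).aestronglyMeasurable
    · rw [← Complex.ofReal_mul, Complex.norm_exp_ofReal_mul_I]
  refine (LipschitzWith.of_dist_le_mul (K := ⟨|t|, abs_nonneg t⟩) fun u v => ?_).continuous
  rw [dist_eq_norm, dist_eq_norm, ← integral_sub (hint u) (hint v)]
  have h1 : ∀ᵐ ω ∂μ, ‖Complex.exp (t * u ω * Complex.I) - Complex.exp (t * v ω * Complex.I)‖ ≤
      |t| * |(u - v) ω| := by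
    filter_upwards [Lp.coeFn_sub u v] with ω hω
    rw [hω, Pi.sub_apply, ← abs_mul]
    have h2 : Complex.exp (t * u ω * Complex.I) - Complex.exp (t * v ω * Complex.I) =
        Complex.exp (t * v ω * Complex.I) * (Complex.exp (Complex.I * ((t * (u ω - v ω) : ℝ) : ℂ)) - 1) := by
      rw [mul_sub, ← Complex.exp_add, mul_one]
      congr 2
      push_cast; ring
    rw [h2, norm_mul, ← Complex.ofReal_mul, Complex.norm_exp_ofReal_mul_I, one_mul]
    exact Real.norm_exp_I_mul_ofReal_sub_one_le
  refine (norm_integral_le_of_norm_le ?_ h1).trans ?_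
  · exact ((Lp.memLp (u - v)).integrable (by norm_num)).abs.const_mul _
  · rw [integral_const_mul]
    exact mul_le_mul_of_nonneg_left (integral_abs_le_norm _) (abs_nonneg _)

/-- Elements of the closed span of a centred Gaussian process are centred Gaussian. -/
lemma charFun_of_mem_gaussianSpace {S : Type*} {ξ : S → Ω → ℝ} (hG : IsGaussianProcess ξ μ)
    (h0 : ∀ s, ∫ ω, ξ s ω ∂μ = 0) (hξ : ∀ s, MemLp (ξ s) 2 μ) {u : Lp ℝ 2 μ}
    (hu : u ∈ gaussianSpace ξ hξ) (t : ℝ) :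
    ∫ ω, Complex.exp (t * u ω * Complex.I) ∂μ = Complex.exp (-(t ^ 2 * ‖u‖ ^ 2 / 2)) := by
  have hclosed : IsClosed {u : Lp ℝ 2 μ | ∫ ω, Complex.exp (t * u ω * Complex.I) ∂μ =
      Complex.exp (-(t ^ 2 * ‖u‖ ^ 2 / 2))} :=
    isClosed_eq (continuous_integral_cexp t) (by fun_prop)
  refine closure_minimal ?_ hclosed hu
  intro v hv
  obtain ⟨c, rfl⟩ := (Finsupp.mem_span_range_iff_exists_finsupp).1 hv
  have hlaw : HasGaussianLaw (fun ω => ∑ s ∈ c.support, c s * ξ s ω) μ :=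
    (hG.smul fun s => c s).hasGaussianLaw_fun_sum (I := c.support)
  set X : Ω → ℝ := fun ω => ∑ s ∈ c.support, c s * ξ s ω with hX
  set v : Lp ℝ 2 μ := c.sum fun i a => a • (hξ i).toLp with hv'
  have hae : v =ᵐ[μ] X := by
    rw [hv', Finsupp.sum]
    have h1 : ∀ s ∈ c.support, ∀ᵐ ω ∂μ, (c s • (hξ s).toLp : Lp ℝ 2 μ) ω = c s * ξ s ω := by
      intro s _
      filter_upwards [Lp.coeFn_smul (c s) (hξ s).toLp, (hξ s).coeFn_toLp] with ω h1 h2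
      rw [h1, Pi.smul_apply, h2, smul_eq_mul]
    filter_upwards [(Finset.eventually_all _).2 h1,
      Lp.coeFn_finsetSum c.support (fun s => c s • (hξ s).toLp)] with ω h1 h2
    rw [h2, Finset.sum_apply]
    exact Finset.sum_congr rfl fun s hs => h1 s hs
  have hmean : ∫ ω, X ω ∂μ = 0 := by
    rw [hX, integral_finsetSum _ fun s _ => ((hξ s).integrable (by norm_num)).const_mul _]
    simp [integral_const_mul, h0]
  have hvar : Var[X; μ] = ‖v‖ ^ 2 := by
    rw [variance_of_integral_eq_zero hlaw.aemeasurable hmean, ← real_inner_self_eq_norm_sq,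
      L2.inner_def]
    refine integral_congr_ae ?_
    filter_upwards [hae] with ω hω
    rw [hω]; simp [sq]
  have h2 : ∫ ω, Complex.exp (t * v ω * Complex.I) ∂μ = charFun (μ.map X) t := by
    rw [charFun_apply_real, integral_map hlaw.aemeasurable (by fun_prop)]
    refine integral_congr_ae ?_
    filter_upwards [hae] with ω hω
    rw [hω]
  change _ = _
  rw [h2, hlaw.map_eq_gaussianReal, charFun_gaussianReal, hmean, hvar,
    Real.coe_toNNReal _ (sq_nonneg _)]
  congr 1
  push_cast
  ring

lemma hasGaussianLaw_of_mem_gaussianSpace {S : Type*} {ξ : S → Ω → ℝ} (hG : IsGaussianProcess ξ μ)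
    (h0 : ∀ s, ∫ ω, ξ s ω ∂μ = 0) (hξ : ∀ s, MemLp (ξ s) 2 μ) {u : Lp ℝ 2 μ}
    (hu : u ∈ gaussianSpace ξ hξ) : HasGaussianLaw u μ := by
  have hm : AEMeasurable u μ := (Lp.aestronglyMeasurable u).aemeasurable
  have hmap : μ.map u = gaussianReal 0 (‖u‖ ^ 2).toNNReal := by
    have := Measure.isProbabilityMeasure_map hm
    apply Measure.ext_of_charFun
    ext t
    rw [charFun_apply_real, integral_map hm (by fun_prop),
      charFun_of_mem_gaussianSpace hG h0 hξ hu, charFun_gaussianReal,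
      Real.coe_toNNReal _ (sq_nonneg _)]
    congr 1
    push_cast
    ring
  exact ⟨by rw [hmap]; infer_instance⟩

/-- A family of elements of the closed span of a centred Gaussian process is a Gaussian process. -/
lemma isGaussianProcess_of_mem_gaussianSpace {S J : Type*} {ξ : S → Ω → ℝ}
    (hG : IsGaussianProcess ξ μ) (h0 : ∀ s, ∫ ω, ξ s ω ∂μ = 0) (hξ : ∀ s, MemLp (ξ s) 2 μ)
    {η : J → Ω → ℝ} (hη : ∀ j, MemLp (η j) 2 μ) (hmem : ∀ j, (hη j).toLp ∈ gaussianSpace ξ hξ) :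
    IsGaussianProcess η μ := by
  classical
  refine ⟨fun I => ⟨isGaussian_of_isGaussian_map fun L => ?_⟩⟩
  have hm : AEMeasurable (fun ω => I.restrict (η · ω)) μ :=
    aemeasurable_pi_lambda _ fun i => (hη i).aestronglyMeasurable.aemeasurable
  rw [AEMeasurable.map_map_of_aemeasurable (by fun_prop) hm]
  set u : Lp ℝ 2 μ := ∑ i : I, L (Pi.single i 1) • (hη i).toLp with hu
  have humem : u ∈ gaussianSpace ξ hξ :=
    Submodule.sum_mem _ fun i _ => Submodule.smul_mem _ _ (hmem i)
  have hae : u =ᵐ[μ] (L ∘ fun ω => I.restrict (η · ω)) := by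
    have h1 : ∀ i : I, ∀ᵐ ω ∂μ, (L (Pi.single i 1) • (hη i).toLp : Lp ℝ 2 μ) ω =
        L (Pi.single i 1) * η i ω := by
      intro i
      filter_upwards [Lp.coeFn_smul (L (Pi.single i 1)) (hη i).toLp, (hη i).coeFn_toLp] with ω h1 h2
      rw [h1, Pi.smul_apply, h2, smul_eq_mul]
    filter_upwards [ae_all_iff.2 h1,
      Lp.coeFn_finsetSum Finset.univ (fun i : I => L (Pi.single i 1) • (hη i).toLp)] with ω h1 h2
    rw [hu, h2, Finset.sum_apply, Function.comp_apply]
    have h3 := (L : (I → ℝ) →ₗ[ℝ] ℝ).pi_apply_eq_sum_univ (I.restrict (η · ω))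
    refine Eq.trans ?_ h3.symm
    refine Finset.sum_congr rfl fun i _ => ?_
    rw [h1 i, smul_eq_mul, mul_comm]
    have h4 : (Pi.single i 1 : I → ℝ) = fun j => if i = j then 1 else 0 := by
      ext j; simp [Pi.single_apply, eq_comm]
    rw [h4]
    rfl
  exact ((hasGaussianLaw_of_mem_gaussianSpace hG h0 hξ humem).congr hae).isGaussian_map

end GaussianHilbert

end SPHAR


/-! ### Harmonic coefficients of square-integrable and Gaussian fields. -/

namespace SPHAR

set_option linter.unusedSectionVars false

section Coefficients

variable {Ω : Type*} [MeasurableSpace Ω] {μ : Measure Ω}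

/-- A jointly measurable field with uniformly bounded second moments. -/
structure IsSquareField (X : Ω → S2 → ℝ) (B : ℝ) (μ : Measure Ω) : Prop where
  measurable : Measurable (fun q : Ω × S2 => X q.1 q.2)
  memLp : ∀ x, MemLp (fun ω => X ω x) 2 μ
  bound : ∀ x, ∫ ω, X ω x ^ 2 ∂μ ≤ B

/-- The coefficient `∫ X f` of a spherical field. -/
noncomputable def coef (f : C(S2, ℝ)) (X : Ω → S2 → ℝ) (ω : Ω) : ℝ := ∫ x, X ω x * f x ∂surface

lemma memLp_continuousMap (f : C(S2, ℝ)) : MemLp f 2 surface :=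
  (memLp_two_iff_integrable_sq f.continuous.aestronglyMeasurable).2
    (integrable_of_continuous (by fun_prop))

variable [IsProbabilityMeasure μ] {X X' : Ω → S2 → ℝ} {B B' : ℝ}

namespace IsSquareField

lemma memLp_prod (hX : IsSquareField X B μ) :
    MemLp (fun q : Ω × S2 => X q.1 q.2) 2 (μ.prod surface) := by
  rw [memLp_two_iff_integrable_sq hX.measurable.aestronglyMeasurable,
    integrable_prod_iff' (hX.measurable.pow_const 2).aestronglyMeasurable]
  refine ⟨Eventually.of_forall fun x => (hX.memLp x).integrable_sq, ?_⟩
  refine Integrable.of_bound (C := B) ?_ (Eventually.of_forall fun x => ?_)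
  · exact ((hX.measurable.pow_const 2).norm.comp measurable_swap).aestronglyMeasurable.integral_prod_right'
  · rw [Real.norm_of_nonneg (integral_nonneg fun _ => norm_nonneg _)]
    simpa using hX.bound x

lemma ae_memLp (hX : IsSquareField X B μ) : ∀ᵐ ω ∂μ, MemLp (X ω) 2 surface := by
  have h := hX.memLp_prod.integrable_sq.prod_right_ae
  filter_upwards [h] with ω hω
  exact (memLp_two_iff_integrable_sq (hX.measurable.comp
    measurable_prodMk_left).aestronglyMeasurable).2 hω

lemma stronglyMeasurable_coef (hX : IsSquareField X B μ) (f : C(S2, ℝ)) :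
    StronglyMeasurable (coef f X) :=
  (hX.measurable.mul (f.continuous.measurable.comp measurable_snd)).stronglyMeasurable.integral_prod_right'

lemma integrable_coef_sq (hX : IsSquareField X B μ) (f : C(S2, ℝ)) :
    Integrable (fun ω => coef f X ω ^ 2) μ ∧
      ∫ ω, coef f X ω ^ 2 ∂μ ≤ B * (4 * Real.pi) * ∫ x, f x ^ 2 ∂surface := by
  have h1 : ∀ᵐ ω ∂μ, coef f X ω ^ 2 ≤ (∫ x, X ω x ^ 2 ∂surface) * ∫ x, f x ^ 2 ∂surface := by
    filter_upwards [hX.ae_memLp] with ω hω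
    exact sq_integral_mul_le hω (memLp_continuousMap f)
  have h2 : Integrable (fun ω => (∫ x, X ω x ^ 2 ∂surface) * ∫ x, f x ^ 2 ∂surface) μ :=
    (hX.memLp_prod.integrable_sq.integral_prod_left).mul_const _
  have h3 : Integrable (fun ω => coef f X ω ^ 2) μ := by
    refine h2.mono' ((hX.stronglyMeasurable_coef f).pow 2).aestronglyMeasurable ?_
    filter_upwards [h1] with ω hω
    rwa [Real.norm_of_nonneg (sq_nonneg _)]
  refine ⟨h3, (integral_mono_ae h3 h2 h1).trans ?_⟩
  rw [integral_mul_const]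
  refine mul_le_mul_of_nonneg_right ?_ (integral_nonneg fun _ => sq_nonneg _)
  rw [integral_integral_swap (f := fun ω x => X ω x ^ 2) hX.memLp_prod.integrable_sq]
  refine (integral_mono hX.memLp_prod.integrable_sq.integral_prod_right (integrable_const B)
    hX.bound).trans (le_of_eq ?_)
  rw [integral_const, surface_real_univ, smul_eq_mul, mul_comm]

lemma memLp_coef (hX : IsSquareField X B μ) (f : C(S2, ℝ)) : MemLp (coef f X) 2 μ :=
  (memLp_two_iff_integrable_sq (hX.stronglyMeasurable_coef f).aestronglyMeasurable).2
    (hX.integrable_coef_sq f).1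

/-- Fubini: pairing a coefficient with a square integrable variable. -/
lemma integral_mul_coef (hX : IsSquareField X B μ) (f : C(S2, ℝ)) {ζ : Ω → ℝ} (hζ : MemLp ζ 2 μ) :
    ∫ ω, ζ ω * coef f X ω ∂μ = ∫ x, (∫ ω, ζ ω * X ω x ∂μ) * f x ∂surface := by
  have h1 : MemLp (fun q : Ω × S2 => ζ q.1 * f q.2) 2 (μ.prod surface) := by
    rw [memLp_two_iff_integrable_sq]
    · have := hζ.integrable_sq.mul_prod (memLp_continuousMap f).integrable_sq
      refine this.congr (Eventually.of_forall fun q => ?_)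
      simp [mul_pow]
    · exact (hζ.aestronglyMeasurable.comp_fst).mul
        (f.continuous.measurable.comp measurable_snd).aestronglyMeasurable
  have h2 : Integrable (fun q : Ω × S2 => ζ q.1 * (X q.1 q.2 * f q.2)) (μ.prod surface) := by
    refine (h1.integrable_mul hX.memLp_prod).congr (Eventually.of_forall fun q => ?_)
    simp only [Pi.mul_apply]; ring
  simp_rw [coef, ← integral_const_mul]
  rw [integral_integral_swap h2]
  simp_rw [← mul_assoc, integral_mul_const]

lemma integral_coef (hX : IsSquareField X B μ) (f : C(S2, ℝ)) (h0 : ∀ x, ∫ ω, X ω x ∂μ = 0) :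
    ∫ ω, coef f X ω ∂μ = 0 := by
  have := hX.integral_mul_coef f (memLp_const 1)
  simpa [h0] using this

lemma integral_coef_mul_coef (hX : IsSquareField X B μ) (hX' : IsSquareField X' B' μ)
    (f g : C(S2, ℝ)) : ∫ ω, coef f X ω * coef g X' ω ∂μ =
      ∫ y, (∫ x, (∫ ω, X ω x * X' ω y ∂μ) * f x ∂surface) * g y ∂surface := by
  rw [hX'.integral_mul_coef g (hX.memLp_coef f)]
  congr 1
  ext y
  congr 1
  simp_rw [mul_comm (coef f X _)]
  rw [hX.integral_mul_coef f (hX'.memLp y)]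
  simp_rw [mul_comm]

end IsSquareField

end Coefficients

section Model

variable {Ω : Type*} [MeasurableSpace Ω] {μ : Measure Ω} [IsProbabilityMeasure μ]
  {T Z : Ω → S2 → ℤ → ℝ} {CZ : ℕ → ℝ}

lemma IsGaussianIsotropicStationary.exists_isSquareField (hT : IsGaussianIsotropicStationary T μ) :
    ∃ B, ∀ t, IsSquareField (fun ω x => T ω x t) B μ := by
  obtain ⟨Γ, hΓ⟩ := hT.covariance
  refine ⟨Γ 1 0, fun t => ⟨?_, fun x => ?_, fun x => ?_⟩⟩
  · exact hT.measurable.comp (measurable_fst.prodMk (measurable_snd.prodMk measurable_const))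
  · exact (hT.gaussian.hasGaussianLaw_eval (x, t)).memLp_two
  · have := hΓ x t x t
    rw [dot_self, sub_self] at this
    simp_rw [sq]; rw [this]

lemma IsSphericalWhiteNoise.exists_isSquareField (hZ : IsSphericalWhiteNoise Z CZ μ) :
    ∃ B, ∀ t, IsSquareField (fun ω x => Z ω x t) B μ := by
  refine ⟨∑' l, CZ l * zonal l 1, fun t => ⟨?_, fun x => ?_, fun x => ?_⟩⟩
  · exact hZ.measurable.comp (measurable_fst.prodMk (measurable_snd.prodMk measurable_const))
  · exact ((hZ.gaussian t).hasGaussianLaw_eval x).memLp_two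
  · have := (hZ.covariance x x t).tsum_eq
    rw [dot_self] at this
    simp_rw [sq]; rw [this]

/-- A variable orthogonal to every `T(x,t)` is, by Fubini, orthogonal to every coefficient. The
coefficients therefore lie in the closed Gaussian span of the field. -/
lemma IsGaussianIsotropicStationary.isGaussianProcess_coef
    (hT : IsGaussianIsotropicStationary T μ) {J : Type*} (f : J → C(S2, ℝ)) :
    IsGaussianProcess (fun (q : J × ℤ) ω => coef (f q.1) (fun ω x => T ω x q.2) ω) μ := by
  obtain ⟨B, hB⟩ := hT.exists_isSquareField
  have hξ : ∀ q : S2 × ℤ, MemLp (fun ω => T ω q.1 q.2) 2 μ := fun q => (hB q.2).memLp q.1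
  refine isGaussianProcess_of_mem_gaussianSpace hT.gaussian (fun q => hT.mean_zero _ _) hξ
    (fun q => (hB q.2).memLp_coef (f q.1)) fun q => ?_
  refine mem_gaussianSpace_of_orthogonal hξ _ fun ζ hζ h => ?_
  rw [(hB q.2).integral_mul_coef _ hζ]
  have h1 : ∀ x, ∫ ω, ζ ω * T ω x q.2 ∂μ = 0 := fun x => h (x, q.2)
  simp [h1]

variable {Y : (l : ℕ) → Fin (2 * l + 1) → C(S2, ℝ)}

/-- At equal times the covariance acts as an isotropic kernel, so Funk–Hecke gives the factor `C_l`;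
at different times the fields are independent and centred. -/
lemma IsSphericalWhiteNoise.integral_coef_mul_coef (hZ : IsSphericalWhiteNoise Z CZ μ)
    (hC : ∀ l, 0 < CZ l) (hY : IsHarmonicSystem Y) (i j : Σ l : ℕ, Fin (2 * l + 1)) (t s : ℤ) :
    ∫ ω, coef (Y i.1 i.2) (fun ω x => Z ω x t) ω * coef (Y j.1 j.2) (fun ω x => Z ω x s) ω ∂μ =
      if i = j ∧ t = s then CZ i.1 else 0 := by
  obtain ⟨B, hB⟩ := hZ.exists_isSquareField
  rw [(hB t).integral_coef_mul_coef (hB s)]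
  by_cases hts : t = s
  · subst hts
    -- The covariance expansion is known only at values `⟨x, y⟩`; each `z ∈ [-1, 1]` is such a
    -- value.
    have hexp : HasLegendreExpansion (fun z => ∑' l, CZ l * zonal l z) CZ := by
      intro z hz
      obtain ⟨x, y, rfl⟩ := exists_dot_eq hz
      exact (hZ.covariance x y t).summable.hasSum
    have hsum : Summable fun l => |CZ l| * (2 * (l : ℝ) + 1) := by
      refine (hZ.summable.mul_right (4 * Real.pi)).congr fun l => ?_
      rw [abs_of_pos (hC l)]
      field_simp
    have h1 : ∀ x y, ∫ ω, Z ω x t * Z ω y t ∂μ = ∑' l, CZ l * zonal l (dot y x) := by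
      intro x y
      rw [dot_comm]
      exact (hZ.covariance x y t).tsum_eq.symm
    simp_rw [h1]
    have h2 := hY.integral_kernel_mul hexp hsum i
    simp_rw [h2, mul_assoc]
    rw [integral_const_mul, hY.orthonormal]
    simp
  · have h1 : ∀ x y, ∫ ω, Z ω x t * Z ω y s ∂μ = 0 := by
      intro x y
      have hind : IndepFun (fun ω => Z ω x t) (fun ω => Z ω y s) μ :=
        (hZ.indep.indepFun hts).comp (measurable_pi_apply x) (measurable_pi_apply y)
      have := hind.integral_fun_mul_eq_mul_integral ((hB t).memLp x).aestronglyMeasurable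
        ((hB s).memLp y).aestronglyMeasurable
      rw [this, hZ.mean_zero, zero_mul]
    simp [h1, hts]

end Model

end SPHAR


/-! ### Kernel operators, normal equations and scalar recursions. -/

namespace SPHAR

section Kernel

variable {Y : (l : ℕ) → Fin (2 * l + 1) → C(S2, ℝ)}

lemma exists_kernel_bound {k : ℝ → ℝ} (hc : Continuous fun q : S2 × S2 => k (dot q.1 q.2)) :
    ∃ M, ∀ x y, |k (dot x y)| ≤ M := by
  obtain ⟨M, hM⟩ := (isCompact_univ (X := S2 × S2)).exists_bound_of_continuousOn hc.continuousOn
  exact ⟨M, fun x y => hM (x, y) trivial⟩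

lemma integrable_kernel_mul {k : ℝ → ℝ} (hc : Continuous fun q : S2 × S2 => k (dot q.1 q.2))
    {g : S2 → ℝ} (hg : Integrable g surface) (x : S2) :
    Integrable (fun y => k (dot x y) * g y) surface := by
  obtain ⟨M, hM⟩ := exists_kernel_bound hc
  exact hg.bdd_mul (c := M) (hc.comp (by fun_prop : Continuous fun y => (x, y))).aestronglyMeasurable
    (Eventually.of_forall fun y => hM x y)

lemma memLp_kernelOp {k : ℝ → ℝ} (hc : Continuous fun q : S2 × S2 => k (dot q.1 q.2))
    {g : S2 → ℝ} (hg : Integrable g surface) : MemLp (kernelOp k g) 2 surface := by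
  obtain ⟨M, hM⟩ := exists_kernel_bound hc
  refine MemLp.of_bound (C := M * ∫ y, |g y| ∂surface) ?_ (Eventually.of_forall fun x => ?_)
  · exact (hc.aestronglyMeasurable.mul hg.aestronglyMeasurable.comp_snd).integral_prod_right'
  · rw [← integral_const_mul]
    refine norm_integral_le_of_norm_le (hg.abs.const_mul M) (Eventually.of_forall fun y => ?_)
    rw [norm_mul]
    exact mul_le_mul_of_nonneg_right (hM x y) (abs_nonneg _)

lemma IsHarmonicSystem.integral_kernelOp_mul (hY : IsHarmonicSystem Y) {k : ℝ → ℝ} {φ : ℕ → ℝ}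
    (hk : HasLegendreExpansion k φ) (hφ : Summable fun l => |φ l| * (2 * (l : ℝ) + 1))
    {g : S2 → ℝ} (hg : Integrable g surface) (i : Σ l : ℕ, Fin (2 * l + 1)) :
    ∫ x, kernelOp k g x * Y i.1 i.2 x ∂surface = φ i.1 * ∫ x, g x * Y i.1 i.2 x ∂surface := by
  have hc := continuous_kernel hk hφ
  obtain ⟨M, hM⟩ := exists_kernel_bound hc
  have hint : Integrable (fun q : S2 × S2 => k (dot q.1 q.2) * g q.2 * Y i.1 i.2 q.1)
      (surface.prod surface) := by
    have h1 : Integrable (fun q : S2 × S2 => Y i.1 i.2 q.1 * g q.2) (surface.prod surface) :=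
      (integrable_of_continuous (Y i.1 i.2).continuous).mul_prod hg
    refine (h1.bdd_mul (c := M) hc.aestronglyMeasurable
      (Eventually.of_forall fun q => hM q.1 q.2)).congr (Eventually.of_forall fun q => ?_)
    simp only; ring
  simp_rw [kernelOp, ← integral_mul_const]
  rw [integral_integral_swap hint, ← integral_const_mul]
  congr 1
  ext y
  have := hY.integral_kernel_mul hk hφ i y
  calc ∫ x, k (dot x y) * g y * Y i.1 i.2 x ∂surface
      = g y * ∫ x, k (dot y x) * Y i.1 i.2 x ∂surface := by
        rw [← integral_const_mul]; congr 1; ext x; rw [dot_comm]; ring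
    _ = _ := by rw [this]; ring

lemma memLp_residual {p : ℕ} {k : Fin p → ℝ → ℝ} 
    (hc : ∀ j, Continuous fun q : S2 × S2 => k j (dot q.1 q.2)) {τ : S2 → ℤ → ℝ}
    (hτ : ∀ t, MemLp (fun x => τ x t) 2 surface) (t : ℤ) :
    MemLp (residual k τ t) 2 surface :=
  (hτ t).sub (memLp_finsetSum (f := fun j : Fin p => kernelOp (k j)
    (fun y => τ y (t - ((j : ℤ) + 1)))) Finset.univ fun j _ =>
    memLp_kernelOp (hc j) ((hτ _).integrable (by norm_num)))

lemma IsHarmonicSystem.integral_residual_mul (hY : IsHarmonicSystem Y) {p : ℕ}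
    {k : Fin p → ℝ → ℝ} {φ : ℕ → Fin p → ℝ}
    (hk : ∀ j, HasLegendreExpansion (k j) fun l => φ l j)
    (hφ : ∀ j, Summable fun l => |φ l j| * (2 * (l : ℝ) + 1)) {τ : S2 → ℤ → ℝ}
    (hτ : ∀ t, MemLp (fun x => τ x t) 2 surface) (t : ℤ) (i : Σ l : ℕ, Fin (2 * l + 1)) :
    ∫ x, residual k τ t x * Y i.1 i.2 x ∂surface = ∫ x, τ x t * Y i.1 i.2 x ∂surface -
      ∑ j, φ i.1 j * ∫ x, τ x (t - ((j : ℤ) + 1)) * Y i.1 i.2 x ∂surface := by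
  have hYi := memLp_continuousMap (Y i.1 i.2)
  have hint : ∀ j, Integrable (fun y => τ y (t - (((j : Fin p) : ℤ) + 1))) surface := fun j =>
    (hτ _).integrable (by norm_num)
  have hop : ∀ j : Fin p, Integrable (fun x =>
      kernelOp (k j) (fun y => τ y (t - ((j : ℤ) + 1))) x * Y i.1 i.2 x) surface := fun j =>
    (memLp_kernelOp (continuous_kernel (hk j) (hφ j)) (hint j)).integrable_mul hYi
  simp only [residual, sub_mul, Finset.sum_mul]
  have h0 : Integrable (fun x => τ x t * Y i.1 i.2 x) surface := (hτ t).integrable_mul hYi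
  rw [integral_sub h0 (integrable_finsetSum _ fun j _ => hop j),
    integral_finsetSum _ fun j _ => hop j]
  congr 1
  exact Finset.sum_congr rfl fun j _ => hY.integral_kernelOp_mul (hk j) (hφ j) (hint j) i

lemma IsHarmonicSystem.kernelOp_zonal (hY : IsHarmonicSystem Y) (l : ℕ) {g : S2 → ℝ}
    (hg : MemLp g 2 surface) (x : S2) :
    kernelOp (zonal l) g x = ∑ m, (∫ y, g y * Y l m y ∂surface) * Y l m x := by
  simp_rw [kernelOp, ← hY.addition, Finset.sum_mul, ← integral_mul_const]
  rw [integral_finsetSum _ fun m _ => ?_]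
  · refine Finset.sum_congr rfl fun m _ => ?_
    congr 1; ext y; ring
  · have := (hg.integrable_mul (memLp_continuousMap (Y l m))).mul_const (Y l m x)
    refine this.congr (Eventually.of_forall fun y => ?_)
    simp only [Pi.mul_apply]; ring

lemma residual_add_single {p : ℕ} {k : Fin p → ℝ → ℝ} {g : ℝ → ℝ}
    (hc : ∀ j, Continuous fun q : S2 × S2 => k j (dot q.1 q.2))
    (hg : Continuous fun q : S2 × S2 => g (dot q.1 q.2)) {τ : S2 → ℤ → ℝ}
    (hτ : ∀ t, MemLp (fun x => τ x t) 2 surface) (t : ℤ) (i : Fin p) (s : ℝ) (x : S2) :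
    residual (Function.update k i (fun z => k i z + s * g z)) τ t x =
      residual k τ t x - s * kernelOp g (fun y => τ y (t - ((i : ℤ) + 1))) x := by
  have h1 : ∀ j : Fin p, kernelOp (Function.update k i (fun z => k i z + s * g z) j)
      (fun y => τ y (t - ((j : ℤ) + 1))) x = kernelOp (k j) (fun y => τ y (t - ((j : ℤ) + 1))) x +
      if j = i then s * kernelOp g (fun y => τ y (t - ((i : ℤ) + 1))) x else 0 := by
    intro j
    have hint : Integrable (fun y => τ y (t - ((j : ℤ) + 1))) surface :=
      (hτ _).integrable (by norm_num)
    by_cases hj : j = i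
    · subst hj
      rw [Function.update_self, if_pos rfl, kernelOp, kernelOp, kernelOp, ← integral_const_mul,
        ← integral_add (integrable_kernel_mul (hc j) hint x)
          ((integrable_kernel_mul hg hint x).const_mul s)]
      congr 1; ext y; ring
    · rw [Function.update_of_ne hj, if_neg hj, add_zero]
  simp only [residual, h1, Finset.sum_add_distrib, Finset.sum_ite_eq', Finset.mem_univ, if_true]
  ring

lemma eq_zero_of_forall_quadratic {A B : ℝ} (hA : 0 ≤ A) (h : ∀ s : ℝ, 0 ≤ -2 * s * B + s ^ 2 * A) :
    B = 0 := by
  by_contra hB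
  -- The minimizer would be `B / A`; `A + 1` covers the case `A = 0` as well.
  have h1 := h (B / (A + 1))
  have h2 : -2 * (B / (A + 1)) * B + (B / (A + 1)) ^ 2 * A = -(B ^ 2 * (A + 2) / (A + 1) ^ 2) := by
    field_simp; ring
  rw [h2] at h1
  have : 0 < B ^ 2 * (A + 2) / (A + 1) ^ 2 := by positivity
  linarith

lemma exists_coeff_of_mem_kernelSpace {L : ℕ} {k : ℝ → ℝ} (hk : k ∈ kernelSpace L) :
    ∃ h : ℕ → ℝ, (∀ l, L < l → h l = 0) ∧ ∀ z, k z = ∑ l ∈ Finset.range (L + 1), h l * zonal l z := by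
  induction hk using Submodule.span_induction with
  | mem k hk =>
    obtain ⟨l, hl, rfl⟩ := hk
    refine ⟨fun l' => if l' = l then 1 else 0, fun l' hl' => if_neg ?_, fun z => ?_⟩
    · have : l ≤ L := hl
      omega
    · have : l < L + 1 := Nat.lt_succ_of_le hl
      simp [this]
  | zero => exact ⟨0, fun _ _ => rfl, fun z => by simp⟩
  | add f g _ _ h1 h2 =>
    obtain ⟨h1, h1', h1''⟩ := h1
    obtain ⟨h2, h2', h2''⟩ := h2
    refine ⟨h1 + h2, fun l hl => by simp [h1' l hl, h2' l hl], fun z => ?_⟩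
    rw [Pi.add_apply, h1'', h2'', ← Finset.sum_add_distrib]
    exact Finset.sum_congr rfl fun l _ => by simp [add_mul]
  | smul c f _ h1 =>
    obtain ⟨h1, h1', h1''⟩ := h1
    refine ⟨c • h1, fun l hl => by simp [h1' l hl], fun z => ?_⟩
    rw [Pi.smul_apply, h1'', smul_eq_mul, Finset.mul_sum]
    exact Finset.sum_congr rfl fun l _ => by simp [mul_assoc]

/-- Normal equations of the least-squares problem, degree by degree. -/
lemma IsHarmonicSystem.normal_equations (hY : IsHarmonicSystem Y) {p N L : ℕ} {τ : S2 → ℤ → ℝ}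
    (hτ : ∀ t, MemLp (fun x => τ x t) 2 surface) {khat : Fin p → ℝ → ℝ}
    (hest : IsKernelEstimate N L τ khat) :
    ∃ h : ℕ → Fin p → ℝ, (∀ j z, khat j z = ∑ l ∈ Finset.range (L + 1), h l j * zonal l z) ∧
      ∀ l ≤ L, ∀ i : Fin p, ∑ t ∈ Finset.Icc 1 N, ∑ m,
        (∫ x, τ x ((t : ℤ) + p - ((i : ℤ) + 1)) * Y l m x ∂surface) *
          ((∫ x, τ x ((t : ℤ) + p) * Y l m x ∂surface) -
            ∑ j, h l j * ∫ x, τ x ((t : ℤ) + p - ((j : ℤ) + 1)) * Y l m x ∂surface) = 0 := by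
  choose h h0 hh using fun j => exists_coeff_of_mem_kernelSpace (hest.1 j)
  have hk : ∀ j, HasLegendreExpansion (khat j) fun l => h j l := by
    intro j z _
    rw [hh j z]
    refine hasSum_sum_of_ne_finset_zero fun l hl => ?_
    rw [Finset.mem_range, not_lt] at hl
    simp only [h0 j l (by omega), zero_mul]
  have hs : ∀ j, Summable fun l => |h j l| * (2 * (l : ℝ) + 1) := by
    intro j
    refine summable_of_ne_finset_zero (s := Finset.range (L + 1)) fun l hl => ?_
    rw [Finset.mem_range, not_lt] at hl
    rw [h0 j l (by omega), abs_zero, zero_mul]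
  have hc := fun j => continuous_kernel (hk j) (hs j)
  have hz : ∀ l, Continuous fun q : S2 × S2 => zonal l (dot q.1 q.2) := fun l => by
    unfold zonal dot; fun_prop
  refine ⟨fun l j => h j l, hh, fun l hl i => ?_⟩
  set R : ℕ → S2 → ℝ := fun t => residual khat τ ((t : ℤ) + p) with hR
  set G : ℕ → S2 → ℝ := fun t => kernelOp (zonal l) (fun y => τ y ((t : ℤ) + p - ((i : ℤ) + 1)))
    with hG
  have hRm : ∀ t, MemLp (R t) 2 surface := fun t => memLp_residual hc hτ _
  have hGm : ∀ t, MemLp (G t) 2 surface := fun t =>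
    memLp_kernelOp (hz l) ((hτ _).integrable (by norm_num))
  -- First variation at lag `i` in the direction of the zonal function of degree `l ≤ L`, which
  -- keeps the competitor in `kernelSpace L`. The functional is quadratic along this line and
  -- minimal at `s = 0`, so its linear term vanishes.
  have hB : ∑ t ∈ Finset.Icc 1 N, ∫ x, R t x * G t x ∂surface = 0 := by
    refine eq_zero_of_forall_quadratic (A := ∑ t ∈ Finset.Icc 1 N, ∫ x, G t x ^ 2 ∂surface)
      (Finset.sum_nonneg fun t _ => integral_nonneg fun x => sq_nonneg _) fun s => ?_
    have h1 := hest.2 (Function.update khat i (fun z => khat i z + s * zonal l z)) fun j => by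
      by_cases hj : j = i
      · subst hj
        rw [Function.update_self]
        exact Submodule.add_mem _ (hest.1 j) (Submodule.smul_mem _ s
          (Submodule.subset_span ⟨l, hl, rfl⟩))
      · rw [Function.update_of_ne hj]; exact hest.1 j
    have h2 : leastSquares N τ (Function.update khat i (fun z => khat i z + s * zonal l z)) =
        leastSquares N τ khat + (-2 * s * (∑ t ∈ Finset.Icc 1 N, ∫ x, R t x * G t x ∂surface) +
          s ^ 2 * ∑ t ∈ Finset.Icc 1 N, ∫ x, G t x ^ 2 ∂surface) := by
      simp only [leastSquares, Finset.mul_sum, ← Finset.sum_add_distrib]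
      refine Finset.sum_congr rfl fun t _ => ?_
      simp_rw [residual_add_single hc (hz l) hτ]
      rw [← integral_const_mul, ← integral_const_mul]
      have i1 : Integrable (fun x => (-2 * s) * (R t x * G t x)) surface :=
        ((hRm t).integrable_mul (hGm t)).const_mul _
      have i2 : Integrable (fun x => s ^ 2 * G t x ^ 2) surface := (hGm t).integrable_sq.const_mul _
      have i3 : Integrable (fun x => (-2 * s) * (R t x * G t x) + s ^ 2 * G t x ^ 2) surface :=
        i1.add i2
      have i4 : Integrable (fun x => residual khat τ ((t : ℤ) + p) x ^ 2) surface :=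
        (hRm t).integrable_sq
      rw [← integral_add i1 i2, ← integral_add i4 i3]
      congr 1
      ext x
      simp only [hR, hG]
      ring
    rw [h2] at h1
    linarith
  rw [← hB]
  refine Finset.sum_congr rfl fun t _ => ?_
  -- By the addition formula, `kernelOp (zonal l)` is the projection onto degree `l`.
  have h3 : ∀ x, R t x * G t x = ∑ m, (∫ y, τ y ((t : ℤ) + p - ((i : ℤ) + 1)) * Y l m y ∂surface) *
      (R t x * Y l m x) := by
    intro x
    simp only [hG]
    rw [hY.kernelOp_zonal l (hτ _), Finset.mul_sum]
    exact Finset.sum_congr rfl fun m _ => by ring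
  simp_rw [h3]
  have h4 : ∀ m, Integrable (fun x => (∫ y, τ y ((t : ℤ) + p - ((i : ℤ) + 1)) * Y l m y ∂surface) *
      (R t x * Y l m x)) surface := fun m =>
    ((hRm t).integrable_mul (memLp_continuousMap (Y l m))).const_mul _
  rw [integral_finsetSum _ fun m _ => h4 m]
  refine Finset.sum_congr rfl fun m _ => ?_
  rw [integral_const_mul]
  congr 1
  exact (hY.integral_residual_mul (φ := fun l j => h j l) hk hs hτ _ ⟨l, m⟩).symm

end Kernel

section Recursion

variable {Ω : Type*} [MeasurableSpace Ω] {μ : Measure Ω} [IsProbabilityMeasure μ]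
  {T Z : Ω → S2 → ℤ → ℝ} {CZ : ℕ → ℝ} {Y : (l : ℕ) → Fin (2 * l + 1) → C(S2, ℝ)}

lemma IsGaussianIsotropicStationary.ae_memLp (hT : IsGaussianIsotropicStationary T μ) :
    ∀ᵐ ω ∂μ, ∀ t, MemLp (fun x => T ω x t) 2 surface := by
  obtain ⟨B, hB⟩ := hT.exists_isSquareField
  exact ae_all_iff.2 fun t => (hB t).ae_memLp

/-- The harmonic coefficients satisfy scalar autoregressions. -/
lemma IsSPHAR.coef_recursion {p : ℕ} {k : Fin p → ℝ → ℝ} {φ : ℕ → Fin p → ℝ}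
    (hTZ : IsSPHAR k T Z μ) (hT : IsGaussianIsotropicStationary T μ) (hY : IsHarmonicSystem Y)
    (hk : ∀ j, HasLegendreExpansion (k j) fun l => φ l j)
    (hφ : ∀ j, Summable fun l => |φ l j| * (2 * (l : ℝ) + 1)) (i : Σ l : ℕ, Fin (2 * l + 1))
    (t : ℤ) : ∀ᵐ ω ∂μ, coef (Y i.1 i.2) (fun ω x => T ω x t) ω -
      ∑ j, φ i.1 j * coef (Y i.1 i.2) (fun ω x => T ω x (t - (((j : Fin p) : ℤ) + 1))) ω =
        coef (Y i.1 i.2) (fun ω x => Z ω x t) ω := by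
  filter_upwards [hT.ae_memLp, Measure.ae_ae_of_ae_prod (hTZ.2 t)] with ω h1 h2
  have h3 := hY.integral_residual_mul hk hφ (τ := T ω) h1 t i
  simp only [coef]
  rw [← h3]
  refine integral_congr_ae ?_
  filter_upwards [h2] with x hx
  rw [sub_eq_zero.1 hx]

end Recursion

end SPHAR


/-! ### Causal inversion of the autoregressive filter. -/

namespace SPHAR

section CausalFilter

/-- The absolutely summable causal inverse `ψ` of the filter `1 - ∑ φ_j B^{j+1}`. -/
structure IsCausalInverse {p : ℕ} (φ : Fin p → ℝ) (ψ : ℤ → ℝ) : Prop where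
  summable : Summable fun n => |ψ n|
  causal : ∀ n < 0, ψ n = 0
  recursion : ∀ n, ψ n - ∑ j, φ j * ψ (n - ((j : ℤ) + 1)) = if n = 0 then 1 else 0

lemma hasSum_shift_causal {c : ℤ → ℂ} (hc : ∀ n < 0, c n = 0) {w s : ℂ}
    (h : HasSum (fun n : ℕ => w ^ n * c n) s) (j : ℕ) :
    HasSum (fun n : ℕ => w ^ n * c (n - ((j : ℤ) + 1))) (w ^ (j + 1) * s) := by
  rw [← hasSum_nat_add_iff' (j + 1)]
  have h0 : ∑ i ∈ Finset.range (j + 1), w ^ i * c (i - ((j : ℤ) + 1)) = 0 := by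
    refine Finset.sum_eq_zero fun i hi => ?_
    rw [Finset.mem_range] at hi
    rw [hc _ (by omega), mul_zero]
  rw [h0, sub_zero]
  have h1 : (fun n : ℕ => w ^ (n + (j + 1)) * c ((n + (j + 1) : ℕ) - ((j : ℤ) + 1))) =
      fun n : ℕ => w ^ (j + 1) * (w ^ n * c n) := by
    ext n
    have : ((n + (j + 1) : ℕ) : ℤ) - ((j : ℤ) + 1) = n := by push_cast; ring
    rw [this, pow_add]
    ring
  rw [h1]
  exact h.mul_left _

/-- The sequence `ψ` consists of the Taylor coefficients of `1/g`, where `g` is the autoregressive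
polynomial. As `g` has no zero in the disc of radius `1 + δ`, the radius of convergence exceeds `1`,
which gives absolute summability. Comparing coefficients in `g · (1/g) = 1` gives the recursion. -/
lemma exists_isCausalInverse {p : ℕ} (φ : Fin p → ℝ) {δ : ℝ} (hδ : 0 < δ)
    (h : ∀ w : ℂ, ‖w‖ ≤ 1 + δ → 1 - ∑ j : Fin p, (φ j : ℂ) * w ^ ((j : ℕ) + 1) ≠ 0) :
    ∃ ψ, IsCausalInverse φ ψ := by
  set g : ℂ → ℂ := fun w => 1 - ∑ j : Fin p, (φ j : ℂ) * w ^ ((j : ℕ) + 1) with hg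
  set R : NNReal := ⟨1 + δ, by positivity⟩ with hR
  have hR1 : (1 : NNReal) < R := by
    rw [← NNReal.coe_lt_coe]; change (1 : ℝ) < 1 + δ; linarith
  have hgd : Differentiable ℂ g := by rw [hg]; fun_prop
  have hdiff : DifferentiableOn ℂ (fun w => (g w)⁻¹) (Metric.closedBall 0 R) := by
    intro w hw
    refine (hgd.differentiableAt.inv (h w ?_)).differentiableWithinAt
    rw [Metric.mem_closedBall, dist_zero_right] at hw
    exact hw
  have hps := hdiff.hasFPowerSeriesOnBall (lt_trans one_pos hR1)
  set P := cauchyPowerSeries (fun w => (g w)⁻¹) 0 R with hP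
  set c : ℤ → ℂ := fun n => if 0 ≤ n then P.coeff n.toNat else 0 with hc
  have hcn : ∀ n : ℕ, c n = P.coeff n := fun n => by simp [hc]
  have hc0 : ∀ n < 0, c n = 0 := fun n hn => by simp [hc, not_le.2 hn]
  have hsumN : Summable fun n : ℕ => ‖c n‖ := by
    have h1 : ((1 : NNReal) : ENNReal) < P.radius :=
      lt_of_lt_of_le (by exact_mod_cast hR1) hps.r_le
    have := P.summable_norm_mul_pow h1
    refine this.congr fun n => ?_
    rw [hcn]; simp [FormalMultilinearSeries.norm_apply_eq_norm_coef]
  have hsum : Summable fun n : ℤ => ‖c n‖ := by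
    rw [summable_int_iff_summable_nat_and_neg]
    refine ⟨hsumN, summable_of_ne_finset_zero (s := {0}) fun n hn => ?_⟩
    rw [Finset.mem_singleton] at hn
    rw [hc0 _ (by omega), norm_zero]
  have hfs : ∀ w : ℂ, ‖w‖ < 1 → HasSum (fun n : ℕ => w ^ n * c n) (g w)⁻¹ := by
    intro w hw
    have := hps.hasSum (y := w) (by
      rw [Metric.eball_coe, Metric.mem_ball, dist_zero_right]
      exact hw.trans (by exact_mod_cast hR1))
    simpa [FormalMultilinearSeries.apply_eq_pow_smul_coeff, hcn] using this
  set d : ℕ → ℂ := fun n => c n - ∑ j : Fin p, (φ j : ℂ) * c (n - ((j : ℤ) + 1)) with hd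
  have hds : ∀ w : ℂ, ‖w‖ < 1 → HasSum (fun n : ℕ => w ^ n * d n) 1 := by
    intro w hw
    have h1 := hfs w hw
    have h2 := hasSum_sum (s := Finset.univ) fun (j : Fin p) _ =>
      (hasSum_shift_causal hc0 h1 j).mul_left (φ j : ℂ)
    have h3 := h1.sub h2
    have h4 : (fun n : ℕ => w ^ n * d n) = fun n : ℕ => w ^ n * c n -
        ∑ j : Fin p, (φ j : ℂ) * (w ^ n * c (n - ((j : ℤ) + 1))) := by
      ext n
      simp only [hd, mul_sub, Finset.mul_sum]
      congr 1
      exact Finset.sum_congr rfl fun j _ => by ring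
    have hgw : g w ≠ 0 := h w (hw.le.trans (by linarith))
    have h5 : (g w)⁻¹ - ∑ j : Fin p, (φ j : ℂ) * (w ^ ((j : ℕ) + 1) * (g w)⁻¹) = 1 := by
      rw [← mul_inv_cancel₀ hgw]
      nth_rw 3 [hg]
      rw [sub_mul, one_mul, Finset.sum_mul]
      congr 1
      exact Finset.sum_congr rfl fun j _ => by ring
    rw [h5] at h3
    rw [h4]
    exact h3
  have hd1 : HasFPowerSeriesAt (fun _ : ℂ => (1 : ℂ)) (FormalMultilinearSeries.ofScalars ℂ d) 0 := by
    rw [hasFPowerSeriesAt_iff]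
    filter_upwards [Metric.ball_mem_nhds (0 : ℂ) one_pos] with w hw
    have := hds w (by simpa using hw)
    simpa [FormalMultilinearSeries.coeff_ofScalars] using this
  have hd2 := hd1.eq_formalMultilinearSeries
    (hasFPowerSeriesAt_const (𝕜 := ℂ) (E := ℂ) (c := (1 : ℂ)) (e := 0))
  have hdn : ∀ n : ℕ, d n = if n = 0 then 1 else 0 := by
    intro n
    have h1 : (FormalMultilinearSeries.ofScalars ℂ d).coeff n = d n := by
      simp [FormalMultilinearSeries.coeff_ofScalars]
    rw [← h1, hd2]
    cases n with
    | zero => simp [FormalMultilinearSeries.coeff]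
    | succ n => simp [FormalMultilinearSeries.coeff, constFormalMultilinearSeries_apply_succ]
  -- The recursion has real coefficients, so it survives taking real parts.
  refine ⟨fun n => (c n).re, ⟨?_, fun n hn => by simp [hc0 n hn], fun n => ?_⟩⟩
  · exact Summable.of_nonneg_of_le (fun n => abs_nonneg _) (fun n => Complex.abs_re_le_norm _) hsum
  · rcases lt_or_ge n 0 with hn | hn
    · rw [if_neg hn.ne, hc0 n hn, Finset.sum_eq_zero]
      · simp
      · intro j _
        rw [hc0 _ (by omega)]; simp
    · lift n to ℕ using hn
      have h1 := congrArg Complex.re (hdn n)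
      simp only [hd, Complex.sub_re, Complex.re_sum, Complex.re_ofReal_mul] at h1
      rw [h1]
      by_cases hn : n = 0 <;> simp [hn]

namespace IsCausalInverse

variable {p : ℕ} {φ : Fin p → ℝ} {ψ : ℤ → ℝ}

lemma apply_zero (h : IsCausalInverse φ ψ) : ψ 0 = 1 := by
  have h1 := h.recursion 0
  rw [if_pos rfl, Finset.sum_eq_zero] at h1
  · linarith
  · intro j _
    rw [h.causal _ (by omega), mul_zero]

lemma summable_mul (h : IsCausalInverse φ ψ) {b : ℤ → ℝ} {B : ℝ} (hb : ∀ t, |b t| ≤ B)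
    (σ : ℤ → ℤ) : Summable fun n => ψ n * b (σ n) := by
  refine Summable.of_norm_bounded (h.summable.mul_right B) fun n => ?_
  rw [norm_mul]
  exact mul_le_mul_of_nonneg_left (hb _) (abs_nonneg _)

/-- Inversion of the autoregressive filter on bounded sequences. -/
lemma hasSum_filter (h : IsCausalInverse φ ψ) {b : ℤ → ℝ} {B : ℝ} (hb : ∀ t, |b t| ≤ B) (t : ℤ) :
    HasSum (fun n => ψ n * (b (t - n) - ∑ j, φ j * b (t - n - ((j : ℤ) + 1)))) (b t) := by
  have h1 : HasSum (fun n => ψ n * b (t - n)) (∑' n, ψ n * b (t - n)) :=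
    (h.summable_mul hb _).hasSum
  -- Reindexing moves the lag from `b` to `ψ`, where the filter produces the unit impulse at `0`.
  have h2 : ∀ j : Fin p, HasSum (fun n => ψ n * b (t - n - ((j : ℤ) + 1)))
      (∑' n, ψ (n - ((j : ℤ) + 1)) * b (t - n)) := by
    intro j
    have hs := (h.summable_mul hb fun n => t - n - ((j : ℤ) + 1)).hasSum
    convert hs using 1
    rw [← (Equiv.subRight ((j : ℤ) + 1)).tsum_eq fun n => ψ n * b (t - n - ((j : ℤ) + 1))]
    congr 1; ext n
    simp only [Equiv.subRight_apply]
    rw [show t - (n - ((j : ℤ) + 1)) - ((j : ℤ) + 1) = t - n by ring]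
  have h2' : ∀ j : Fin p, HasSum (fun n => ψ (n - ((j : ℤ) + 1)) * b (t - n))
      (∑' n, ψ (n - ((j : ℤ) + 1)) * b (t - n)) := by
    intro j
    refine Summable.hasSum ?_
    rw [← (Equiv.addRight ((j : ℤ) + 1)).summable_iff]
    refine (h.summable_mul hb fun n => t - n - ((j : ℤ) + 1)).congr fun n => ?_
    simp only [Function.comp_apply, Equiv.coe_addRight]
    rw [add_sub_cancel_right, show t - (n + ((j : ℤ) + 1)) = t - n - ((j : ℤ) + 1) by ring]
  have h3 := h1.sub (hasSum_sum (s := Finset.univ) fun j _ => (h2 j).mul_left (φ j))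
  have h4 := h1.sub (hasSum_sum (s := Finset.univ) fun j _ => (h2' j).mul_left (φ j))
  have h5 : HasSum (fun n => ψ n * b (t - n) - ∑ j, φ j * (ψ (n - ((j : ℤ) + 1)) * b (t - n)))
      (b t) := by
    have : ∀ n, ψ n * b (t - n) - ∑ j, φ j * (ψ (n - ((j : ℤ) + 1)) * b (t - n)) =
        if n = 0 then b t else 0 := by
      intro n
      calc _ = (ψ n - ∑ j, φ j * ψ (n - ((j : ℤ) + 1))) * b (t - n) := by
            rw [sub_mul, Finset.sum_mul]
            congr 1
            exact Finset.sum_congr rfl fun j _ => by ring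
        _ = _ := by
            rw [h.recursion]
            by_cases hn : n = 0 <;> simp [hn]
    simp_rw [this]
    exact hasSum_ite_eq 0 (b t)
  rw [h4.unique h5] at h3
  have h6 : (fun n => ψ n * (b (t - n) - ∑ j, φ j * b (t - n - ((j : ℤ) + 1)))) =
      fun n => ψ n * b (t - n) - ∑ j, φ j * (ψ n * b (t - n - ((j : ℤ) + 1))) := by
    ext n
    rw [mul_sub, Finset.mul_sum]
    congr 1
    exact Finset.sum_congr rfl fun j _ => by ring
  rwa [h6]

/-- The `ℓ¹` norm of both sides of the recursion. When `∑|φ_j|` is small it forces the norm of `ψ`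
close to `1`. -/
lemma tsum_abs_le (h : IsCausalInverse φ ψ) :
    ∑' n, |ψ n| ≤ 1 + (∑ j, |φ j|) * ∑' n, |ψ n| := by
  have h1 : ∀ j : Fin p, HasSum (fun n => |φ j| * |ψ (n - ((j : ℤ) + 1))|)
      (|φ j| * ∑' n, |ψ n|) := fun j =>
    (((Equiv.subRight ((j : ℤ) + 1)).hasSum_iff).2 h.summable.hasSum).mul_left _
  have h2 := (hasSum_ite_eq (0 : ℤ) (1 : ℝ)).add (hasSum_sum (s := Finset.univ) fun j _ => h1 j)
  rw [Finset.sum_mul]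
  refine hasSum_le (fun n => ?_) h.summable.hasSum h2
  have h3 := h.recursion n
  have h4 : ψ n = (if n = 0 then 1 else 0) + ∑ j, φ j * ψ (n - ((j : ℤ) + 1)) := by linarith
  calc |ψ n| = |(if n = 0 then 1 else 0) + ∑ j, φ j * ψ (n - ((j : ℤ) + 1))| := by rw [← h4]
    _ ≤ |if n = 0 then (1 : ℝ) else 0| + ∑ j, |φ j * ψ (n - ((j : ℤ) + 1))| :=
        (abs_add_le _ _).trans (add_le_add_right (Finset.abs_sum_le_sum_abs _ _) _)
    _ = _ := by
        simp_rw [abs_mul]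
        congr 1
        split_ifs <;> simp

lemma one_le_tsum_abs (h : IsCausalInverse φ ψ) : 1 ≤ ∑' n, |ψ n| := by
  have := h.summable.le_tsum 0 fun _ _ => abs_nonneg _
  rwa [h.apply_zero, abs_one] at this

end IsCausalInverse

/-- The autocovariance function of the autoregression with causal inverse `ψ`. -/
noncomputable def autocov (ψ : ℤ → ℝ) (τ : ℤ) : ℝ := ∑' n, ψ n * ψ (n - τ)

namespace IsCausalInverse

variable {p : ℕ} {φ : Fin p → ℝ} {ψ : ℤ → ℝ}

lemma abs_le (h : IsCausalInverse φ ψ) (n : ℤ) : |ψ n| ≤ ∑' n, |ψ n| :=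
  h.summable.le_tsum n fun _ _ => abs_nonneg _

lemma hasSum_autocov (h : IsCausalInverse φ ψ) (τ : ℤ) :
    HasSum (fun n => ψ n * ψ (n - τ)) (autocov ψ τ) :=
  (h.summable_mul h.abs_le fun n => n - τ).hasSum

/-- Young's inequality for the correlation of `ψ` with itself; injectivity of `σ` ensures that no
lag is counted twice. -/
lemma sum_abs_autocov_le (h : IsCausalInverse φ ψ) {J : Type*} (I : Finset J) {σ : J → ℤ}
    (hσ : Set.InjOn σ I) : ∑ i ∈ I, |autocov ψ (σ i)| ≤ (∑' n, |ψ n|) ^ 2 := by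
  have h1 : ∀ i, |autocov ψ (σ i)| ≤ ∑' n, |ψ n| * |ψ (n - σ i)| := by
    intro i
    have hs : Summable fun n => |ψ n| * |ψ (n - σ i)| := by
      simpa [abs_mul] using (h.summable_mul h.abs_le fun n => n - σ i).abs
    rw [autocov, ← Real.norm_eq_abs]
    refine tsum_of_norm_bounded hs.hasSum fun n => ?_
    rw [norm_mul]; rfl
  have hs : ∀ i, Summable fun n => |ψ n| * |ψ (n - σ i)| := fun i => by
    simpa [abs_mul] using (h.summable_mul h.abs_le fun n => n - σ i).abs
  refine (Finset.sum_le_sum fun i _ => h1 i).trans ?_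
  rw [← Summable.tsum_finsetSum fun i _ => hs i, sq, ← tsum_mul_right]
  refine Summable.tsum_le_tsum (fun n => ?_) (summable_sum fun i _ => hs i) (h.summable.mul_right _)
  rw [← Finset.mul_sum]
  refine mul_le_mul_of_nonneg_left ?_ (abs_nonneg _)
  classical
  have : ∑ i ∈ I, |ψ (n - σ i)| = ∑ m ∈ I.image fun i => n - σ i, |ψ m| := by
    rw [Finset.sum_image]
    intro i hi j hj hij
    exact hσ hi hj (by simpa using hij)
  rw [this]
  exact h.summable.sum_le_tsum _ fun _ _ => abs_nonneg _

lemma abs_autocov_le (h : IsCausalInverse φ ψ) (τ : ℤ) : |autocov ψ τ| ≤ (∑' n, |ψ n|) ^ 2 := by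
  simpa using h.sum_abs_autocov_le {()} (σ := fun _ : Unit => τ) (by simp)

lemma one_le_autocov_zero (h : IsCausalInverse φ ψ) : 1 ≤ autocov ψ 0 := by
  have h1 := (h.hasSum_autocov 0).summable.le_tsum 0 fun n _ => by
    rw [sub_zero]; exact mul_self_nonneg _
  rw [autocov]
  simpa [h.apply_zero] using h1

/-- The autocovariance at `0` is at least `1`, while the absolute values at `0` and `τ` sum to at
most the squared `ℓ¹` norm; only the excess of the latter over `1` is left for the deviation from
white noise. -/
lemma abs_autocov_sub_le (h : IsCausalInverse φ ψ) (τ : ℤ) :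
    |autocov ψ τ - if τ = 0 then 1 else 0| ≤ (∑' n, |ψ n|) ^ 2 - 1 := by
  have h0 := h.one_le_autocov_zero
  by_cases hτ : τ = 0
  · subst hτ
    have := h.abs_autocov_le 0
    rw [if_pos rfl, abs_of_nonneg (by linarith)]
    linarith [le_abs_self (autocov ψ 0)]
  · have := h.sum_abs_autocov_le {0, τ} (σ := id) (by simp)
    rw [Finset.sum_pair (Ne.symm hτ)] at this
    rw [if_neg hτ, sub_zero]
    simp only [id] at this
    linarith [le_abs_self (autocov ψ 0)]

lemma autocov_neg (ψ : ℤ → ℝ) (τ : ℤ) : autocov ψ (-τ) = autocov ψ τ := by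
  rw [autocov, autocov, ← (Equiv.subRight τ).tsum_eq]
  congr 1; ext n
  simp only [Equiv.subRight_apply, sub_neg_eq_add, sub_add_cancel]
  ring

end IsCausalInverse

end CausalFilter

end SPHAR


/-! ### Autocovariance matrices: invertibility and convergence to the identity. -/

namespace SPHAR

section AutocovMatrix

/-- The `p × p` Toeplitz matrix of autocovariances. -/
noncomputable def autocovMatrix (p : ℕ) (ψ : ℤ → ℝ) : Matrix (Fin p) (Fin p) ℝ :=
  Matrix.of fun i j => autocov ψ ((i : ℤ) - j)

namespace IsCausalInverse

variable {p : ℕ} {φ : Fin p → ℝ} {ψ : ℤ → ℝ}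

lemma hasSum_autocov_shift (h : IsCausalInverse φ ψ) (i j : ℤ) :
    HasSum (fun n => ψ (n - i) * ψ (n - j)) (autocov ψ (i - j)) := by
  have h1 := h.hasSum_autocov (j - i)
  rw [← (Equiv.subRight i).hasSum_iff, ← autocov_neg, neg_sub] at h1
  refine h1.congr_fun fun n => ?_
  simp only [Function.comp_apply, Equiv.subRight_apply]
  congr 2
  ring

lemma hasSum_quadratic (h : IsCausalInverse φ ψ) (v : Fin p → ℝ) :
    HasSum (fun n => (∑ i, v i * ψ (n - (i : ℤ))) ^ 2)
      (∑ i, ∑ j, v i * (autocovMatrix p ψ i j * v j)) := by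
  have h1 := hasSum_sum (s := Finset.univ) fun (i : Fin p) _ =>
    hasSum_sum (s := Finset.univ) fun (j : Fin p) _ =>
      ((h.hasSum_autocov_shift i j).mul_right (v j)).mul_left (v i)
  refine h1.congr_fun fun n => ?_
  rw [sq, Finset.sum_mul_sum]
  exact Finset.sum_congr rfl fun i _ => Finset.sum_congr rfl fun j _ => by ring

/-- The quadratic form is `∑_n (∑_i v_i ψ_{n-i})²`. If it vanishes, every inner sum does; by
causality and `ψ_0 = 1` these equations are triangular for `n = 0, …, p - 1` and give `v = 0`. -/
lemma det_autocovMatrix_ne_zero (h : IsCausalInverse φ ψ) : (autocovMatrix p ψ).det ≠ 0 := by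
  intro hdet
  obtain ⟨v, hv, hv0⟩ := Matrix.exists_mulVec_eq_zero_iff.2 hdet
  refine hv (funext ?_)
  have hq := h.hasSum_quadratic v
  have h0 : ∑ i, ∑ j, v i * (autocovMatrix p ψ i j * v j) = 0 := by
    refine Finset.sum_eq_zero fun i _ => ?_
    rw [← Finset.mul_sum]
    have : ∑ j, autocovMatrix p ψ i j * v j = 0 := congrFun hv0 i
    rw [this, mul_zero]
  rw [h0] at hq
  have h1 := (hasSum_zero_iff_of_nonneg fun n => sq_nonneg _).1 hq
  have h2 : ∀ m : ℕ, ∀ i : Fin p, (i : ℕ) = m → v i = 0 := by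
    intro m
    induction m using Nat.strong_induction_on with
    | _ m ih =>
      intro i hi
      have h3 := congrFun h1 (i : ℤ)
      simp only [Pi.zero_apply, sq_eq_zero_iff] at h3
      rw [Finset.sum_eq_single i] at h3
      · simpa [h.apply_zero] using h3
      · intro j _ hj
        rcases lt_or_gt_of_ne (Fin.val_ne_of_ne hj) with hlt | hgt
        · rw [ih j (hi ▸ hlt) j rfl, zero_mul]
        · rw [h.causal _ (by omega), mul_zero]
      · simp
  exact fun i => h2 i i rfl

/-- Autocovariance matrices are invertible. -/
lemma isUnit_det_autocovMatrix (h : IsCausalInverse φ ψ) : IsUnit (autocovMatrix p ψ).det :=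
  isUnit_iff_ne_zero.2 h.det_autocovMatrix_ne_zero

lemma tsum_abs_le_two (h : IsCausalInverse φ ψ) (hφ : ∑ j, |φ j| ≤ 1 / 2) : ∑' n, |ψ n| ≤ 2 := by
  have h1 := h.tsum_abs_le
  have h2 := h.one_le_tsum_abs
  nlinarith

end IsCausalInverse

variable {p : ℕ} {φ : ℕ → Fin p → ℝ} {ψ : ℕ → ℤ → ℝ}

lemma tendsto_tsum_abs (h : ∀ l, IsCausalInverse (φ l) (ψ l))
    (hφ : ∀ j, Tendsto (fun l => φ l j) atTop (𝓝 0)) :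
    Tendsto (fun l => ∑' n, |ψ l n|) atTop (𝓝 1) := by
  have hs : Tendsto (fun l => ∑ j, |φ l j|) atTop (𝓝 0) := by
    have := tendsto_finsetSum (Finset.univ : Finset (Fin p)) fun j _ => (hφ j).abs
    simpa using this
  refine tendsto_of_tendsto_of_tendsto_of_le_of_le' tendsto_const_nhds
    (h := fun l => 1 + (∑ j, |φ l j|) * 2) ?_ (Eventually.of_forall fun l => (h l).one_le_tsum_abs) ?_
  · simpa using (hs.mul_const 2).const_add 1
  · filter_upwards [hs.eventually_le_const (by norm_num : (0 : ℝ) < 1 / 2)] with l hl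
    have h1 := (h l).tsum_abs_le
    have h2 := (h l).tsum_abs_le_two hl
    have h3 : 0 ≤ ∑ j, |φ l j| := Finset.sum_nonneg fun j _ => abs_nonneg _
    nlinarith

lemma exists_tsum_abs_le (h : ∀ l, IsCausalInverse (φ l) (ψ l))
    (hφ : ∀ j, Tendsto (fun l => φ l j) atTop (𝓝 0)) : ∃ Q, ∀ l, ∑' n, |ψ l n| ≤ Q := by
  obtain ⟨Q, hQ⟩ := (tendsto_tsum_abs h hφ).bddAbove_range
  exact ⟨Q, fun l => hQ ⟨l, rfl⟩⟩

/-- At high degrees the series are nearly white noise: as `φ_l → 0` the `ℓ¹` norm of `ψ_l` tends to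
`1`, which controls every entry. This is why the limiting covariance in the theorem is the identity.
-/
lemma tendsto_autocovMatrix_inv (h : ∀ l, IsCausalInverse (φ l) (ψ l))
    (hφ : ∀ j, Tendsto (fun l => φ l j) atTop (𝓝 0)) :
    Tendsto (fun l => (autocovMatrix p (ψ l))⁻¹) atTop (𝓝 1) := by
  have h1 : Tendsto (fun l => autocovMatrix p (ψ l)) atTop (𝓝 1) := by
    refine tendsto_pi_nhds.2 fun i => tendsto_pi_nhds.2 fun j => ?_
    have h2 : Tendsto (fun l => (∑' n, |ψ l n|) ^ 2 - 1) atTop (𝓝 0) := by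
      simpa using ((tendsto_tsum_abs h hφ).pow 2).sub_const 1
    rw [tendsto_iff_norm_sub_tendsto_zero]
    refine squeeze_zero (fun l => norm_nonneg _) (fun l => ?_) h2
    have h3 := (h l).abs_autocov_sub_le ((i : ℤ) - j)
    have h4 : (1 : Matrix (Fin p) (Fin p) ℝ) i j = if ((i : ℤ) - j) = 0 then 1 else 0 := by
      rw [Matrix.one_apply]
      congr 1
      rw [sub_eq_zero, Nat.cast_inj, Fin.val_inj]
    rw [h4]
    exact h3
  have h5 : ContinuousAt (fun A : Matrix (Fin p) (Fin p) ℝ => A⁻¹) 1 := by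
    refine continuousAt_matrix_inv _ ?_
    rw [Matrix.det_one, Ring.inverse_eq_inv']
    exact continuousAt_inv₀ one_ne_zero
  have h6 := h5.tendsto.comp h1
  rwa [inv_one] at h6

lemma exists_autocovMatrix_inv_bound (h : ∀ l, IsCausalInverse (φ l) (ψ l))
    (hφ : ∀ j, Tendsto (fun l => φ l j) atTop (𝓝 0)) :
    ∃ K, ∀ l i j, |(autocovMatrix p (ψ l))⁻¹ i j| ≤ K := by
  have h1 : ∀ q : Fin p × Fin p, ∃ K, ∀ l, |(autocovMatrix p (ψ l))⁻¹ q.1 q.2| ≤ K := by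
    intro q
    have h2 := ((tendsto_pi_nhds.1 ((tendsto_pi_nhds.1 (tendsto_autocovMatrix_inv h hφ)) q.1)) q.2).abs
    obtain ⟨K, hK⟩ := h2.bddAbove_range
    exact ⟨K, fun l => hK ⟨l, rfl⟩⟩
  choose K hK using h1
  refine ⟨∑ q, |K q|, fun l i j => (hK (i, j) l).trans ((le_abs_self _).trans ?_)⟩
  exact Finset.single_le_sum (f := fun q => |K q|) (fun q _ => abs_nonneg _) (Finset.mem_univ (i, j))

end AutocovMatrix

end SPHAR


/-! ### Moments of jointly Gaussian variables and Isserlis' formula. -/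

namespace SPHAR

set_option linter.unusedSectionVars false

section Moments

variable {Ω : Type*} [MeasurableSpace Ω] {μ : Measure Ω}

/-- A random variable all of whose moments are finite. -/
def HasMoments (f : Ω → ℝ) (μ : Measure Ω) : Prop := ∀ q : ENNReal, q ≠ ⊤ → MemLp f q μ

namespace HasMoments

variable {f g : Ω → ℝ}

lemma memLp_two (hf : HasMoments f μ) : MemLp f 2 μ := hf 2 (by norm_num)

lemma integrable (hf : HasMoments f μ) : Integrable f μ :=
  memLp_one_iff_integrable.1 (hf 1 (by norm_num))

lemma add (hf : HasMoments f μ) (hg : HasMoments g μ) : HasMoments (fun ω => f ω + g ω) μ :=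
  fun q hq => (hf q hq).add (hg q hq)

lemma const_mul (hf : HasMoments f μ) (c : ℝ) : HasMoments (fun ω => c * f ω) μ :=
  fun q hq => (hf q hq).const_mul c

lemma mul (hf : HasMoments f μ) (hg : HasMoments g μ) : HasMoments (fun ω => f ω * g ω) μ := by
  intro q hq
  have h2 : (2 * q) ≠ ⊤ := ENNReal.mul_ne_top (by norm_num) hq
  have : ENNReal.HolderTriple (2 * q) (2 * q) q := ⟨by
    rw [ENNReal.mul_inv (Or.inl (by norm_num)) (Or.inl (by norm_num)), ← add_mul,
      ENNReal.inv_two_add_inv_two, one_mul]⟩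
  exact (hg _ h2).mul' (hf _ h2)

lemma sum {J : Type*} {F : J → Ω → ℝ} (I : Finset J) (h : ∀ i ∈ I, HasMoments (F i) μ) :
    HasMoments (fun ω => ∑ i ∈ I, F i ω) μ :=
  fun q hq => memLp_finsetSum I fun i hi => h i hi q hq

lemma const [IsFiniteMeasure μ] (c : ℝ) : HasMoments (fun _ : Ω => c) μ :=
  fun _ _ => memLp_const c

lemma pow [IsFiniteMeasure μ] (hf : HasMoments f μ) (n : ℕ) : HasMoments (fun ω => f ω ^ n) μ := by
  induction n with
  | zero => simpa using const 1
  | succ n ih => simpa only [pow_succ] using ih.mul hf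

end HasMoments

/-- `exp(v t²/2)` is the moment generating function of a centred normal law of variance `v`, so
these are its third and fourth moments. -/
lemma iteratedDeriv_exp_quadratic (v : ℝ) :
    iteratedDeriv 3 (fun t : ℝ => Real.exp (v * t ^ 2 / 2)) 0 = 0 ∧
      iteratedDeriv 4 (fun t : ℝ => Real.exp (v * t ^ 2 / 2)) 0 = 3 * v ^ 2 := by
  have h0 : ∀ t : ℝ, HasDerivAt (fun t : ℝ => Real.exp (v * t ^ 2 / 2))
      (v * t * Real.exp (v * t ^ 2 / 2)) t := by
    intro t
    have h1 : HasDerivAt (fun t : ℝ => v * t ^ 2 / 2) (v * (2 * t) / 2) t := by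
      simpa using (((hasDerivAt_id t).pow 2).const_mul v).div_const 2
    convert h1.exp using 1; ring
  have hp : ∀ (a b c d e : ℝ) (t : ℝ), HasDerivAt (fun t : ℝ => (a + b * t + c * t ^ 2 + d * t ^ 3) *
      Real.exp (v * t ^ 2 / 2)) ((b + 2 * c * t + 3 * d * t ^ 2) * Real.exp (v * t ^ 2 / 2) +
        (a + b * t + c * t ^ 2 + d * t ^ 3) * (v * t * Real.exp (v * t ^ 2 / 2))) t := by
    intro a b c d e t
    have h1 : HasDerivAt (fun t : ℝ => a + b * t + c * t ^ 2 + d * t ^ 3)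
        (b + 2 * c * t + 3 * d * t ^ 2) t := by
      have h2 := (((hasDerivAt_id t).const_mul b).const_add a).add
        (((hasDerivAt_id t).pow 2).const_mul c)
      have h3 := h2.add (((hasDerivAt_id t).pow 3).const_mul d)
      refine h3.congr_deriv ?_
      simp only [id, Nat.cast_ofNat]; ring
    exact h1.mul (h0 t)
  have e1 : deriv (fun t : ℝ => Real.exp (v * t ^ 2 / 2)) =
      fun t => (0 + v * t + 0 * t ^ 2 + 0 * t ^ 3) * Real.exp (v * t ^ 2 / 2) := by
    ext t; rw [(h0 t).deriv]; ring
  have e2 : deriv (fun t => (0 + v * t + 0 * t ^ 2 + 0 * t ^ 3) * Real.exp (v * t ^ 2 / 2)) =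
      fun t => (v + 0 * t + v ^ 2 * t ^ 2 + 0 * t ^ 3) * Real.exp (v * t ^ 2 / 2) := by
    ext t; rw [(hp 0 v 0 0 0 t).deriv]; ring
  have e3 : deriv (fun t => (v + 0 * t + v ^ 2 * t ^ 2 + 0 * t ^ 3) * Real.exp (v * t ^ 2 / 2)) =
      fun t => (0 + 3 * v ^ 2 * t + 0 * t ^ 2 + v ^ 3 * t ^ 3) * Real.exp (v * t ^ 2 / 2) := by
    ext t; rw [(hp v 0 (v ^ 2) 0 0 t).deriv]; ring
  have i3 : iteratedDeriv 3 (fun t : ℝ => Real.exp (v * t ^ 2 / 2)) =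
      fun t => (0 + 3 * v ^ 2 * t + 0 * t ^ 2 + v ^ 3 * t ^ 3) * Real.exp (v * t ^ 2 / 2) := by
    rw [iteratedDeriv_succ, iteratedDeriv_succ, iteratedDeriv_one, e1, e2, e3]
  refine ⟨by rw [i3]; simp, ?_⟩
  rw [iteratedDeriv_succ, i3, (hp 0 (3 * v ^ 2) 0 (v ^ 3) 0 0).deriv]
  simp

end Moments

section GaussianSpace

variable {Ω : Type*} [MeasurableSpace Ω] {μ : Measure Ω}

/-- A linear space of centred Gaussian random variables. -/
def IsGaussianSpace (V : Submodule ℝ (Ω → ℝ)) (μ : Measure Ω) : Prop :=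
  ∀ X ∈ V, HasGaussianLaw X μ ∧ ∫ ω, X ω ∂μ = 0

lemma isGaussianSpace_span {S : Type*} {ξ : S → Ω → ℝ} (hξ : IsGaussianProcess ξ μ)
    (h0 : ∀ s, ∫ ω, ξ s ω ∂μ = 0) : IsGaussianSpace (Submodule.span ℝ (Set.range ξ)) μ := by
  intro X hX
  obtain ⟨c, rfl⟩ := (Finsupp.mem_span_range_iff_exists_finsupp).1 hX
  have h1 : c.sum (fun i a => a • ξ i) = fun ω => ∑ s ∈ c.support, c s • ξ s ω := by
    ext ω; simp [Finsupp.sum]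
  rw [h1]
  refine ⟨(hξ.smul fun s => c s).hasGaussianLaw_fun_sum (I := c.support), ?_⟩
  have h2 : ∀ s, Integrable (fun ω => c s • ξ s ω) μ := fun s =>
    (hξ.hasGaussianLaw_eval s).integrable.const_mul (c s)
  rw [integral_finsetSum _ fun s _ => h2 s]
  simp [integral_const_mul, h0]

namespace IsGaussianSpace

variable [IsProbabilityMeasure μ] {V : Submodule ℝ (Ω → ℝ)}

lemma hasMoments (hV : IsGaussianSpace V μ) {X : Ω → ℝ} (hX : X ∈ V) : HasMoments X μ :=
  fun _ hq => (hV X hX).1.memLp hq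

lemma integral_pow (hV : IsGaussianSpace V μ) {X : Ω → ℝ} (hX : X ∈ V) :
    ∫ ω, X ω ^ 3 ∂μ = 0 ∧ ∫ ω, X ω ^ 4 ∂μ = 3 * (∫ ω, X ω ^ 2 ∂μ) ^ 2 := by
  obtain ⟨hG, h0⟩ := hV X hX
  have hmap := hG.map_eq_gaussianReal
  rw [h0, variance_of_integral_eq_zero hG.aemeasurable h0] at hmap
  have hmap2 : ∀ n : ℕ, ∫ ω, X ω ^ n ∂μ = ∫ x, x ^ n ∂(μ.map X) := fun n =>
    (integral_map hG.aemeasurable (measurable_id.pow_const n).aestronglyMeasurable).symm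
  have hmgf := fun n => iteratedDeriv_mgf_zero (μ := gaussianReal 0 (∫ ω, X ω ^ 2 ∂μ).toNNReal)
    (X := fun x => x) (by simp) n
  have h2 := mgf_fun_id_gaussianReal (μ := 0) (v := (∫ ω, X ω ^ 2 ∂μ).toNNReal)
  simp only [zero_mul, zero_add] at h2
  rw [hmap2 3, hmap2 4, hmap]
  have hv : (((∫ ω, X ω ^ 2 ∂μ).toNNReal : NNReal) : ℝ) = ∫ ω, X ω ^ 2 ∂μ :=
    Real.coe_toNNReal _ (integral_nonneg fun _ => sq_nonneg _)
  obtain ⟨h3, h4⟩ := iteratedDeriv_exp_quadratic ((∫ ω, X ω ^ 2 ∂μ).toNNReal : NNReal)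
  rw [← h2] at h3 h4
  rw [hv] at h4
  exact ⟨(hmgf 3).symm.trans h3, (hmgf 4).symm.trans h4⟩

lemma integrable_mul (hV : IsGaussianSpace V μ) {X Y : Ω → ℝ} (hX : X ∈ V) (hY : Y ∈ V) :
    Integrable (fun ω => X ω * Y ω) μ := ((hV.hasMoments hX).mul (hV.hasMoments hY)).integrable

lemma integral_add_sq (hV : IsGaussianSpace V μ) {X Y : Ω → ℝ} (hX : X ∈ V) (hY : Y ∈ V) (c : ℝ) :
    ∫ ω, (X ω + c * Y ω) ^ 2 ∂μ =
      ∫ ω, X ω ^ 2 ∂μ + 2 * c * (∫ ω, X ω * Y ω ∂μ) + c ^ 2 * ∫ ω, Y ω ^ 2 ∂μ := by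
  have e : ∀ ω, (X ω + c * Y ω) ^ 2 = X ω ^ 2 + 2 * c * (X ω * Y ω) + c ^ 2 * Y ω ^ 2 := by
    intro ω; ring
  have mX := hV.hasMoments hX
  have mY := hV.hasMoments hY
  simp_rw [e]
  rw [integral_add ((mX.pow 2).add ((mX.mul mY).const_mul _)).integrable
    ((mY.pow 2).const_mul _).integrable, integral_add (mX.pow 2).integrable
    ((mX.mul mY).const_mul _).integrable, integral_const_mul, integral_const_mul]

/-- Polarization of the scalar fourth moment formula: `(X+Y)⁴ + (X-Y)⁴` isolates `X²Y²`. -/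
lemma integral_sq_mul_sq (hV : IsGaussianSpace V μ) {X Y : Ω → ℝ} (hX : X ∈ V) (hY : Y ∈ V) :
    ∫ ω, X ω ^ 2 * Y ω ^ 2 ∂μ =
      (∫ ω, X ω ^ 2 ∂μ) * (∫ ω, Y ω ^ 2 ∂μ) + 2 * (∫ ω, X ω * Y ω ∂μ) ^ 2 := by
  have mX := hV.hasMoments hX
  have mY := hV.hasMoments hY
  have h1 := (hV.integral_pow (V.add_mem hX hY)).2
  have h2 := (hV.integral_pow (V.sub_mem hX hY)).2
  have h3 := (hV.integral_pow hX).2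
  have h4 := (hV.integral_pow hY).2
  have hs := hV.integral_add_sq hX hY
  have s1 : ∀ ω, (X + Y) ω = X ω + 1 * Y ω := fun ω => by simp
  have s2 : ∀ ω, (X - Y) ω = X ω + (-1) * Y ω := fun ω => by simp [sub_eq_add_neg]
  have h1' : ∫ ω, (X + Y) ω ^ 2 ∂μ = ∫ ω, (X ω + 1 * Y ω) ^ 2 ∂μ := by simp_rw [s1]
  have h2' : ∫ ω, (X - Y) ω ^ 2 ∂μ = ∫ ω, (X ω + (-1) * Y ω) ^ 2 ∂μ := by simp_rw [s2]
  rw [h1', hs] at h1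
  rw [h2', hs] at h2
  have e : ∀ ω, (X + Y) ω ^ 4 + (X - Y) ω ^ 4 =
      2 * X ω ^ 4 + 12 * (X ω ^ 2 * Y ω ^ 2) + 2 * Y ω ^ 4 := by
    intro ω; simp only [Pi.add_apply, Pi.sub_apply]; ring
  have h5 : ∫ ω, (X + Y) ω ^ 4 ∂μ + ∫ ω, (X - Y) ω ^ 4 ∂μ = 2 * ∫ ω, X ω ^ 4 ∂μ +
      12 * (∫ ω, X ω ^ 2 * Y ω ^ 2 ∂μ) + 2 * ∫ ω, Y ω ^ 4 ∂μ := by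
    rw [← integral_add ((hV.hasMoments (V.add_mem hX hY)).pow 4).integrable
      ((hV.hasMoments (V.sub_mem hX hY)).pow 4).integrable]
    simp_rw [e]
    have m2 := ((mX.pow 2).mul (mY.pow 2)).const_mul 12
    rw [integral_add (((mX.pow 4).const_mul 2).add m2).integrable ((mY.pow 4).const_mul 2).integrable,
      integral_add ((mX.pow 4).const_mul 2).integrable m2.integrable, integral_const_mul,
      integral_const_mul, integral_const_mul]
  rw [h1, h2, h3, h4] at h5
  linarith

/-- Isserlis' formula for fourth mixed moments. -/
lemma isserlis (hV : IsGaussianSpace V μ) {A B C D : Ω → ℝ} (hA : A ∈ V) (hB : B ∈ V) (hC : C ∈ V)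
    (hD : D ∈ V) : ∫ ω, A ω * B ω * (C ω * D ω) ∂μ =
      (∫ ω, A ω * B ω ∂μ) * (∫ ω, C ω * D ω ∂μ) + (∫ ω, A ω * C ω ∂μ) * (∫ ω, B ω * D ω ∂μ) +
        (∫ ω, A ω * D ω ∂μ) * (∫ ω, B ω * C ω ∂μ) := by
  have hlin : ∀ {X Y Z : Ω → ℝ}, X ∈ V → Y ∈ V → Z ∈ V → ∀ c : ℝ,
      ∫ ω, (X ω + c * Y ω) * Z ω ∂μ = ∫ ω, X ω * Z ω ∂μ + c * ∫ ω, Y ω * Z ω ∂μ := by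
    intro X Y Z hX hY hZ c
    simp_rw [add_mul, mul_assoc]
    rw [integral_add (hV.integrable_mul hX hZ) ((hV.integrable_mul hY hZ).const_mul c),
      integral_const_mul]
  have hmem : ∀ {X Y : Ω → ℝ}, X ∈ V → Y ∈ V → ∀ c : ℝ, (fun ω => X ω + c * Y ω) ∈ V :=
    fun hX hY c => V.add_mem hX (V.smul_mem c hY)
  have hbil : ∀ c d : ℝ, ∫ ω, (A ω + c * B ω) * (C ω + d * D ω) ∂μ =
      ∫ ω, A ω * C ω ∂μ + d * (∫ ω, A ω * D ω ∂μ) + c * (∫ ω, B ω * C ω ∂μ) +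
        c * d * ∫ ω, B ω * D ω ∂μ := by
    intro c d
    rw [hlin hA hB (hmem hC hD d)]
    simp_rw [mul_comm (A _), mul_comm (B _)]
    rw [hlin hC hD hA, hlin hC hD hB]
    simp_rw [mul_comm (C _), mul_comm (D _)]
    ring
  have hq : ∀ c d : ℝ, ∫ ω, (A ω + c * B ω) ^ 2 * (C ω + d * D ω) ^ 2 ∂μ = _ := fun c d =>
    hV.integral_sq_mul_sq (hmem hA hB c) (hmem hC hD d)
  have hm : ∀ c d : ℝ, Integrable (fun ω => (A ω + c * B ω) ^ 2 * (C ω + d * D ω) ^ 2) μ :=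
    fun c d => (((hV.hasMoments (hmem hA hB c)).pow 2).mul
      ((hV.hasMoments (hmem hC hD d)).pow 2)).integrable
  -- Both products are polarized by `4AB = (A+B)² - (A-B)²`, which reduces to products of two
  -- squares.
  have e : ∀ ω, A ω * B ω * (C ω * D ω) = (1 / 16) *
      (((A ω + 1 * B ω) ^ 2 * (C ω + 1 * D ω) ^ 2 + (A ω + (-1) * B ω) ^ 2 * (C ω + (-1) * D ω) ^ 2) -
      ((A ω + 1 * B ω) ^ 2 * (C ω + (-1) * D ω) ^ 2 +
        (A ω + (-1) * B ω) ^ 2 * (C ω + 1 * D ω) ^ 2)) := by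
    intro ω; ring
  simp_rw [e]
  have i1 : Integrable (fun ω => (A ω + 1 * B ω) ^ 2 * (C ω + 1 * D ω) ^ 2 +
      (A ω + (-1) * B ω) ^ 2 * (C ω + (-1) * D ω) ^ 2) μ := (hm _ _).add (hm _ _)
  have i2 : Integrable (fun ω => (A ω + 1 * B ω) ^ 2 * (C ω + (-1) * D ω) ^ 2 +
      (A ω + (-1) * B ω) ^ 2 * (C ω + 1 * D ω) ^ 2) μ := (hm _ _).add (hm _ _)
  rw [integral_const_mul, integral_sub i1 i2, integral_add (hm _ _) (hm _ _),
    integral_add (hm _ _) (hm _ _), hq, hq, hq, hq]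
  simp only [hbil, hV.integral_add_sq hA hB, hV.integral_add_sq hC hD]
  ring

lemma isGaussianProcess (hV : IsGaussianSpace V μ) {J : Type*} {η : J → Ω → ℝ}
    (hη : ∀ j, η j ∈ V) : IsGaussianProcess η μ := by
  classical
  refine ⟨fun I => ⟨isGaussian_of_isGaussian_map fun L => ?_⟩⟩
  have hm : AEMeasurable (fun ω => I.restrict (η · ω)) μ :=
    aemeasurable_pi_lambda _ fun i => (hV _ (hη i)).1.aemeasurable
  rw [AEMeasurable.map_map_of_aemeasurable (by fun_prop) hm]
  have h1 : (L ∘ fun ω => I.restrict (η · ω)) = ∑ i : I, L (Pi.single i 1) • η i := by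
    ext ω
    have h3 := (L : (I → ℝ) →ₗ[ℝ] ℝ).pi_apply_eq_sum_univ (I.restrict (η · ω))
    rw [Function.comp_apply]
    refine Eq.trans h3 ?_
    rw [Finset.sum_apply]
    refine Finset.sum_congr rfl fun i _ => ?_
    rw [Pi.smul_apply, smul_eq_mul, smul_eq_mul, mul_comm]
    have h4 : (Pi.single i 1 : I → ℝ) = fun j => if i = j then 1 else 0 := by
      ext j; simp [Pi.single_apply, eq_comm]
    rw [h4]
    rfl
  rw [h1]
  have h2 : ∑ i : I, L (Pi.single i 1) • η i ∈ V := V.sum_mem fun i _ => V.smul_mem _ (hη i)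
  exact (hV _ h2).1.isGaussian_map

lemma covariance_eq (hV : IsGaussianSpace V μ) {X Y : Ω → ℝ} (hX : X ∈ V) (hY : Y ∈ V) :
    cov[X, Y; μ] = ∫ ω, X ω * Y ω ∂μ := by
  rw [covariance, (hV X hX).2, (hV Y hY).2]
  simp

lemma indepFun (hV : IsGaussianSpace V μ) {J : Type*} {η : J → Ω → ℝ} (hη : ∀ j, η j ∈ V)
    {X : Ω → ℝ} (hX : X ∈ V) (h : ∀ j, ∫ ω, η j ω * X ω ∂μ = 0) :
    IndepFun (fun ω j => η j ω) X μ := by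
  have h1 := IsGaussianProcess.indepFun_of_covariance_eq_zero (P := μ) (X := η) (Y := fun _ : Unit => X)
    (hV.isGaussianProcess fun j => by rcases j with j | j; exacts [hη j, hX])
    (fun j => (hV _ (hη j)).1.aemeasurable) (fun _ => (hV _ hX).1.aemeasurable)
    (fun j _ => by rw [hV.covariance_eq (hη j) hX, h])
  exact h1.comp measurable_id (measurable_pi_apply ())

end IsGaussianSpace

end GaussianSpace

end SPHAR


/-! ### Systems of Gaussian autoregressions: covariances and scores. -/

namespace SPHAR

set_option linter.unusedSectionVars false

section AutoregressiveSystem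

variable {Ω : Type*} [MeasurableSpace Ω] {μ : Measure Ω} {p : ℕ}

/-- The linear combination `∑_j θ_j a_{t-j-1}` of the `p` previous values. -/
def lagSum (θ : Fin p → ℝ) (a : ℤ → Ω → ℝ) (t : ℤ) (ω : Ω) : ℝ :=
  ∑ j, θ j * a (t - ((j : ℤ) + 1)) ω

/-- The innovation `a_t - ∑_j φ_j a_{t-j-1}`. -/
def innovation (φ : Fin p → ℝ) (a : ℤ → Ω → ℝ) (t : ℤ) (ω : Ω) : ℝ := a t ω - lagSum φ a t ω

/-- A family of centred, jointly Gaussian autoregressions driven by orthonormal innovations. -/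
structure IsARSystem {κ : Type*} [DecidableEq κ] (φ : κ → Fin p → ℝ) (a : κ → ℤ → Ω → ℝ)
    (μ : Measure Ω) : Prop where
  gaussian : IsGaussianProcess (fun q : κ × ℤ => a q.1 q.2) μ
  mean_zero : ∀ i t, ∫ ω, a i t ω ∂μ = 0
  bound : ∀ i, ∃ B, ∀ t, ∫ ω, a i t ω ^ 2 ∂μ ≤ B
  innov : ∀ i j t s, ∫ ω, innovation (φ i) (a i) t ω * innovation (φ j) (a j) s ω ∂μ =
    if i = j ∧ t = s then 1 else 0

/-- The score `∑_{k<n} x_{t+k} e_{t+k}` with regressor `x = ∑_j θ_j a_{·-j-1}`. -/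
def score (φ θ : Fin p → ℝ) (a : ℤ → Ω → ℝ) (t : ℤ) (n : ℕ) (ω : Ω) : ℝ :=
  ∑ k ∈ Finset.range n, lagSum θ a (t + k) ω * innovation φ a (t + k) ω

namespace IsARSystem

variable {κ : Type*} [DecidableEq κ] {φ : κ → Fin p → ℝ} {a : κ → ℤ → Ω → ℝ}

/-- The span of all coefficients. -/
def space (a : κ → ℤ → Ω → ℝ) : Submodule ℝ (Ω → ℝ) :=
  Submodule.span ℝ (Set.range fun q : κ × ℤ => a q.1 q.2)

lemma isGaussianSpace (h : IsARSystem φ a μ) : IsGaussianSpace (space a) μ :=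
  isGaussianSpace_span h.gaussian fun q => h.mean_zero q.1 q.2

lemma mem_space (a : κ → ℤ → Ω → ℝ) (i : κ) (t : ℤ) : a i t ∈ space a :=
  Submodule.subset_span ⟨(i, t), rfl⟩

lemma lagSum_mem (a : κ → ℤ → Ω → ℝ) (θ : Fin p → ℝ) (i : κ) (t : ℤ) :
    lagSum θ (a i) t ∈ space a := by
  have h1 : lagSum θ (a i) t = ∑ j, θ j • a i (t - ((j : ℤ) + 1)) := by
    ext ω; simp [lagSum]
  rw [h1]
  exact Submodule.sum_mem _ fun j _ => Submodule.smul_mem _ _ (mem_space a _ _)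

lemma innovation_mem (a : κ → ℤ → Ω → ℝ) (θ : Fin p → ℝ) (i : κ) (t : ℤ) :
    innovation θ (a i) t ∈ space a :=
  Submodule.sub_mem _ (mem_space a i t) (lagSum_mem a θ i t)

variable [IsProbabilityMeasure μ]

lemma integral_mul_lagSum (h : IsARSystem φ a μ) {X : Ω → ℝ} (hX : X ∈ space a) (θ : Fin p → ℝ)
    (i : κ) (t : ℤ) : ∫ ω, X ω * lagSum θ (a i) t ω ∂μ =
      ∑ j, θ j * ∫ ω, X ω * a i (t - ((j : ℤ) + 1)) ω ∂μ := by
  have h1 : ∀ j : Fin p, Integrable (fun ω => θ j * (X ω * a i (t - ((j : ℤ) + 1)) ω)) μ :=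
    fun j => (h.isGaussianSpace.integrable_mul hX (mem_space a _ _)).const_mul _
  have h2 : ∀ ω, X ω * lagSum θ (a i) t ω = ∑ j, θ j * (X ω * a i (t - ((j : ℤ) + 1)) ω) := by
    intro ω
    rw [lagSum, Finset.mul_sum]
    exact Finset.sum_congr rfl fun j _ => by ring
  simp_rw [h2]
  rw [integral_finsetSum _ fun j _ => h1 j]
  simp_rw [integral_const_mul]

variable {ψ : κ → ℤ → ℝ}

/-- For fixed `X` the sequence `s ↦ E[X a_s]` is bounded, uniformly bounded second moments being
assumed, so the filter can be inverted on it. All covariances follow, without representing `a_t`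
itself as a moving average. -/
lemma hasSum_integral_mul (h : IsARSystem φ a μ) (hψ : ∀ i, IsCausalInverse (φ i) (ψ i))
    {X : Ω → ℝ} (hX : X ∈ space a) (i : κ) (t : ℤ) :
    HasSum (fun n => ψ i n * ∫ ω, X ω * innovation (φ i) (a i) (t - n) ω ∂μ)
      (∫ ω, X ω * a i t ω ∂μ) := by
  obtain ⟨B, hB⟩ := h.bound i
  have hV := h.isGaussianSpace
  have hb : ∀ s, |∫ ω, X ω * a i s ω ∂μ| ≤ √(∫ ω, X ω ^ 2 ∂μ) * √B := fun s =>
    (abs_integral_mul_le (hV.hasMoments hX).memLp_two (hV.hasMoments (mem_space a i s)).memLp_two).trans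
      (mul_le_mul_of_nonneg_left (Real.sqrt_le_sqrt (hB s)) (Real.sqrt_nonneg _))
  have h1 := (hψ i).hasSum_filter hb t
  have h2 : ∀ s, ∫ ω, X ω * innovation (φ i) (a i) s ω ∂μ =
      ∫ ω, X ω * a i s ω ∂μ - ∑ j, φ i j * ∫ ω, X ω * a i (s - ((j : ℤ) + 1)) ω ∂μ := by
    intro s
    rw [← h.integral_mul_lagSum hX]
    simp_rw [innovation, mul_sub]
    exact integral_sub (hV.integrable_mul hX (mem_space a i s))
      (hV.integrable_mul hX (lagSum_mem a _ i s))
  simp_rw [h2]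
  exact h1

lemma integral_innovation_mul (h : IsARSystem φ a μ) (hψ : ∀ i, IsCausalInverse (φ i) (ψ i))
    (i j : κ) (t s : ℤ) : ∫ ω, innovation (φ i) (a i) t ω * a j s ω ∂μ =
      if i = j then ψ j (s - t) else 0 := by
  have h1 := h.hasSum_integral_mul hψ (innovation_mem a (φ i) i t) j s
  simp_rw [h.innov] at h1
  refine h1.unique ?_
  by_cases hij : i = j
  · have h2 : ∀ n, (ψ j n * if i = j ∧ t = s - n then (1 : ℝ) else 0) =
        if n = s - t then ψ j (s - t) else 0 := by
      intro n
      by_cases hn : n = s - t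
      · subst hn; simp [hij]
      · have : ¬ t = s - n := fun h => hn (by omega)
        simp [hn, this]
    simp_rw [h2, if_pos hij]
    exact hasSum_ite_eq _ _
  · simp [hij, hasSum_zero]

lemma integral_mul (h : IsARSystem φ a μ) (hψ : ∀ i, IsCausalInverse (φ i) (ψ i))
    (i j : κ) (t s : ℤ) : ∫ ω, a i t ω * a j s ω ∂μ =
      if i = j then autocov (ψ i) (t - s) else 0 := by
  have h1 := h.hasSum_integral_mul hψ (mem_space a i t) j s
  simp_rw [mul_comm (a i t _)] at h1 ⊢
  simp_rw [h.integral_innovation_mul hψ] at h1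
  refine h1.unique ?_
  by_cases hij : i = j
  · subst hij
    simp only [if_true]
    have h2 := (hψ i).hasSum_autocov (s - t)
    rw [← IsCausalInverse.autocov_neg, neg_sub] at h2
    refine h2.congr_fun fun n => ?_
    congr 2; ring
  · simp [hij, Ne.symm hij, hasSum_zero]

lemma integral_innovation_mul_lagSum (h : IsARSystem φ a μ)
    (hψ : ∀ i, IsCausalInverse (φ i) (ψ i)) (θ : Fin p → ℝ) (i j : κ) (t s : ℤ) :
    ∫ ω, innovation (φ i) (a i) t ω * lagSum θ (a j) s ω ∂μ =
      if i = j then ∑ k, θ k * ψ j (s - ((k : ℤ) + 1) - t) else 0 := by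
  rw [h.integral_mul_lagSum (innovation_mem a (φ i) i t)]
  simp_rw [h.integral_innovation_mul hψ]
  by_cases hij : i = j <;> simp [hij]

lemma integral_innovation_mul_lagSum_of_le (h : IsARSystem φ a μ)
    (hψ : ∀ i, IsCausalInverse (φ i) (ψ i)) (θ : Fin p → ℝ) (i j : κ) {t s : ℤ} (hst : s ≤ t) :
    ∫ ω, innovation (φ i) (a i) t ω * lagSum θ (a j) s ω ∂μ = 0 := by
  rw [h.integral_innovation_mul_lagSum hψ]
  split_ifs
  · exact Finset.sum_eq_zero fun k _ => by rw [(hψ j).causal _ (by omega), mul_zero]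
  · rfl

lemma integral_lagSum_sq (h : IsARSystem φ a μ) (hψ : ∀ i, IsCausalInverse (φ i) (ψ i))
    (θ : Fin p → ℝ) (i : κ) (t : ℤ) : ∫ ω, lagSum θ (a i) t ω ^ 2 ∂μ =
      ∑ j, ∑ k, θ j * (autocovMatrix p (ψ i) j k * θ k) := by
  simp_rw [sq]
  rw [h.integral_mul_lagSum (lagSum_mem a θ i t)]
  refine Finset.sum_congr rfl fun j _ => ?_
  simp_rw [mul_comm (lagSum θ (a i) t _)]
  rw [h.integral_mul_lagSum (mem_space a _ _), Finset.mul_sum]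
  refine Finset.sum_congr rfl fun k _ => ?_
  rw [h.integral_mul hψ, if_pos rfl, autocovMatrix, Matrix.of_apply, ← IsCausalInverse.autocov_neg]
  rw [show -(t - ((j : ℤ) + 1) - (t - ((k : ℤ) + 1))) = (j : ℤ) - k by ring]
  ring

lemma integral_mul_self_innovation (h : IsARSystem φ a μ) (i : κ) (t : ℤ) :
    ∫ ω, innovation (φ i) (a i) t ω ^ 2 ∂μ = 1 := by
  simp_rw [sq]
  simpa using h.innov i i t t

lemma hasMoments_score (h : IsARSystem φ a μ) (θ : Fin p → ℝ) (i : κ) (t : ℤ) (n : ℕ) :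
    HasMoments (score (φ i) θ (a i) t n) μ :=
  HasMoments.sum _ fun _ _ => (h.isGaussianSpace.hasMoments (lagSum_mem a θ i _)).mul
    (h.isGaussianSpace.hasMoments (innovation_mem a (φ i) i _))

lemma integral_score (h : IsARSystem φ a μ) (hψ : ∀ i, IsCausalInverse (φ i) (ψ i))
    (θ : Fin p → ℝ) (i : κ) (t : ℤ) (n : ℕ) : ∫ ω, score (φ i) θ (a i) t n ω ∂μ = 0 := by
  simp_rw [score]
  rw [integral_finsetSum _ fun _ _ => h.isGaussianSpace.integrable_mul (lagSum_mem a θ i _)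
    (innovation_mem a (φ i) i _)]
  refine Finset.sum_eq_zero fun k _ => ?_
  simp_rw [mul_comm (lagSum _ _ _ _)]
  exact h.integral_innovation_mul_lagSum_of_le hψ θ i i le_rfl

/-- Second moments of scores, for possibly different regressors and series. -/
lemma integral_score_mul_score (h : IsARSystem φ a μ) (hψ : ∀ i, IsCausalInverse (φ i) (ψ i))
    (θ : Fin p → ℝ) (i j : κ) (t : ℤ) (n : ℕ) :
    ∫ ω, score (φ i) θ (a i) t n ω * score (φ j) θ (a j) t n ω ∂μ =
      if i = j then n * ∑ j, ∑ k, θ j * (autocovMatrix p (ψ i) j k * θ k) else 0 := by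
  have hV := h.isGaussianSpace
  have hl := fun i t => lagSum_mem a θ i t
  have he := fun i t => innovation_mem a (φ i) i t
  have h1 : ∀ k m : ℕ, ∫ ω, lagSum θ (a i) (t + k) ω * innovation (φ i) (a i) (t + k) ω *
      (lagSum θ (a j) (t + m) ω * innovation (φ j) (a j) (t + m) ω) ∂μ =
      if i = j ∧ k = m then ∑ j, ∑ k, θ j * (autocovMatrix p (ψ i) j k * θ k) else 0 := by
    intro k m
    rw [hV.isserlis (hl _ _) (he _ _) (hl _ _) (he _ _), h.innov]
    have z1 : ∫ ω, lagSum θ (a i) (t + k) ω * innovation (φ i) (a i) (t + k) ω ∂μ = 0 := by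
      simp_rw [mul_comm (lagSum _ _ _ _)]
      exact h.integral_innovation_mul_lagSum_of_le hψ θ i i le_rfl
    -- Whichever of the two times is later, its innovation is orthogonal to the other regressor,
    -- which uses strictly earlier values only.
    have z2 : (∫ ω, lagSum θ (a i) (t + k) ω * innovation (φ j) (a j) (t + m) ω ∂μ) *
        ∫ ω, innovation (φ i) (a i) (t + k) ω * lagSum θ (a j) (t + m) ω ∂μ = 0 := by
      simp_rw [mul_comm (lagSum θ (a i) (t + k) _)]
      rcases le_total k m with hkm | hkm
      · rw [h.integral_innovation_mul_lagSum_of_le hψ θ j i (by omega), zero_mul]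
      · rw [h.integral_innovation_mul_lagSum_of_le hψ θ i j (by omega), mul_zero]
    rw [z1, z2, zero_mul, zero_add, add_zero]
    by_cases hc : i = j ∧ k = m
    · obtain ⟨rfl, rfl⟩ := hc
      have := h.integral_lagSum_sq hψ θ i (t + k)
      simp_rw [sq] at this
      simp [this]
    · have : ¬ (i = j ∧ t + (k : ℤ) = t + m) := fun hh => hc ⟨hh.1, by omega⟩
      rw [if_neg hc, if_neg this, mul_zero]
  simp_rw [score, Finset.sum_mul_sum]
  have hi : ∀ k m : ℕ, Integrable (fun ω => lagSum θ (a i) (t + k) ω *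
      innovation (φ i) (a i) (t + k) ω * (lagSum θ (a j) (t + m) ω *
        innovation (φ j) (a j) (t + m) ω)) μ := fun k m =>
    (((hV.hasMoments (hl _ _)).mul (hV.hasMoments (he _ _))).mul
      ((hV.hasMoments (hl _ _)).mul (hV.hasMoments (he _ _)))).integrable
  rw [integral_finsetSum _ fun k _ => integrable_finsetSum _ fun m _ => hi k m]
  simp_rw [integral_finsetSum _ fun m _ => hi _ m, h1]
  by_cases hij : i = j
  · simp only [hij, true_and, if_true, Finset.sum_ite_eq]
    rw [Finset.sum_congr rfl fun k hk => if_pos hk]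
    simp
  · simp [hij]

/-- The scores of distinct series are independent. -/
lemma iIndepFun_score (h : IsARSystem φ a μ) (hψ : ∀ i, IsCausalInverse (φ i) (ψ i))
    (θ : κ → Fin p → ℝ) (t : ℤ) (n : ℕ) :
    iIndepFun (fun i ω => score (φ i) (θ i) (a i) t n ω) μ := by
  have hV := h.isGaussianSpace
  have h1 := IsGaussianProcess.iIndepFun_of_covariance_eq_zero (P := μ) (X := a)
    (hV.isGaussianProcess fun q : (_ : κ) × ℤ => mem_space a q.1 q.2)
    (fun i s => (hV.hasMoments (mem_space a i s)).memLp_two.aestronglyMeasurable.aemeasurable)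
    (fun i j hij s s' => by
      rw [hV.covariance_eq (mem_space a i s) (mem_space a j s'), h.integral_mul hψ, if_neg hij])
  refine h1.comp (fun i (b : ℤ → ℝ) => ∑ k ∈ Finset.range n,
    (∑ j, θ i j * b (t + k - ((j : ℤ) + 1))) *
      (b (t + k) - ∑ j, φ i j * b (t + k - ((j : ℤ) + 1)))) fun i => ?_
  fun_prop

/-- The innovation at time `t + n` is independent of the score and regressor before it. -/
lemma indepFun_score_lagSum (h : IsARSystem φ a μ) (hψ : ∀ i, IsCausalInverse (φ i) (ψ i))
    (θ : Fin p → ℝ) (i : κ) (t : ℤ) (n : ℕ) :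
    IndepFun (fun ω => (score (φ i) θ (a i) t n ω, lagSum θ (a i) (t + n) ω))
      (innovation (φ i) (a i) (t + n)) μ := by
  have hV := h.isGaussianSpace
  -- The strict past of `t + n`, kept indexed by all of `ℤ` by replacing later values with zero. The
  -- score and the regressor are measurable functions of it.
  set η : ℤ → Ω → ℝ := fun s => if s < t + n then a i s else 0 with hη
  have h1 : IndepFun (fun ω s => η s ω) (innovation (φ i) (a i) (t + n)) μ := by
    refine hV.indepFun (fun s => ?_) (innovation_mem a (φ i) i _) fun s => ?_
    · by_cases hs : s < t + n
      · simp only [hη, hs, if_true]; exact mem_space a i s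
      · simp only [hη, hs, if_false]; exact Submodule.zero_mem _
    · by_cases hs : s < t + n
      · simp only [hη, hs, if_true]
        simp_rw [mul_comm (a i s _)]
        rw [h.integral_innovation_mul hψ, if_pos rfl, (hψ i).causal _ (by omega)]
      · simp [hη, hs]
  have h2 := h1.comp (φ := fun b : ℤ → ℝ => (∑ k ∈ Finset.range n,
    (∑ j, θ j * b (t + k - ((j : ℤ) + 1))) *
      (b (t + k) - ∑ j, φ i j * b (t + k - ((j : ℤ) + 1))),
        ∑ j, θ j * b (t + n - ((j : ℤ) + 1)))) (by fun_prop) measurable_id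
  refine h2.congr (Eventually.of_forall fun ω => ?_) (Eventually.of_forall fun ω => rfl)
  refine Prod.ext ?_ ?_
  · simp only [score, lagSum, innovation, Function.comp_apply]
    refine Finset.sum_congr rfl fun k hk => ?_
    have hk : (k : ℤ) < n := by exact_mod_cast Finset.mem_range.1 hk
    have e1 : ∀ j : Fin p, η (t + k - ((j : ℤ) + 1)) = a i (t + k - ((j : ℤ) + 1)) := fun j =>
      if_pos (by omega)
    have e2 : η (t + k) = a i (t + k) := if_pos (by omega)
    simp_rw [e1, e2]
  · simp only [lagSum, Function.comp_apply]
    refine Finset.sum_congr rfl fun j _ => ?_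
    rw [show η (t + n - ((j : ℤ) + 1)) = a i (t + n - ((j : ℤ) + 1)) from if_pos (by omega)]

/-- Fourth moments of scores. -/
lemma integral_score_pow_four_le (h : IsARSystem φ a μ) (hψ : ∀ i, IsCausalInverse (φ i) (ψ i))
    (θ : Fin p → ℝ) (i : κ) (t : ℤ) (n : ℕ) : ∫ ω, score (φ i) θ (a i) t n ω ^ 4 ∂μ ≤
      27 * (n * ∑ j, ∑ k, θ j * (autocovMatrix p (ψ i) j k * θ k)) ^ 2 := by
  have hV := h.isGaussianSpace
  induction n with
  | zero => simp [score]
  | succ n ih =>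
    set v := ∑ j, ∑ k, θ j * (autocovMatrix p (ψ i) j k * θ k) with hv
    have hx2 := h.integral_lagSum_sq hψ θ i (t + n)
    rw [← hv] at hx2
    have hv0 : 0 ≤ v := hx2 ▸ integral_nonneg fun _ => sq_nonneg _
    have mW := h.hasMoments_score θ i t n
    have mx := hV.hasMoments (lagSum_mem a θ i (t + n))
    have me := hV.hasMoments (innovation_mem a (φ i) i (t + n))
    have hind := h.indepFun_score_lagSum hψ θ i t n
    have hx4 := (hV.integral_pow (lagSum_mem a θ i (t + n))).2
    have he3 := (hV.integral_pow (innovation_mem a (φ i) i (t + n))).1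
    have he4 := (hV.integral_pow (innovation_mem a (φ i) i (t + n))).2
    have he2 := h.integral_mul_self_innovation i (t + n)
    have he1 := (hV _ (innovation_mem a (φ i) i (t + n))).2
    have hsucc : ∀ ω, score (φ i) θ (a i) t (n + 1) ω = score (φ i) θ (a i) t n ω +
        lagSum θ (a i) (t + n) ω * innovation (φ i) (a i) (t + n) ω := fun ω => by
      rw [score, Finset.sum_range_succ]; rfl
    generalize score (φ i) θ (a i) t n = W at *
    generalize lagSum θ (a i) (t + n) = x at *
    generalize innovation (φ i) (a i) (t + n) = e at *
    have hprod : ∀ r s m : ℕ, ∫ ω, W ω ^ r * x ω ^ s * e ω ^ m ∂μ =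
        (∫ ω, W ω ^ r * x ω ^ s ∂μ) * ∫ ω, e ω ^ m ∂μ := by
      intro r s m
      have h3 := hind.comp (φ := fun q : ℝ × ℝ => q.1 ^ r * q.2 ^ s) (ψ := fun y : ℝ => y ^ m)
        (by fun_prop) (by fun_prop)
      exact h3.integral_fun_mul_eq_mul_integral ((mW.pow r).mul (mx.pow s)).memLp_two.1
        (me.pow m).memLp_two.1
    have hmom : ∀ r s m : ℕ, HasMoments (fun ω => W ω ^ r * x ω ^ s * e ω ^ m) μ := fun r s m =>
      ((mW.pow r).mul (mx.pow s)).mul (me.pow m)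
    have hexp : ∀ ω, score (φ i) θ (a i) t (n + 1) ω ^ 4 = W ω ^ 4 * x ω ^ 0 * e ω ^ 0 +
        4 * (W ω ^ 3 * x ω ^ 1 * e ω ^ 1) + 6 * (W ω ^ 2 * x ω ^ 2 * e ω ^ 2) +
        4 * (W ω ^ 1 * x ω ^ 3 * e ω ^ 3) + W ω ^ 0 * x ω ^ 4 * e ω ^ 4 := by
      intro ω; rw [hsucc]; ring
    have m1 := (hmom 4 0 0).add ((hmom 3 1 1).const_mul 4)
    have m2 := m1.add ((hmom 2 2 2).const_mul 6)
    have m3 := m2.add ((hmom 1 3 3).const_mul 4)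
    simp_rw [hexp]
    rw [integral_add m3.integrable (hmom 0 4 4).integrable,
      integral_add m2.integrable ((hmom 1 3 3).const_mul 4).integrable,
      integral_add m1.integrable ((hmom 2 2 2).const_mul 6).integrable,
      integral_add (hmom 4 0 0).integrable ((hmom 3 1 1).const_mul 4).integrable]
    simp_rw [integral_const_mul, hprod]
    simp only [pow_one, pow_zero, mul_one, one_mul]
    rw [he1, he2, he3, he4, he2, hx4, hx2]
    have hcs := abs_integral_mul_le (mW.pow 2).memLp_two (mx.pow 2).memLp_two
    simp_rw [← pow_mul] at hcs
    norm_num at hcs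
    rw [hx4, hx2] at hcs
    -- The constant `27` closes the induction: Cauchy–Schwarz gives `√(27 · 3) = 9`, the terms odd
    -- in `e` vanish, `E x⁴ E e⁴ = 9v²`, and `27n² + 6·9n + 9 ≤ 27(n+1)²`.
    have hb : √(∫ ω, W ω ^ 4 ∂μ) * √(3 * v ^ 2) ≤ 9 * n * v ^ 2 := by
      rw [← Real.sqrt_mul (integral_nonneg fun _ => by positivity)]
      refine Real.sqrt_le_iff.2 ⟨by positivity, ?_⟩
      have h3 := mul_le_mul_of_nonneg_right ih (by positivity : 0 ≤ 3 * v ^ 2)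
      calc _ ≤ _ := h3
        _ = _ := by ring
    have h5 := (le_abs_self _).trans (hcs.trans hb)
    simp only [integral_const, probReal_univ, smul_eq_mul, mul_one]
    push_cast
    nlinarith [sq_nonneg v]

end IsARSystem

end AutoregressiveSystem

end SPHAR


/-! ### A Lyapunov bound for characteristic functions. -/

namespace SPHAR

section Lyapunov

lemma norm_prod_sub_prod_le {J : Type*} (I : Finset J) (f g : J → ℂ) (hf : ∀ i ∈ I, ‖f i‖ ≤ 1)
    (hg : ∀ i ∈ I, ‖g i‖ ≤ 1) : ‖∏ i ∈ I, f i - ∏ i ∈ I, g i‖ ≤ ∑ i ∈ I, ‖f i - g i‖ := by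
  classical
  induction I using Finset.induction_on with
  | empty => simp
  | insert i I hi ih =>
    rw [Finset.prod_insert hi, Finset.prod_insert hi, Finset.sum_insert hi]
    have h1 := ih (fun j hj => hf j (Finset.mem_insert_of_mem hj))
      (fun j hj => hg j (Finset.mem_insert_of_mem hj))
    have h2 : ‖∏ j ∈ I, g j‖ ≤ 1 := by
      rw [norm_prod]
      exact Finset.prod_le_one (fun _ _ => norm_nonneg _)
        fun j hj => hg j (Finset.mem_insert_of_mem hj)
    have h3 : f i * ∏ j ∈ I, f j - g i * ∏ j ∈ I, g j =
        f i * (∏ j ∈ I, f j - ∏ j ∈ I, g j) + (f i - g i) * ∏ j ∈ I, g j := by ring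
    rw [h3]
    refine (norm_add_le _ _).trans ?_
    rw [norm_mul, norm_mul, add_comm]
    refine add_le_add (mul_le_of_le_one_right (norm_nonneg _) h2) ?_
    exact (mul_le_of_le_one_left (norm_nonneg _) (hf i (Finset.mem_insert_self i I))).trans h1

/-- Second order expansion of `e^{ix}` with a cubic remainder. -/
lemma norm_cexp_mul_I_sub_le (x : ℝ) :
    ‖Complex.exp (x * Complex.I) - (1 + x * Complex.I - x ^ 2 / 2)‖ ≤ 4 * |x| ^ 3 := by
  rcases le_or_gt |x| 1 with hx | hx
  · have h1 : ‖(x : ℂ) * Complex.I‖ ≤ 1 := by simpa using hx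
    have h2 := Complex.exp_bound h1 (n := 3) (by norm_num)
    have h3 : ∑ m ∈ Finset.range 3, ((x : ℂ) * Complex.I) ^ m / m.factorial =
        1 + x * Complex.I - x ^ 2 / 2 := by
      simp only [Finset.sum_range_succ, Finset.sum_range_zero, mul_pow, Complex.I_sq]
      norm_num [Nat.factorial]
      ring
    rw [h3] at h2
    refine h2.trans ?_
    rw [norm_mul, Complex.norm_I, mul_one, Complex.norm_real, Real.norm_eq_abs, mul_comm]
    refine mul_le_mul_of_nonneg_right ?_ (by positivity)
    norm_num [Nat.factorial]
  · have h1 : ‖Complex.exp (x * Complex.I) - (1 + x * Complex.I - x ^ 2 / 2)‖ ≤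
        1 + (1 + |x| + |x| ^ 2 / 2) := by
      refine (norm_sub_le _ _).trans (add_le_add (Complex.norm_exp_ofReal_mul_I x).le ?_)
      refine (norm_sub_le _ _).trans (add_le_add ((norm_add_le _ _).trans ?_) ?_)
      · simp
      · simp
    have h2 : 1 ≤ |x| ^ 3 := one_le_pow₀ hx.le
    have h3 : |x| ≤ |x| ^ 3 := le_self_pow₀ hx.le (by norm_num)
    have h4 : |x| ^ 2 ≤ |x| ^ 3 := pow_le_pow_right₀ hx.le (by norm_num)
    linarith

variable {Ω : Type*} [MeasurableSpace Ω] {μ : Measure Ω} [IsProbabilityMeasure μ]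

/-- The cubic remainder is split by `4|x|³ ≤ 2ε x² + (2/ε) x⁴`. With `E X⁴ ≤ 27 s²` and `s ≤ ε²`
this contributes `2εs + 54εs`, and comparing `1 - s/2` with `e^{-s/2}` costs at most `εs` more. -/
lemma norm_integral_cexp_sub_le {X : Ω → ℝ} (hX : HasMoments X μ) (h0 : ∫ ω, X ω ∂μ = 0) {s ε : ℝ}
    (hs : ∫ ω, X ω ^ 2 ∂μ = s) (h4 : ∫ ω, X ω ^ 4 ∂μ ≤ 27 * s ^ 2) (hε : 0 < ε) (hε1 : ε ≤ 1)
    (hsε : s ≤ ε ^ 2) :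
    ‖∫ ω, Complex.exp (X ω * Complex.I) ∂μ - Complex.exp (-(s / 2 : ℝ))‖ ≤ 60 * ε * s := by
  have hs0 : 0 ≤ s := hs ▸ integral_nonneg fun _ => sq_nonneg _
  have hm : AEMeasurable X μ := (hX.memLp_two.1).aemeasurable
  have hi : Integrable (fun ω => Complex.exp (X ω * Complex.I)) μ := by
    refine Integrable.of_bound (C := 1) ?_ (Eventually.of_forall fun ω => ?_)
    · exact (by fun_prop : AEMeasurable (fun ω => Complex.exp (X ω * Complex.I)) μ).aestronglyMeasurable
    · rw [Complex.norm_exp_ofReal_mul_I]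
  have i1 : Integrable (fun ω => ((X ω : ℝ) : ℂ) * Complex.I) μ := hX.integrable.ofReal.mul_const _
  have i2 : Integrable (fun ω => ((X ω : ℝ) : ℂ) ^ 2 / 2) μ := by
    have := ((hX.pow 2).integrable.ofReal (𝕜 := ℂ)).div_const 2
    simpa using this
  have i3 : Integrable (fun ω => (1 : ℂ) + X ω * Complex.I) μ := (integrable_const _).add i1
  have e1 : (∫ ω, ((1 : ℂ) + X ω * Complex.I - (X ω : ℂ) ^ 2 / 2) ∂μ : ℂ) = (1 - s / 2 : ℂ) := by
    rw [integral_sub i3 i2, integral_add (integrable_const _) i1, integral_mul_const,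
      integral_div, integral_complex_ofReal, h0]
    have : ∫ ω, ((X ω : ℝ) : ℂ) ^ 2 ∂μ = s := by
      rw [← hs, ← integral_complex_ofReal]; simp
    rw [this]; simp
  have hb : ‖∫ ω, Complex.exp (X ω * Complex.I) ∂μ - (1 - s / 2)‖ ≤ 56 * ε * s := by
    have i4 : Integrable (fun ω => (1 : ℂ) + X ω * Complex.I - (X ω : ℂ) ^ 2 / 2) μ := i3.sub i2
    rw [← e1, ← integral_sub hi i4]
    have hint : Integrable (fun ω => 2 * ε * X ω ^ 2 + 2 / ε * X ω ^ 4) μ :=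
      (((hX.pow 2).const_mul _).add ((hX.pow 4).const_mul _)).integrable
    refine (norm_integral_le_of_norm_le hint (Eventually.of_forall fun ω => ?_)).trans ?_
    · refine (norm_cexp_mul_I_sub_le (X ω)).trans ?_
      have h1 : |X ω| ^ 3 = |X ω| * |X ω| ^ 2 := by ring
      have h2 : X ω ^ 4 = (|X ω| ^ 2) ^ 2 := by rw [sq_abs]; ring
      rw [h1, h2, ← sq_abs (X ω)]
      have h3 := sq_nonneg (ε * |X ω| - |X ω| ^ 2)
      have h5 : 2 * ε * |X ω| ^ 2 + 2 / ε * (|X ω| ^ 2) ^ 2 - 4 * (|X ω| * |X ω| ^ 2) =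
          2 / ε * (ε * |X ω| - |X ω| ^ 2) ^ 2 := by
        field_simp; ring
      have h6 : 0 ≤ 2 / ε * (ε * |X ω| - |X ω| ^ 2) ^ 2 := by positivity
      linarith
    · rw [integral_add ((hX.pow 2).const_mul _).integrable ((hX.pow 4).const_mul _).integrable,
        integral_const_mul, integral_const_mul, hs]
      have h5 : 2 / ε * ∫ ω, X ω ^ 4 ∂μ ≤ 2 / ε * (27 * (ε ^ 2 * s)) := by
        refine mul_le_mul_of_nonneg_left (h4.trans ?_) (by positivity)
        nlinarith
      have h6 : 2 / ε * (27 * (ε ^ 2 * s)) = 54 * ε * s := by field_simp; ring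
      linarith
  have hexp : ‖(1 - s / 2 : ℂ) - Complex.exp (-(s / 2 : ℝ))‖ ≤ ε * s := by
    have h1 : |(-(s / 2))| ≤ 1 := by
      rw [abs_neg, abs_of_nonneg (by positivity)]
      nlinarith
    have h2 := Real.abs_exp_sub_one_sub_id_le h1
    have h3 : (1 - s / 2 : ℂ) - Complex.exp (-(s / 2 : ℝ)) =
        ((-(Real.exp (-(s / 2)) - 1 - -(s / 2)) : ℝ) : ℂ) := by
      push_cast; ring
    rw [h3, Complex.norm_real, Real.norm_eq_abs, abs_neg]
    refine h2.trans ?_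
    nlinarith
  have hfin := (norm_add_le _ _).trans (add_le_add hb hexp)
  rw [sub_add_sub_cancel] at hfin
  refine hfin.trans ?_
  nlinarith [mul_nonneg hε.le hs0]

/-- Quantitative Lyapunov central limit theorem for characteristic functions. -/
lemma norm_integral_cexp_sum_sub_le {J : Type*} (I : Finset J) {X : J → Ω → ℝ}
    (hind : iIndepFun X μ) (hX : ∀ i, HasMoments (X i) μ) (h0 : ∀ i, ∫ ω, X i ω ∂μ = 0)
    (s : J → ℝ) (hs : ∀ i, ∫ ω, X i ω ^ 2 ∂μ = s i) (h4 : ∀ i, ∫ ω, X i ω ^ 4 ∂μ ≤ 27 * s i ^ 2)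
    {ε : ℝ} (hε : 0 < ε) (hε1 : ε ≤ 1) (hsε : ∀ i ∈ I, s i ≤ ε ^ 2) :
    ‖∫ ω, Complex.exp ((∑ i ∈ I, X i ω : ℝ) * Complex.I) ∂μ -
      Complex.exp (-((∑ i ∈ I, s i) / 2 : ℝ))‖ ≤ 60 * ε * ∑ i ∈ I, s i := by
  have hm : ∀ i, AEMeasurable (X i) μ := fun i => ((hX i).memLp_two.1).aemeasurable
  have hcf : ∀ {Y : Ω → ℝ}, AEMeasurable Y μ →
      charFun (μ.map Y) 1 = ∫ ω, Complex.exp (Y ω * Complex.I) ∂μ := by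
    intro Y hY
    rw [charFun_apply_real, integral_map hY (by fun_prop)]
    simp
  have h1 := congrFun (iIndepFun.charFun_map_fun_finsetSum_eq_prod (s := I) (fun i _ => hm i)
    (hind.restrict I)) 1
  rw [hcf (Finset.aemeasurable_fun_sum I fun i _ => hm i), Finset.prod_apply] at h1
  simp_rw [hcf (hm _)] at h1
  rw [h1]
  have h2 : Complex.exp (-((∑ i ∈ I, s i) / 2 : ℝ)) = ∏ i ∈ I, Complex.exp (-(s i / 2 : ℝ)) := by
    rw [← Complex.exp_sum]
    congr 1
    push_cast
    rw [Finset.sum_div, Finset.sum_neg_distrib]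
  rw [h2, Finset.mul_sum]
  refine (norm_prod_sub_prod_le I _ _ (fun i _ => ?_) fun i _ => ?_).trans
    (Finset.sum_le_sum fun i hi => norm_integral_cexp_sub_le (hX i) (h0 i) (hs i) (h4 i) hε hε1
      (hsε i hi))
  · refine (norm_integral_le_of_norm_le (integrable_const (1 : ℝ))
      (Eventually.of_forall fun ω => ?_)).trans (by simp)
    rw [Complex.norm_exp_ofReal_mul_I]
  · rw [← Complex.ofReal_neg, Complex.norm_exp_ofReal, Real.exp_le_one_iff]
    have : 0 ≤ s i := hs i ▸ integral_nonneg fun _ => sq_nonneg _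
    linarith

end Lyapunov

end SPHAR


/-! ### Central limit theorem for the linear part of the error. -/

namespace SPHAR

section CentralLimit

lemma abs_legendre_le (l : ℕ) {z : ℝ} (hz : z ∈ Set.Icc (-1 : ℝ) 1) :
    |(legendre l).eval z| ≤ 1 := by
  obtain ⟨x, y, rfl⟩ := exists_dot_eq hz
  have h := abs_zonal_le l x y
  have hc : 0 < (2 * (l : ℝ) + 1) / (4 * Real.pi) := by positivity
  rw [zonal, abs_mul, abs_of_pos hc] at h
  exact le_of_mul_le_mul_left (by linarith) hc

lemma tendsto_weighted_average {w v : ℕ → ℝ} {c : ℝ} (hw : ∀ n, 0 ≤ w n)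
    (hW : Tendsto (fun n => ∑ l ∈ Finset.range n, w l) atTop atTop) (hv : Tendsto v atTop (𝓝 c)) :
    Tendsto (fun n => (∑ l ∈ Finset.range n, w l * v l) / ∑ l ∈ Finset.range n, w l) atTop (𝓝 c) := by
  have h1 : (fun l => w l * (v l - c)) =o[atTop] w := by
    have h2 : (fun l => v l - c) =o[atTop] (fun _ => (1 : ℝ)) := by
      rw [Asymptotics.isLittleO_one_iff]
      simpa using hv.sub_const c
    simpa using (Asymptotics.isBigO_refl w atTop).mul_isLittleO h2
  have h3 := (h1.sum_range hw hW).tendsto_div_nhds_zero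
  have h4 := h3.add_const c
  rw [zero_add] at h4
  refine h4.congr' ?_
  filter_upwards [hW.eventually_gt_atTop 0] with n hn
  simp_rw [mul_sub]
  rw [Finset.sum_sub_distrib, ← Finset.sum_mul]
  field_simp
  ring

lemma tendsto_of_isHomogeneous {p : ℕ} {H : ℕ → Matrix (Fin p) (Fin p) ℝ}
    (hH : Tendsto H atTop (𝓝 1)) (c : Fin p → ℝ) :
    Tendsto (fun l => ∑ j, Matrix.vecMul c (H l) j * c j) atTop (𝓝 (∑ j, c j ^ 2)) := by
  have h1 : ∀ i j, Tendsto (fun l => H l i j) atTop (𝓝 ((1 : Matrix (Fin p) (Fin p) ℝ) i j)) :=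
    fun i j => (tendsto_pi_nhds.1 ((tendsto_pi_nhds.1 hH) i)) j
  have h2 : ∑ j, c j ^ 2 = ∑ j, (∑ i, c i * (1 : Matrix (Fin p) (Fin p) ℝ) i j) * c j := by
    refine Finset.sum_congr rfl fun j _ => ?_
    simp [Matrix.one_apply, sq]
  rw [h2]
  exact tendsto_finsetSum _ fun j _ => (tendsto_finsetSum _ fun i _ =>
    (h1 i j).const_mul (c i)).mul_const (c j)

/-- With `θ = cᵀ G⁻¹`, the quadratic form `θᵀ G θ` equals `θᵀ c`. -/
lemma IsCausalInverse.quadratic_vecMul_inv {p : ℕ} {φ : Fin p → ℝ} {ψ : ℤ → ℝ}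
    (h : IsCausalInverse φ ψ) (c : Fin p → ℝ) :
    ∑ j, ∑ k, Matrix.vecMul c (autocovMatrix p ψ)⁻¹ j *
      (autocovMatrix p ψ j k * Matrix.vecMul c (autocovMatrix p ψ)⁻¹ k) =
      ∑ j, Matrix.vecMul c (autocovMatrix p ψ)⁻¹ j * c j := by
  rw [Finset.sum_comm]
  have h1 : Matrix.vecMul (Matrix.vecMul c (autocovMatrix p ψ)⁻¹) (autocovMatrix p ψ) = c := by
    rw [Matrix.vecMul_vecMul, Matrix.nonsing_inv_mul _ h.isUnit_det_autocovMatrix,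
      Matrix.vecMul_one]
  refine Finset.sum_congr rfl fun k _ => ?_
  have h2 := congrFun h1 k
  rw [← h2]
  generalize Matrix.vecMul c (autocovMatrix p ψ)⁻¹ = θ
  simp_rw [Matrix.vecMul, dotProduct, Finset.mul_sum]
  exact Finset.sum_congr rfl fun j _ => by ring

variable {Ω : Type*} [MeasurableSpace Ω] {μ : Measure Ω} [IsProbabilityMeasure μ] {p : ℕ}
  {φ : ℕ → Fin p → ℝ} {ψ : ℕ → ℤ → ℝ} {a : (Σ l : ℕ, Fin (2 * l + 1)) → ℤ → Ω → ℝ}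

/-- The indices of the harmonics of degree at most `L`. -/
def harmonicIndices (L : ℕ) : Finset (Σ l : ℕ, Fin (2 * l + 1)) :=
  (Finset.range (L + 1)).sigma fun _ => Finset.univ

/-- The linear part of the standardized estimation error, in the direction `c`. -/
noncomputable def linearPart (φ : ℕ → Fin p → ℝ) (ψ : ℕ → ℤ → ℝ)
    (a : (Σ l : ℕ, Fin (2 * l + 1)) → ℤ → Ω → ℝ) (L : ℕ) (z : ℝ) (c : Fin p → ℝ) (t : ℤ) (N : ℕ)
    (ω : Ω) : ℝ :=
  ∑ i ∈ harmonicIndices L, (legendre i.1).eval z / (4 * Real.pi * √(N * normalizer L z)) *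
    score (φ i.1) (Matrix.vecMul c (autocovMatrix p (ψ i.1))⁻¹) (a i) t N ω

/-- The summands are independent over `(l, m)`, and the fourth moment bound for scores is Lyapunov's
condition at each index. Their total variance is a weighted average of `v l = cᵀ G_l⁻¹ c`, which
tends to `|c|²` because the normalizer, the sum of the weights, diverges. -/
lemma IsARSystem.tendsto_integral_cexp_linearPart
    (h : IsARSystem (fun i : Σ l : ℕ, Fin (2 * l + 1) => φ i.1) a μ)
    (hψ : ∀ l, IsCausalInverse (φ l) (ψ l)) (hφ : ∀ j, Tendsto (fun l => φ l j) atTop (𝓝 0))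
    {z : ℝ} (hz : z ∈ Set.Icc (-1 : ℝ) 1) {L : ℕ → ℕ} (hL : Tendsto L atTop atTop)
    (c : Fin p → ℝ) (t : ℤ) :
    Tendsto (fun N : ℕ => ∫ ω, Complex.exp ((linearPart φ ψ a (L N) z c t N ω : ℝ) * Complex.I) ∂μ)
      atTop (𝓝 (Complex.exp (-((∑ j, c j ^ 2) / 2 : ℝ)))) := by
  have hψ' : ∀ i : Σ l : ℕ, Fin (2 * l + 1), IsCausalInverse (φ i.1) (ψ i.1) := fun i => hψ i.1
  set θ : ℕ → Fin p → ℝ := fun l => Matrix.vecMul c (autocovMatrix p (ψ l))⁻¹ with hθ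
  set v : ℕ → ℝ := fun l => ∑ j, θ l j * c j with hv
  have hvl : Tendsto v atTop (𝓝 (∑ j, c j ^ 2)) :=
    tendsto_of_isHomogeneous (tendsto_autocovMatrix_inv hψ hφ) c
  obtain ⟨C, hC⟩ := hvl.bddAbove_range
  have hC : ∀ l, v l ≤ |C| + 1 := fun l => (hC ⟨l, rfl⟩).trans ((le_abs_self C).trans (by linarith))
  have hnorm := (tendsto_normalizer hz).comp hL
  set w : ℕ → ℝ := fun l => (2 * (l : ℝ) + 1) / (16 * Real.pi ^ 2) * (legendre l).eval z ^ 2 with hw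
  set s : ℕ → (Σ l : ℕ, Fin (2 * l + 1)) → ℝ := fun N i =>
    (legendre i.1).eval z ^ 2 / (16 * Real.pi ^ 2) / normalizer (L N) z * v i.1 with hs
  have hquad : ∀ l, ∑ j, ∑ k, θ l j * (autocovMatrix p (ψ l) j k * θ l k) = v l := fun l =>
    (hψ l).quadratic_vecMul_inv c
  have hv0 : ∀ l, 0 ≤ v l := fun l => by
    rw [← hquad, ← h.integral_lagSum_sq hψ' (θ l) ⟨l, 0⟩ 0]
    exact integral_nonneg fun _ => sq_nonneg _
  have hssum : ∀ N, ∑ i ∈ harmonicIndices (L N), s N i =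
      (∑ l ∈ Finset.range (L N + 1), w l * v l) / ∑ l ∈ Finset.range (L N + 1), w l := by
    intro N
    rw [harmonicIndices, Finset.sum_sigma, Finset.sum_div]
    refine Finset.sum_congr rfl fun l _ => ?_
    have : ∑ l ∈ Finset.range (L N + 1), w l = normalizer (L N) z := rfl
    rw [this]
    simp only [hs, hw, Finset.sum_const, Finset.card_univ, Fintype.card_fin, nsmul_eq_mul]
    push_cast
    ring
  have hslim : Tendsto (fun N => ∑ i ∈ harmonicIndices (L N), s N i) atTop (𝓝 (∑ j, c j ^ 2)) := by
    simp_rw [hssum]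
    have hW : Tendsto (fun n => ∑ l ∈ Finset.range n, w l) atTop atTop :=
      (tendsto_add_atTop_iff_nat 1).1 (tendsto_normalizer hz)
    exact (tendsto_weighted_average (fun n => by positivity) hW hvl).comp
      ((tendsto_add_atTop_iff_nat 1).2 tendsto_id |>.comp hL)
  -- `ε²` dominates every single variance, by `|P_l(z)| ≤ 1` and the bound on `v`, and it vanishes
  -- as the normalizer diverges.
  set ε : ℕ → ℝ := fun N => √((|C| + 1) / (16 * Real.pi ^ 2) / normalizer (L N) z) with hε
  have hεlim : Tendsto ε atTop (𝓝 0) := by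
    have h1 := (hnorm.const_div_atTop ((|C| + 1) / (16 * Real.pi ^ 2))).sqrt
    simpa using h1
  have hεpos : ∀ N, 0 < ε N := fun N => Real.sqrt_pos.2 (by
    have := normalizer_pos (L N) z; positivity)
  have hsε : ∀ N i, s N i ≤ ε N ^ 2 := by
    intro N i
    have hn := normalizer_pos (L N) z
    rw [hε, Real.sq_sqrt (by positivity)]
    have h1 : (legendre i.1).eval z ^ 2 ≤ 1 := by
      rw [← sq_abs]; exact pow_le_one₀ (abs_nonneg _) (abs_legendre_le _ hz)
    calc s N i ≤ 1 / (16 * Real.pi ^ 2) / normalizer (L N) z * (|C| + 1) := by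
          simp only [hs]
          gcongr
          exacts [hv0 _, hC _]
      _ = _ := by ring
  have hmain : ∀ᶠ N : ℕ in atTop, ‖∫ ω, Complex.exp ((linearPart φ ψ a (L N) z c t N ω : ℝ) *
      Complex.I) ∂μ - Complex.exp (-((∑ i ∈ harmonicIndices (L N), s N i) / 2 : ℝ))‖ ≤
        60 * ε N * ∑ i ∈ harmonicIndices (L N), s N i := by
    filter_upwards [eventually_gt_atTop 0, hεlim.eventually_le_const zero_lt_one] with N hN hε1
    have hn := normalizer_pos (L N) z
    have hN' : (0 : ℝ) < N := by exact_mod_cast hN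
    set b : (Σ l : ℕ, Fin (2 * l + 1)) → ℝ := fun i =>
      (legendre i.1).eval z / (4 * Real.pi * √(N * normalizer (L N) z)) with hb
    have hb2 : ∀ i, b i ^ 2 * (N * v i.1) = s N i := by
      intro i
      simp only [hb, hs, div_pow, mul_pow]
      rw [Real.sq_sqrt (by positivity)]
      field_simp
      ring
    refine norm_integral_cexp_sum_sub_le (harmonicIndices (L N))
      (X := fun i ω => b i * score (φ i.1) (θ i.1) (a i) t N ω) ?_ (fun i => ?_) (fun i => ?_)
      (s N) (fun i => ?_) (fun i => ?_) (hεpos N) hε1 fun i _ => hsε N i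
    · exact (h.iIndepFun_score hψ' (fun i => θ i.1) t N).comp (fun i x => b i * x)
        fun i => by fun_prop
    · exact (h.hasMoments_score _ i t N).const_mul _
    · rw [integral_const_mul, h.integral_score hψ', mul_zero]
    · simp_rw [mul_pow]
      have := h.integral_score_mul_score hψ' (θ i.1) i i t N
      simp only [if_true, ← sq] at this
      rw [integral_const_mul, this, hquad, hb2]
    · simp_rw [mul_pow]
      rw [integral_const_mul]
      have := h.integral_score_pow_four_le hψ' (θ i.1) i t N
      rw [hquad] at this
      refine (mul_le_mul_of_nonneg_left this (by positivity)).trans (le_of_eq ?_)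
      rw [← hb2]; ring
  have hlim2 : Tendsto (fun N => 60 * ε N * ∑ i ∈ harmonicIndices (L N), s N i) atTop (𝓝 0) := by
    simpa using (hεlim.const_mul 60).mul hslim
  have hd := squeeze_zero_norm' hmain hlim2
  have hexp : Tendsto (fun N => Complex.exp (-((∑ i ∈ harmonicIndices (L N), s N i) / 2 : ℝ))) atTop
      (𝓝 (Complex.exp (-((∑ j, c j ^ 2) / 2 : ℝ)))) :=
    (Complex.continuous_exp.tendsto _).comp
      ((Complex.continuous_ofReal.tendsto _).comp (hslim.div_const 2)).neg
  simpa using hd.add hexp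

end CentralLimit

end SPHAR


/-! ### Mean square errors of empirical covariances. -/

namespace SPHAR

set_option linter.unusedSectionVars false

section EmpiricalCovariance

variable {Ω : Type*} [MeasurableSpace Ω] {μ : Measure Ω} {p : ℕ}

/-- The empirical autocovariances of the harmonics of degree `l`. -/
noncomputable def empCov (a : (Σ l : ℕ, Fin (2 * l + 1)) → ℤ → Ω → ℝ) (l : ℕ) (t : ℤ) (N : ℕ)
    (i j : ℕ) (ω : Ω) : ℝ :=
  (∑ m, ∑ k ∈ Finset.range N,
    a ⟨l, m⟩ (t + k - ((i : ℤ) + 1)) ω * a ⟨l, m⟩ (t + k - ((j : ℤ) + 1)) ω) / (N * (2 * l + 1))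

/-- The empirical cross covariances between innovations and regressors of degree `l`. -/
noncomputable def empCross (φ : Fin p → ℝ) (a : (Σ l : ℕ, Fin (2 * l + 1)) → ℤ → Ω → ℝ) (l : ℕ)
    (t : ℤ) (N : ℕ) (i : Fin p) (ω : Ω) : ℝ :=
  (∑ m, score φ (Pi.single i 1) (a ⟨l, m⟩) t N ω) / (N * (2 * l + 1))

lemma lagSum_single (i : Fin p) (a : ℤ → Ω → ℝ) (t : ℤ) (ω : Ω) :
    lagSum (Pi.single i 1) a t ω = a (t - ((i : ℤ) + 1)) ω := by
  simp [lagSum, Pi.single_apply]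

lemma score_eq_sum (φ θ : Fin p → ℝ) (a : ℤ → Ω → ℝ) (t : ℤ) (N : ℕ) (ω : Ω) :
    score φ θ a t N ω = ∑ i, θ i * score φ (Pi.single i 1) a t N ω := by
  simp_rw [score, lagSum_single, Finset.mul_sum]
  rw [Finset.sum_comm]
  refine Finset.sum_congr rfl fun k _ => ?_
  rw [lagSum, Finset.sum_mul]
  exact Finset.sum_congr rfl fun i _ => by ring

variable [IsProbabilityMeasure μ]

lemma IsGaussianSpace.integral_centered_mul {V : Submodule ℝ (Ω → ℝ)} (hV : IsGaussianSpace V μ)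
    {A B C D : Ω → ℝ} (hA : A ∈ V) (hB : B ∈ V) (hC : C ∈ V) (hD : D ∈ V) {g : ℝ}
    (h1 : ∫ ω, A ω * B ω ∂μ = g) (h2 : ∫ ω, C ω * D ω ∂μ = g) :
    ∫ ω, (A ω * B ω - g) * (C ω * D ω - g) ∂μ =
      (∫ ω, A ω * C ω ∂μ) * (∫ ω, B ω * D ω ∂μ) + (∫ ω, A ω * D ω ∂μ) * (∫ ω, B ω * C ω ∂μ) := by
  have h3 := hV.isserlis hA hB hC hD
  have e : ∀ ω, (A ω * B ω - g) * (C ω * D ω - g) = A ω * B ω * (C ω * D ω) +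
      (-g) * (A ω * B ω) + (-g) * (C ω * D ω) + g ^ 2 := by intro ω; ring
  have mAB := (hV.hasMoments hA).mul (hV.hasMoments hB)
  have mCD := (hV.hasMoments hC).mul (hV.hasMoments hD)
  have m1 := (mAB.mul mCD).add (mAB.const_mul (-g))
  have m2 := m1.add (mCD.const_mul (-g))
  simp_rw [e]
  rw [integral_add m2.integrable (integrable_const _),
    integral_add m1.integrable (mCD.const_mul (-g)).integrable,
    integral_add (mAB.mul mCD).integrable (mAB.const_mul (-g)).integrable, integral_const_mul,
    integral_const_mul, h3, h1, h2]
  simp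
  ring

lemma integral_sq_sum {J : Type*} (S : Finset J) {Y : J → Ω → ℝ} (hY : ∀ s, HasMoments (Y s) μ) :
    ∫ ω, (∑ s ∈ S, Y s ω) ^ 2 ∂μ = ∑ s ∈ S, ∑ s' ∈ S, ∫ ω, Y s ω * Y s' ω ∂μ := by
  simp_rw [sq, Finset.sum_mul_sum]
  rw [integral_finsetSum _ fun s _ => integrable_finsetSum _ fun s' _ =>
    ((hY s).mul (hY s')).integrable]
  simp_rw [integral_finsetSum _ fun s' _ => ((hY _).mul (hY s')).integrable]

namespace IsARSystem

variable {φ : ℕ → Fin p → ℝ} {ψ : ℕ → ℤ → ℝ} {a : (Σ l : ℕ, Fin (2 * l + 1)) → ℤ → Ω → ℝ}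

lemma hasMoments_empCross (h : IsARSystem (fun i : Σ l : ℕ, Fin (2 * l + 1) => φ i.1) a μ)
    (l : ℕ) (t : ℤ) (N : ℕ) (i : Fin p) : HasMoments (empCross (φ l) a l t N i) μ := by
  have := (HasMoments.sum Finset.univ fun m _ =>
    h.hasMoments_score (Pi.single i 1) ⟨l, m⟩ t N).const_mul (1 / (N * (2 * l + 1) : ℝ))
  convert this using 1
  ext ω
  rw [empCross]; ring

lemma hasMoments_empCov (h : IsARSystem (fun i : Σ l : ℕ, Fin (2 * l + 1) => φ i.1) a μ)
    (l : ℕ) (t : ℤ) (N i j : ℕ) : HasMoments (empCov a l t N i j) μ := by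
  have hm : ∀ (m : Fin (2 * l + 1)) (k : ℕ), HasMoments (fun ω =>
      a ⟨l, m⟩ (t + k - ((i : ℤ) + 1)) ω * a ⟨l, m⟩ (t + k - ((j : ℤ) + 1)) ω) μ := fun m k =>
    (h.isGaussianSpace.hasMoments (mem_space a _ _)).mul
      (h.isGaussianSpace.hasMoments (mem_space a _ _))
  have := (HasMoments.sum Finset.univ fun m _ => HasMoments.sum (Finset.range N) fun k _ =>
    hm m k).const_mul (1 / (N * (2 * l + 1) : ℝ))
  convert this using 1
  ext ω
  rw [empCov]; ring

lemma integral_empCross_sq_le (h : IsARSystem (fun i : Σ l : ℕ, Fin (2 * l + 1) => φ i.1) a μ)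
    (hψ : ∀ l, IsCausalInverse (φ l) (ψ l)) {Q : ℝ} (hQ : ∀ l, ∑' n, |ψ l n| ≤ Q) (l : ℕ) (t : ℤ)
    {N : ℕ} (hN : 0 < N) (i : Fin p) :
    ∫ ω, empCross (φ l) a l t N i ω ^ 2 ∂μ ≤ Q ^ 2 / (N * (2 * l + 1)) := by
  have hψ' : ∀ i : Σ l : ℕ, Fin (2 * l + 1), IsCausalInverse (φ i.1) (ψ i.1) := fun i => hψ i.1
  have hN' : (0 : ℝ) < N := by exact_mod_cast hN
  have hdiag : ∑ j, ∑ k, (Pi.single i 1 : Fin p → ℝ) j *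
      (autocovMatrix p (ψ l) j k * (Pi.single i 1 : Fin p → ℝ) k) = autocov (ψ l) 0 := by
    simp [Pi.single_apply, autocovMatrix]
  have h1 : ∫ ω, (∑ m, score (φ l) (Pi.single i 1) (a ⟨l, m⟩) t N ω) ^ 2 ∂μ =
      (2 * l + 1) * (N * autocov (ψ l) 0) := by
    rw [integral_sq_sum Finset.univ fun m => h.hasMoments_score (Pi.single i 1) ⟨l, m⟩ t N]
    have h2 : ∀ m m' : Fin (2 * l + 1), ∫ ω, score (φ l) (Pi.single i 1) (a ⟨l, m⟩) t N ω *
        score (φ l) (Pi.single i 1) (a ⟨l, m'⟩) t N ω ∂μ =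
          if m = m' then N * autocov (ψ l) 0 else 0 := by
      intro m m'
      have h3 := h.integral_score_mul_score hψ' (Pi.single i 1) ⟨l, m⟩ ⟨l, m'⟩ t N
      simp only [hdiag] at h3
      rw [h3]
      by_cases hmm : m = m' <;> simp [hmm]
    simp_rw [h2]
    simp
  simp_rw [empCross, div_pow]
  rw [integral_div, h1]
  have h4 : autocov (ψ l) 0 ≤ Q ^ 2 := (le_abs_self _).trans (((hψ l).abs_autocov_le 0).trans
    (pow_le_pow_left₀ (tsum_nonneg fun _ => abs_nonneg _) (hQ l) 2))
  calc (2 * l + 1) * (N * autocov (ψ l) 0) / (N * (2 * l + 1) : ℝ) ^ 2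
      = autocov (ψ l) 0 / (N * (2 * l + 1)) := by field_simp
    _ ≤ _ := by gcongr

/-- By Isserlis' formula the covariance of two centred products is a sum of two products of
autocovariances, and it vanishes for different orders `m`. Bounding one factor and summing the other
gives `2Q⁴` for each of the `N(2l+1)` rows, so one power of `N(2l+1)` is gained. -/
lemma integral_empCov_sub_sq_le (h : IsARSystem (fun i : Σ l : ℕ, Fin (2 * l + 1) => φ i.1) a μ)
    (hψ : ∀ l, IsCausalInverse (φ l) (ψ l)) {Q : ℝ} (hQ : ∀ l, ∑' n, |ψ l n| ≤ Q) (l : ℕ) (t : ℤ)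
    {N : ℕ} (hN : 0 < N) (i j : Fin p) :
    ∫ ω, (empCov a l t N i j ω - autocovMatrix p (ψ l) i j) ^ 2 ∂μ ≤
      2 * Q ^ 4 / (N * (2 * l + 1)) := by
  have hψ' : ∀ i : Σ l : ℕ, Fin (2 * l + 1), IsCausalInverse (φ i.1) (ψ i.1) := fun i => hψ i.1
  have hN' : (0 : ℝ) < N := by exact_mod_cast hN
  have hV := h.isGaussianSpace
  set g := autocovMatrix p (ψ l) i j with hg
  have hγ : ∀ (m m' : Fin (2 * l + 1)) (s s' : ℤ), ∫ ω, a ⟨l, m⟩ s ω * a ⟨l, m'⟩ s' ω ∂μ =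
      if m = m' then autocov (ψ l) (s - s') else 0 := by
    intro m m' s s'
    rw [h.integral_mul hψ']
    by_cases hmm : m = m' <;> simp [hmm]
  have hQ1 : ∑' n, |ψ l n| ≤ Q := hQ l
  have hQ0 : 0 ≤ ∑' n, |ψ l n| := tsum_nonneg fun _ => abs_nonneg _
  have hQ2 : (∑' n, |ψ l n|) ^ 2 ≤ Q ^ 2 := pow_le_pow_left₀ hQ0 hQ1 2
  have hb : ∀ τ, |autocov (ψ l) τ| ≤ Q ^ 2 := fun τ => ((hψ l).abs_autocov_le τ).trans hQ2
  set A : Fin (2 * l + 1) × ℕ → Ω → ℝ := fun q => a ⟨l, q.1⟩ (t + q.2 - ((i : ℤ) + 1)) with hA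
  set B : Fin (2 * l + 1) × ℕ → Ω → ℝ := fun q => a ⟨l, q.1⟩ (t + q.2 - ((j : ℤ) + 1)) with hB
  have hAB : ∀ q, ∫ ω, A q ω * B q ω ∂μ = g := by
    intro q
    simp only [hA, hB, hγ, if_true, hg, autocovMatrix, Matrix.of_apply]
    rw [← IsCausalInverse.autocov_neg]
    congr 1; ring
  have hm : ∀ q, HasMoments (fun ω => A q ω * B q ω - g) μ := fun q => by
    simpa [sub_eq_add_neg] using ((hV.hasMoments (mem_space a _ _)).mul
      (hV.hasMoments (mem_space a _ _))).add (HasMoments.const (-g))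
  set S : Finset (Fin (2 * l + 1) × ℕ) := Finset.univ ×ˢ Finset.range N with hS
  have hcard : (S.card : ℝ) = N * (2 * l + 1) := by
    rw [hS, Finset.card_product, Finset.card_univ, Fintype.card_fin, Finset.card_range]
    push_cast; ring
  have hpos : (0 : ℝ) < N * (2 * l + 1) := by positivity
  have hD : ∀ ω, empCov a l t N i j ω - g = (∑ q ∈ S, (A q ω * B q ω - g)) / (N * (2 * l + 1)) := by
    intro ω
    rw [Finset.sum_sub_distrib, Finset.sum_const, nsmul_eq_mul, hcard, sub_div,
      mul_div_cancel_left₀ _ hpos.ne', empCov, hS, Finset.sum_product]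
  have hrow : ∀ q ∈ S, ∑ q' ∈ S, ∫ ω, (A q ω * B q ω - g) * (A q' ω * B q' ω - g) ∂μ ≤ 2 * Q ^ 4 := by
    intro q _
    have h1 : ∀ q', ∫ ω, (A q ω * B q ω - g) * (A q' ω * B q' ω - g) ∂μ ≤
        if q.1 = q'.1 then Q ^ 2 * |autocov (ψ l) (q.2 - q'.2)| +
          Q ^ 2 * |autocov (ψ l) (q.2 - q'.2 + (j - i))| else 0 := by
      intro q'
      rw [hV.integral_centered_mul (mem_space a _ _) (mem_space a _ _) (mem_space a _ _)
        (mem_space a _ _) (hAB q) (hAB q')]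
      simp only [hγ]
      split_ifs with hq
      · have e1 : t + (q.2 : ℤ) - ((i : ℤ) + 1) - (t + q'.2 - ((i : ℤ) + 1)) = q.2 - q'.2 := by ring
        have e2 : t + (q.2 : ℤ) - ((j : ℤ) + 1) - (t + q'.2 - ((j : ℤ) + 1)) = q.2 - q'.2 := by ring
        have e3 : t + (q.2 : ℤ) - ((i : ℤ) + 1) - (t + q'.2 - ((j : ℤ) + 1)) =
          q.2 - q'.2 + (j - i) := by ring
        rw [e1, e2, e3]
        refine add_le_add ?_ ?_
        · refine (le_abs_self _).trans ?_
          rw [abs_mul]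
          exact mul_le_mul_of_nonneg_right (hb _) (abs_nonneg _)
        · refine (le_abs_self _).trans ?_
          rw [abs_mul, mul_comm]
          exact mul_le_mul_of_nonneg_right (hb _) (abs_nonneg _)
      · simp
    refine (Finset.sum_le_sum fun q' _ => h1 q').trans ?_
    rw [hS, Finset.sum_product]
    simp only
    rw [Finset.sum_eq_single q.1]
    · simp only [if_true]
      rw [Finset.sum_add_distrib, ← Finset.mul_sum, ← Finset.mul_sum]
      have s1 := ((hψ l).sum_abs_autocov_le (Finset.range N) (σ := fun k : ℕ => (q.2 : ℤ) - k)
        (fun x _ y _ hxy => by simpa using hxy)).trans hQ2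
      have s2 := ((hψ l).sum_abs_autocov_le (Finset.range N)
        (σ := fun k : ℕ => (q.2 : ℤ) - k + (j - i)) (fun x _ y _ hxy => by simpa using hxy)).trans hQ2
      nlinarith [sq_nonneg Q]
    · intro m _ hm
      simp [Ne.symm hm]
    · simp
  simp_rw [hD, div_pow]
  rw [integral_div, integral_sq_sum S hm, div_le_div_iff₀ (by positivity) hpos]
  have h2 := Finset.sum_le_sum hrow
  rw [Finset.sum_const, nsmul_eq_mul, hcard] at h2
  calc _ ≤ (N * (2 * l + 1)) * (2 * Q ^ 4) * (N * (2 * l + 1) : ℝ) :=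
        mul_le_mul_of_nonneg_right h2 hpos.le
    _ = _ := by ring

end IsARSystem

end EmpiricalCovariance

end SPHAR


/-! ### Linearization of the estimator. -/

namespace SPHAR

set_option linter.unusedSectionVars false

section Remainder

/-- Perturbation of a linear system: if `(G + D) x = u` with `D` small then `x` is close to
`G⁻¹ u`, up to a quadratic error. -/
lemma sum_abs_sub_inv_mulVec_le {p : ℕ} (hp : 1 ≤ p) {G D : Matrix (Fin p) (Fin p) ℝ}
    (hG : IsUnit G.det) {K : ℝ} (hK : ∀ i j, |G⁻¹ i j| ≤ K) {x u : Fin p → ℝ}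
    (hx : ∀ i, ∑ j, (G i j + D i j) * x j = u i)
    (hr : 4 * (p : ℝ) ^ 4 * K ^ 2 * (∑ i, ∑ j, D i j ^ 2 + ∑ i, u i ^ 2) ≤ 1) :
    ∑ i, |x i - ∑ j, G⁻¹ i j * u j| ≤
      2 * (p : ℝ) ^ 4 * K ^ 2 * (∑ i, ∑ j, D i j ^ 2 + ∑ i, u i ^ 2) := by
  have hp1 : (1 : ℝ) ≤ p := by exact_mod_cast hp
  have hK0 : 0 ≤ K := (abs_nonneg _).trans (hK ⟨0, hp⟩ ⟨0, hp⟩)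
  set d : ℝ := ∑ i, ∑ j, |D i j| with hd
  set U : ℝ := ∑ i, |u i| with hU
  set X : ℝ := ∑ i, |x i| with hX
  set r : ℝ := ∑ i, ∑ j, D i j ^ 2 + ∑ i, u i ^ 2 with hrd
  have hd0 : 0 ≤ d := Finset.sum_nonneg fun i _ => Finset.sum_nonneg fun j _ => abs_nonneg _
  have hU0 : 0 ≤ U := Finset.sum_nonneg fun i _ => abs_nonneg _
  have hX0 : 0 ≤ X := Finset.sum_nonneg fun i _ => abs_nonneg _
  have hA0 : 0 ≤ ∑ i, ∑ j, D i j ^ 2 :=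
    Finset.sum_nonneg fun i _ => Finset.sum_nonneg fun j _ => sq_nonneg _
  have hB0 : 0 ≤ ∑ i, u i ^ 2 := Finset.sum_nonneg fun i _ => sq_nonneg _
  have hd2 : d ^ 2 ≤ (p : ℝ) ^ 2 * r := by
    have h1 := sq_sum_le_card_mul_sum_sq (s := (Finset.univ : Finset (Fin p × Fin p)))
      (f := fun q => |D q.1 q.2|)
    simp only [Finset.card_univ, Fintype.card_prod, Fintype.card_fin, Fintype.sum_prod_type,
      sq_abs] at h1
    push_cast at h1
    rw [← hd] at h1
    refine h1.trans ?_
    rw [← sq]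
    exact mul_le_mul_of_nonneg_left (by linarith) (by positivity)
  have hU2 : U ^ 2 ≤ (p : ℝ) ^ 2 * r := by
    have h1 := sq_sum_le_card_mul_sum_sq (s := (Finset.univ : Finset (Fin p))) (f := fun i => |u i|)
    simp only [Finset.card_univ, Fintype.card_fin, sq_abs] at h1
    rw [← hU] at h1
    refine h1.trans ?_
    have : (p : ℝ) * ∑ i, u i ^ 2 ≤ (p : ℝ) ^ 2 * ∑ i, u i ^ 2 :=
      mul_le_mul_of_nonneg_right (by nlinarith) hB0
    refine this.trans (mul_le_mul_of_nonneg_left (by linarith) (by positivity))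
  -- This is what the smallness hypothesis buys: the perturbation term `p K d X` is absorbed in `X`,
  -- giving `X ≤ 2pKU`.
  have hpKd : p * K * d ≤ 1 / 2 := by
    have h1 : (p * K * d) ^ 2 ≤ (1 / 2) ^ 2 := by
      calc (p * K * d) ^ 2 = p ^ 2 * K ^ 2 * d ^ 2 := by ring
        _ ≤ p ^ 2 * K ^ 2 * (p ^ 2 * r) := mul_le_mul_of_nonneg_left hd2 (by positivity)
        _ ≤ _ := by linarith
    exact le_of_sq_le_sq h1 (by norm_num)
  have hGx : ∀ i, x i + ∑ j, G⁻¹ i j * ∑ k, D j k * x k = ∑ j, G⁻¹ i j * u j := by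
    intro i
    have h1 : Matrix.mulVec G x + Matrix.mulVec D x = u := by
      ext i
      rw [← hx i]
      simp [Matrix.mulVec, dotProduct, add_mul, Finset.sum_add_distrib]
    have h2 : Matrix.mulVec G⁻¹ (Matrix.mulVec G x + Matrix.mulVec D x) = Matrix.mulVec G⁻¹ u := by
      rw [h1]
    rw [Matrix.mulVec_add, Matrix.mulVec_mulVec, Matrix.nonsing_inv_mul _ hG, Matrix.one_mulVec] at h2
    exact congrFun h2 i
  have hDx : ∀ i, |∑ j, G⁻¹ i j * ∑ k, D j k * x k| ≤ K * (d * X) := by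
    intro i
    refine (Finset.abs_sum_le_sum_abs _ _).trans ?_
    rw [hd, Finset.sum_mul, Finset.mul_sum]
    refine Finset.sum_le_sum fun j _ => ?_
    rw [abs_mul]
    refine mul_le_mul (hK i j) ?_ (abs_nonneg _) hK0
    refine (Finset.abs_sum_le_sum_abs _ _).trans ?_
    rw [Finset.sum_mul]
    refine Finset.sum_le_sum fun k _ => ?_
    rw [abs_mul]
    exact mul_le_mul_of_nonneg_left
      (Finset.single_le_sum (f := fun k => |x k|) (fun _ _ => abs_nonneg _) (Finset.mem_univ k))
      (abs_nonneg _)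
  have hHu : ∀ i, |∑ j, G⁻¹ i j * u j| ≤ K * U := by
    intro i
    refine (Finset.abs_sum_le_sum_abs _ _).trans ?_
    rw [hU, Finset.mul_sum]
    refine Finset.sum_le_sum fun j _ => ?_
    rw [abs_mul]
    exact mul_le_mul_of_nonneg_right (hK i j) (abs_nonneg _)
  have hdiff : ∑ i, |x i - ∑ j, G⁻¹ i j * u j| ≤ p * K * d * X := by
    have : ∀ i, |x i - ∑ j, G⁻¹ i j * u j| ≤ K * (d * X) := by
      intro i
      rw [← hGx i, sub_add_cancel_left, abs_neg]
      exact hDx i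
    refine (Finset.sum_le_sum fun i _ => this i).trans (le_of_eq ?_)
    simp; ring
  have hXle : X ≤ 2 * (p * K * U) := by
    have : ∀ i, |x i| ≤ K * U + K * (d * X) := by
      intro i
      rw [eq_sub_of_add_eq (hGx i)]
      exact (abs_sub _ _).trans (add_le_add (hHu i) (hDx i))
    have h2 := Finset.sum_le_sum fun i (_ : i ∈ Finset.univ) => this i
    rw [← hX] at h2
    simp only [Finset.sum_const, Finset.card_univ, Fintype.card_fin, nsmul_eq_mul] at h2
    nlinarith
  have hdU : d * U ≤ (p : ℝ) ^ 2 * r := by nlinarith [sq_nonneg (d - U)]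
  calc _ ≤ p * K * d * X := hdiff
    _ ≤ p * K * d * (2 * (p * K * U)) := mul_le_mul_of_nonneg_left hXle (by positivity)
    _ = 2 * (p ^ 2 * K ^ 2) * (d * U) := by ring
    _ ≤ 2 * (p ^ 2 * K ^ 2) * (p ^ 2 * r) := mul_le_mul_of_nonneg_left hdU (by positivity)
    _ = _ := by ring

variable {Ω : Type*} [MeasurableSpace Ω] {μ : Measure Ω} [IsProbabilityMeasure μ] {p : ℕ}
  {φ : ℕ → Fin p → ℝ} {ψ : ℕ → ℤ → ℝ} {a : (Σ l : ℕ, Fin (2 * l + 1)) → ℤ → Ω → ℝ}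

lemma linearPart_single (φ : ℕ → Fin p → ℝ) (ψ : ℕ → ℤ → ℝ)
    (a : (Σ l : ℕ, Fin (2 * l + 1)) → ℤ → Ω → ℝ) (L : ℕ) (z : ℝ) (j : Fin p) (t : ℤ) {N : ℕ}
    (hN : 0 < N) (ω : Ω) : linearPart φ ψ a L z (Pi.single j 1) t N ω =
      √(N / normalizer L z) * ∑ l ∈ Finset.range (L + 1), zonal l z *
        ∑ i, (autocovMatrix p (ψ l))⁻¹ j i * empCross (φ l) a l t N i ω := by
  have hN' : (0 : ℝ) < N := by exact_mod_cast hN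
  have hn := normalizer_pos L z
  rw [linearPart, harmonicIndices, Finset.sum_sigma, Finset.mul_sum]
  refine Finset.sum_congr rfl fun l _ => ?_
  have h1 : ∀ m : Fin (2 * l + 1), score (φ l)
      (Matrix.vecMul (Pi.single j 1) (autocovMatrix p (ψ l))⁻¹) (a ⟨l, m⟩) t N ω =
      ∑ i, (autocovMatrix p (ψ l))⁻¹ j i * score (φ l) (Pi.single i 1) (a ⟨l, m⟩) t N ω := by
    intro m
    rw [score_eq_sum, Matrix.single_one_vecMul]
    rfl
  simp_rw [h1]
  rw [← Finset.mul_sum, Finset.sum_comm]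
  simp_rw [empCross, ← Finset.mul_sum, mul_div_assoc', ← Finset.sum_div]
  have h2 : √(N / normalizer L z) = N / √(N * normalizer L z) := by
    rw [Real.sqrt_div hN'.le, Real.sqrt_mul hN'.le]
    have := Real.sqrt_pos.2 hN'
    have := Real.sqrt_pos.2 hn
    field_simp
    rw [Real.sq_sqrt hN'.le]
  rw [h2, zonal]
  have := Real.sqrt_pos.2 (mul_pos hN' hn)
  field_simp

/-- The quadratic error at degree `l`. -/
noncomputable def empError (φ : ℕ → Fin p → ℝ) (ψ : ℕ → ℤ → ℝ)
    (a : (Σ l : ℕ, Fin (2 * l + 1)) → ℤ → Ω → ℝ) (l : ℕ) (t : ℤ) (N : ℕ) (ω : Ω) : ℝ :=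
  ∑ i : Fin p, ∑ j : Fin p, (empCov a l t N i j ω - autocovMatrix p (ψ l) i j) ^ 2 +
    ∑ i, empCross (φ l) a l t N i ω ^ 2

lemma empError_nonneg (φ : ℕ → Fin p → ℝ) (ψ : ℕ → ℤ → ℝ)
    (a : (Σ l : ℕ, Fin (2 * l + 1)) → ℤ → Ω → ℝ) (l : ℕ) (t : ℤ) (N : ℕ) (ω : Ω) :
    0 ≤ empError φ ψ a l t N ω :=
  add_nonneg (Finset.sum_nonneg fun _ _ => Finset.sum_nonneg fun _ _ => sq_nonneg _)
    (Finset.sum_nonneg fun _ _ => sq_nonneg _)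

lemma IsARSystem.integral_empError_le
    (h : IsARSystem (fun i : Σ l : ℕ, Fin (2 * l + 1) => φ i.1) a μ)
    (hψ : ∀ l, IsCausalInverse (φ l) (ψ l)) {Q : ℝ} (hQ : ∀ l, ∑' n, |ψ l n| ≤ Q) (l : ℕ) (t : ℤ)
    {N : ℕ} (hN : 0 < N) : Integrable (empError φ ψ a l t N) μ ∧
      ∫ ω, empError φ ψ a l t N ω ∂μ ≤ (p * p * (2 * Q ^ 4) + p * Q ^ 2) / (N * (2 * l + 1)) := by
  have m1 : ∀ i j : Fin p, HasMoments (fun ω =>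
      (empCov a l t N i j ω - autocovMatrix p (ψ l) i j) ^ 2) μ := fun i j => by
    have := ((h.hasMoments_empCov l t N i j).add
      (HasMoments.const (-autocovMatrix p (ψ l) i j))).pow 2
    simpa [sub_eq_add_neg] using this
  have m2 : ∀ i, HasMoments (fun ω => empCross (φ l) a l t N i ω ^ 2) μ := fun i =>
    (h.hasMoments_empCross l t N i).pow 2
  have m3 := HasMoments.sum Finset.univ fun i _ => HasMoments.sum Finset.univ fun j _ => m1 i j
  have m4 := HasMoments.sum Finset.univ fun i _ => m2 i
  refine ⟨(m3.add m4).integrable, ?_⟩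
  simp_rw [empError]
  rw [integral_add m3.integrable m4.integrable, integral_finsetSum _ fun i _ =>
    integrable_finsetSum _ fun j _ => (m1 i j).integrable,
    integral_finsetSum _ fun i _ => (m2 i).integrable]
  simp_rw [integral_finsetSum _ fun j _ => (m1 _ j).integrable]
  refine (add_le_add (Finset.sum_le_sum fun i _ => Finset.sum_le_sum fun j _ =>
    h.integral_empCov_sub_sq_le hψ hQ l t hN i j) (Finset.sum_le_sum fun i _ =>
    h.integral_empCross_sq_le hψ hQ l t hN i)).trans (le_of_eq ?_)
  simp
  ring

/-- Cauchy–Schwarz with weights `2l + 1`: `(∑|P_l|)² ≤ ∑ 1/(2l+1) · ∑ (2l+1)P_l²`, and the last sum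
is `16π²` times the normalizer. -/
lemma tendsto_sum_abs_legendre {z : ℝ} {L : ℕ → ℕ} 
    (hL : Tendsto (fun N : ℕ => (∑ l ∈ Finset.range (L N + 1), 1 / (2 * (l : ℝ) + 1)) / N) atTop (𝓝 0)) :
    Tendsto (fun N : ℕ => (∑ l ∈ Finset.range (L N + 1), |(legendre l).eval z|) /
      √(N * normalizer (L N) z)) atTop (𝓝 0) := by
  have h1 : Tendsto (fun N : ℕ => 4 * Real.pi *
      √((∑ l ∈ Finset.range (L N + 1), 1 / (2 * (l : ℝ) + 1)) / N)) atTop (𝓝 0) := by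
    simpa using (hL.sqrt).const_mul (4 * Real.pi)
  refine squeeze_zero' (Eventually.of_forall fun N => by positivity) ?_ h1
  filter_upwards [eventually_gt_atTop 0] with N hN
  have hN' : (0 : ℝ) < N := by exact_mod_cast hN
  have hn := normalizer_pos (L N) z
  set S := ∑ l ∈ Finset.range (L N + 1), 1 / (2 * (l : ℝ) + 1) with hS
  have hS0 : 0 ≤ S := Finset.sum_nonneg fun _ _ => by positivity
  have h2 : (∑ l ∈ Finset.range (L N + 1), |(legendre l).eval z|) ^ 2 ≤
      S * (16 * Real.pi ^ 2 * normalizer (L N) z) := by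
    have h3 : 16 * Real.pi ^ 2 * normalizer (L N) z =
        ∑ l ∈ Finset.range (L N + 1), (2 * (l : ℝ) + 1) * (legendre l).eval z ^ 2 := by
      rw [normalizer, Finset.mul_sum]
      refine Finset.sum_congr rfl fun l _ => ?_
      field_simp
    rw [h3]
    refine Finset.sum_sq_le_sum_mul_sum_of_sq_le_mul (Finset.range (L N + 1))
      (fun l _ => by positivity) (fun l _ => by positivity) fun l _ => le_of_eq ?_
    rw [sq_abs]; field_simp
  rw [div_le_iff₀ (Real.sqrt_pos.2 (by positivity))]
  refine (Real.le_sqrt_of_sq_le h2).trans (le_of_eq ?_)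
  have h4 : S * (16 * Real.pi ^ 2 * normalizer (L N) z) =
      (4 * Real.pi) ^ 2 * (S / N * (N * normalizer (L N) z)) := by
    field_simp; ring
  rw [h4, Real.sqrt_mul (by positivity), Real.sqrt_sq (by positivity), Real.sqrt_mul (by positivity)]
  ring

/-- The estimation error is asymptotically linear. -/
lemma IsARSystem.tendstoInMeasure_sub_linearPart
    (h : IsARSystem (fun i : Σ l : ℕ, Fin (2 * l + 1) => φ i.1) a μ)
    (hψ : ∀ l, IsCausalInverse (φ l) (ψ l)) (hφ : ∀ j, Tendsto (fun l => φ l j) atTop (𝓝 0))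
    (hp : 1 ≤ p) {z : ℝ} {L : ℕ → ℕ}
    (hL : Tendsto (fun N : ℕ => (∑ l ∈ Finset.range (L N + 1), 1 / (2 * (l : ℝ) + 1)) / N) atTop
      (𝓝 0)) (t : ℤ) {x : ℕ → Ω → ℕ → Fin p → ℝ}
    (hx : ∀ᶠ N in atTop, ∀ᵐ ω ∂μ, ∀ l ≤ L N, ∀ i : Fin p,
      ∑ j : Fin p, empCov a l t N i j ω * x N ω l j = empCross (φ l) a l t N i ω) (j : Fin p) :
    TendstoInMeasure μ (fun (N : ℕ) ω => √(N / normalizer (L N) z) *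
      (∑ l ∈ Finset.range (L N + 1), zonal l z * x N ω l j) -
        linearPart φ ψ a (L N) z (Pi.single j 1) t N ω) atTop (fun _ => 0) := by
  obtain ⟨K, hK⟩ := exists_autocovMatrix_inv_bound hψ hφ
  obtain ⟨Q, hQ⟩ := exists_tsum_abs_le hψ hφ
  set C₁ : ℝ := 2 * (p : ℝ) ^ 4 * K ^ 2 with hC₁
  have hC₁0 : 0 ≤ C₁ := by positivity
  set C₂ : ℝ := p * p * (2 * Q ^ 4) + p * Q ^ 2 with hC₂
  -- An integrable majorant with two roles. The first part of the weight bounds the standardized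
  -- error. The part `2 * C₁` makes `F ≤ 1` imply the smallness hypothesis of the perturbation lemma
  -- at all degrees simultaneously, at the cost of the negligible sum of `1/(N(2l+1))`.
  set F : ℕ → Ω → ℝ := fun N ω => ∑ l ∈ Finset.range (L N + 1),
    (√(N / normalizer (L N) z) * |zonal l z| * C₁ + 2 * C₁) * empError φ ψ a l t N ω with hF
  have hF0 : ∀ N ω, 0 ≤ F N ω := fun N ω => Finset.sum_nonneg fun l _ =>
    mul_nonneg (by positivity) (empError_nonneg _ _ _ _ _ _ _)
  have hFint : ∀ᶠ N in atTop, Integrable (F N) μ ∧ ∫ ω, F N ω ∂μ ≤ C₁ * C₂ / (4 * Real.pi) *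
      ((∑ l ∈ Finset.range (L N + 1), |(legendre l).eval z|) / √(N * normalizer (L N) z)) +
      2 * C₁ * C₂ * ((∑ l ∈ Finset.range (L N + 1), 1 / (2 * (l : ℝ) + 1)) / N) := by
    filter_upwards [eventually_gt_atTop 0] with N hN
    have hN' : (0 : ℝ) < N := by exact_mod_cast hN
    have hn := normalizer_pos (L N) z
    have hi := fun l => h.integral_empError_le hψ hQ l t hN
    refine ⟨integrable_finsetSum _ fun l _ => (hi l).1.const_mul _, ?_⟩
    simp_rw [hF]
    rw [integral_finsetSum _ fun l _ => (hi l).1.const_mul _]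
    simp_rw [integral_const_mul]
    refine (Finset.sum_le_sum fun l _ => mul_le_mul_of_nonneg_left (hi l).2
      (by positivity)).trans (le_of_eq ?_)
    rw [Finset.sum_div, Finset.sum_div, Finset.mul_sum, Finset.mul_sum, ← Finset.sum_add_distrib]
    refine Finset.sum_congr rfl fun l _ => ?_
    have h2 : √(N / normalizer (L N) z) = N / √(N * normalizer (L N) z) := by
      rw [Real.sqrt_div hN'.le, Real.sqrt_mul hN'.le]
      have := Real.sqrt_pos.2 hN'
      have := Real.sqrt_pos.2 hn
      field_simp
      rw [Real.sq_sqrt hN'.le]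
    have h3 : |zonal l z| = (2 * l + 1) / (4 * Real.pi) * |(legendre l).eval z| := by
      rw [zonal, abs_mul, abs_of_pos (by positivity)]
    rw [h2, h3, ← hC₂]
    have := Real.sqrt_pos.2 (mul_pos hN' hn)
    field_simp
  have hFlim : Tendsto (fun N => ∫ ω, F N ω ∂μ) atTop (𝓝 0) := by
    have h1 := ((tendsto_sum_abs_legendre (z := z) hL).const_mul (C₁ * C₂ / (4 * Real.pi))).add
      (hL.const_mul (2 * C₁ * C₂))
    simp only [mul_zero, add_zero] at h1
    exact squeeze_zero' (Eventually.of_forall fun N => integral_nonneg (hF0 N))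
      (hFint.mono fun N hN => hN.2) h1
  rw [tendstoInMeasure_iff_measureReal_norm]
  intro ε hε
  -- Below `1` the perturbation lemma applies at every degree; below `ε` the resulting bound
  -- contradicts a large error.
  set η := min ε 1 with hη
  have hη0 : 0 < η := lt_min hε one_pos
  have hlim : Tendsto (fun N => (∫ ω, F N ω ∂μ) / η) atTop (𝓝 0) := by
    simpa using hFlim.div_const η
  refine squeeze_zero' (Eventually.of_forall fun N => measureReal_nonneg) ?_ hlim
  filter_upwards [hFint, hx, eventually_gt_atTop 0] with N hFN hxN hN
  rw [le_div_iff₀ hη0, mul_comm]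
  refine le_trans (mul_le_mul_of_nonneg_left ?_ hη0.le)
    (mul_meas_ge_le_integral_of_nonneg (Eventually.of_forall (hF0 N)) hFN.1 η)
  refine ENNReal.toReal_mono (measure_ne_top _ _) (measure_mono_ae ?_)
  filter_upwards [hxN] with ω hω hbig
  by_contra hsmall
  have hFlt : F N ω < η := not_le.1 hsmall
  have hbig : ε ≤ ‖√(N / normalizer (L N) z) *
      (∑ l ∈ Finset.range (L N + 1), zonal l z * x N ω l j) -
        linearPart φ ψ a (L N) z (Pi.single j 1) t N ω - 0‖ := hbig
  have hterm : ∀ l ∈ Finset.range (L N + 1), (√(N / normalizer (L N) z) * |zonal l z| * C₁ + 2 * C₁) *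
      empError φ ψ a l t N ω ≤ F N ω := fun l hl =>
    Finset.single_le_sum (f := fun l => (√(N / normalizer (L N) z) * |zonal l z| * C₁ + 2 * C₁) *
      empError φ ψ a l t N ω) (fun l _ => mul_nonneg (by positivity)
        (empError_nonneg _ _ _ _ _ _ _)) hl
  have hl : ∀ l ∈ Finset.range (L N + 1),
      |x N ω l j - ∑ i, (autocovMatrix p (ψ l))⁻¹ j i * empCross (φ l) a l t N i ω| ≤
        C₁ * empError φ ψ a l t N ω := by
    intro l hl
    have h0 := empError_nonneg φ ψ a l t N ω
    have h1 := sum_abs_sub_inv_mulVec_le hp (G := autocovMatrix p (ψ l))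
      (D := Matrix.of fun i j => empCov a l t N i j ω - autocovMatrix p (ψ l) i j)
      (hψ l).isUnit_det_autocovMatrix (hK l) (x := x N ω l)
      (u := fun i => empCross (φ l) a l t N i ω) (fun i => by
        rw [← hω l (Nat.lt_succ_iff.1 (Finset.mem_range.1 hl)) i]
        simp) (by
        have h2 : 2 * C₁ * empError φ ψ a l t N ω ≤ 1 := by
          have h3 : 0 ≤ √(N / normalizer (L N) z) * |zonal l z| * C₁ := by positivity
          have h4 := mul_nonneg h3 h0
          have := hterm l hl
          have : η ≤ 1 := min_le_right _ _
          nlinarith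
        have h5 : 4 * (p : ℝ) ^ 4 * K ^ 2 = 2 * C₁ := by rw [hC₁]; ring
        rw [h5]
        exact h2)
    exact (Finset.single_le_sum (f := fun i => |x N ω l i -
      ∑ j, (autocovMatrix p (ψ l))⁻¹ i j * empCross (φ l) a l t N j ω|)
      (fun _ _ => abs_nonneg _) (Finset.mem_univ j)).trans h1
  have hle : ‖√(N / normalizer (L N) z) *
      (∑ l ∈ Finset.range (L N + 1), zonal l z * x N ω l j) -
        linearPart φ ψ a (L N) z (Pi.single j 1) t N ω - 0‖ ≤ F N ω := by
    rw [sub_zero, linearPart_single _ _ _ _ _ _ _ hN, ← mul_sub, ← Finset.sum_sub_distrib, norm_mul,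
      Real.norm_of_nonneg (Real.sqrt_nonneg _)]
    simp_rw [← mul_sub]
    refine (mul_le_mul_of_nonneg_left (Finset.abs_sum_le_sum_abs _ _) (Real.sqrt_nonneg _)).trans ?_
    rw [hF, Finset.mul_sum]
    refine Finset.sum_le_sum fun l hl' => ?_
    have h0 := empError_nonneg φ ψ a l t N ω
    rw [abs_mul]
    have h1 := mul_le_mul_of_nonneg_left (mul_le_mul_of_nonneg_left (hl l hl') (abs_nonneg (zonal l z)))
      (Real.sqrt_nonneg (N / normalizer (L N) z))
    refine h1.trans ?_
    have := mul_nonneg hC₁0 h0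
    nlinarith
  have : η ≤ ε := min_le_left _ _
  linarith

end Remainder

end SPHAR


/-! ### Vector-valued limits and passage from the field to the autoregressive system. -/

namespace SPHAR

section VectorLimits

variable {Ω : Type*} [MeasurableSpace Ω] {μ : Measure Ω} [IsProbabilityMeasure μ] {p : ℕ}
  {φ : ℕ → Fin p → ℝ} {ψ : ℕ → ℤ → ℝ} {a : (Σ l : ℕ, Fin (2 * l + 1)) → ℤ → Ω → ℝ}

lemma tendstoInMeasure_toLp {R : ℕ → Ω → Fin p → ℝ}
    (h : ∀ j, TendstoInMeasure μ (fun N ω => R N ω j) atTop (fun _ => 0)) :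
    TendstoInMeasure μ (fun N ω => (WithLp.toLp 2 (R N ω) : EuclideanSpace ℝ (Fin p))) atTop 0 := by
  rw [tendstoInMeasure_iff_measureReal_norm]
  intro ε hε
  have hη : 0 < ε / (p + 1) := by positivity
  have h1 : Tendsto (fun N => ∑ j, μ.real {ω | ε / (p + 1) ≤ ‖R N ω j - 0‖}) atTop (𝓝 0) := by
    simpa using tendsto_finsetSum Finset.univ fun j _ =>
      (tendstoInMeasure_iff_measureReal_norm.1 (h j)) _ hη
  refine squeeze_zero (fun N => measureReal_nonneg) (fun N => ?_) h1
  refine (measureReal_mono (s₂ := ⋃ j, {ω | ε / (p + 1) ≤ ‖R N ω j - 0‖}) ?_).trans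
    (measureReal_iUnion_fintype_le _)
  intro ω hω
  by_contra hcon
  simp only [Set.mem_iUnion, Set.mem_ofPred_eq, not_exists, not_le, sub_zero] at hcon
  have hω : ε ≤ ‖(WithLp.toLp 2 (R N ω) : EuclideanSpace ℝ (Fin p)) - 0‖ := hω
  rw [sub_zero] at hω
  have h2 : ‖(WithLp.toLp 2 (R N ω) : EuclideanSpace ℝ (Fin p))‖ ≤ ∑ j, ‖R N ω j‖ := by
    rw [EuclideanSpace.norm_eq]
    refine Real.sqrt_le_iff.2 ⟨Finset.sum_nonneg fun _ _ => norm_nonneg _, ?_⟩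
    exact Finset.sum_sq_le_sq_sum_of_nonneg fun _ _ => norm_nonneg _
  have h3 : ∑ j, ‖R N ω j‖ ≤ ∑ _j : Fin p, ε / (p + 1) := Finset.sum_le_sum fun j _ => (hcon j).le
  simp only [Finset.sum_const, Finset.card_univ, Fintype.card_fin, nsmul_eq_mul] at h3
  have h4 : (p : ℝ) * (ε / (p + 1)) < ε := by
    rw [mul_div_assoc', div_lt_iff₀ (by positivity)]
    nlinarith
  linarith

lemma tendstoInMeasure_sub_of_tendsto {f : ℕ → Ω → ℝ} {b : ℕ → ℝ}
    (hf : TendstoInMeasure μ f atTop (fun _ => 0)) (hb : Tendsto b atTop (𝓝 0)) :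
    TendstoInMeasure μ (fun N ω => f N ω - b N) atTop (fun _ => 0) := by
  rw [tendstoInMeasure_iff_measureReal_norm] at hf ⊢
  intro ε hε
  refine squeeze_zero' (Eventually.of_forall fun _ => measureReal_nonneg) ?_ (hf _ (half_pos hε))
  filter_upwards [hb.abs.eventually_lt_const (u := ε / 2) (by simpa using half_pos hε)] with N hN
  refine measureReal_mono fun ω hω => ?_
  have h1 : ε ≤ |f N ω - b N - 0| := hω
  change ε / 2 ≤ |f N ω - 0|
  rw [sub_zero] at h1 ⊢
  linarith [abs_sub (f N ω) (b N)]

/-- Linearity in the direction `c`, needed for the Cramér–Wold argument. -/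
lemma linearPart_eq_sum (φ : ℕ → Fin p → ℝ) (ψ : ℕ → ℤ → ℝ)
    (a : (Σ l : ℕ, Fin (2 * l + 1)) → ℤ → Ω → ℝ) (L : ℕ) (z : ℝ) (c : Fin p → ℝ) (t : ℤ) (N : ℕ)
    (ω : Ω) : linearPart φ ψ a L z c t N ω =
      ∑ j, c j * linearPart φ ψ a L z (Pi.single j 1) t N ω := by
  simp_rw [linearPart, Finset.mul_sum]
  rw [Finset.sum_comm]
  refine Finset.sum_congr rfl fun i _ => ?_
  rw [score_eq_sum, Finset.mul_sum]
  simp_rw [score_eq_sum _ (Matrix.vecMul (Pi.single _ 1) _), Matrix.single_one_vecMul,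
    Finset.mul_sum]
  rw [Finset.sum_comm]
  refine Finset.sum_congr rfl fun k _ => ?_
  rw [Matrix.vecMul, dotProduct, Finset.sum_mul, Finset.mul_sum]
  refine Finset.sum_congr rfl fun j _ => ?_
  simp only [Matrix.row]
  ring

lemma IsARSystem.hasMoments_linearPart
    (h : IsARSystem (fun i : Σ l : ℕ, Fin (2 * l + 1) => φ i.1) a μ) (L : ℕ) (z : ℝ)
    (c : Fin p → ℝ) (t : ℤ) (N : ℕ) : HasMoments (linearPart φ ψ a L z c t N) μ :=
  HasMoments.sum _ fun i _ => (h.hasMoments_score _ i t N).const_mul _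

/-- Lévy's continuity theorem: the characteristic function of the vector at `c` is the scalar
integral already treated, with limit `exp(-|c|²/2)`. -/
lemma IsARSystem.tendstoInDistribution_linearPart
    (h : IsARSystem (fun i : Σ l : ℕ, Fin (2 * l + 1) => φ i.1) a μ)
    (hψ : ∀ l, IsCausalInverse (φ l) (ψ l)) (hφ : ∀ j, Tendsto (fun l => φ l j) atTop (𝓝 0))
    {z : ℝ} (hz : z ∈ Set.Icc (-1 : ℝ) 1) {L : ℕ → ℕ} (hL : Tendsto L atTop atTop) (t : ℤ) :
    TendstoInDistribution
      (fun (N : ℕ) (ω : Ω) => (WithLp.toLp 2 (fun j : Fin p =>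
        linearPart φ ψ a (L N) z (Pi.single j 1) t N ω) : EuclideanSpace ℝ (Fin p)))
      atTop (fun v : EuclideanSpace ℝ (Fin p) => v) (fun _ => μ)
      (stdGaussian (EuclideanSpace ℝ (Fin p))) where
  forall_aemeasurable N := by
    have h1 : ∀ j : Fin p, AEMeasurable (fun ω => linearPart φ ψ a (L N) z (Pi.single j 1) t N ω) μ :=
      fun j => (h.hasMoments_linearPart (L N) z (Pi.single j 1) t N).memLp_two.1.aemeasurable
    exact (WithLp.measurable_toLp 2 _).comp_aemeasurable (aemeasurable_pi_lambda _ h1)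
  tendsto := by
    refine ProbabilityMeasure.tendsto_iff_tendsto_charFun.2 fun c => ?_
    have h1 : ∀ j N, AEMeasurable (fun ω => linearPart φ ψ a (L N) z (Pi.single j 1) t N ω) μ :=
      fun j N => (h.hasMoments_linearPart (L N) z (Pi.single j 1) t N).memLp_two.1.aemeasurable
    have h2 : ∀ N, AEMeasurable (fun ω => (WithLp.toLp 2 (fun j : Fin p =>
        linearPart φ ψ a (L N) z (Pi.single j 1) t N ω) : EuclideanSpace ℝ (Fin p))) μ := fun N =>
      (WithLp.measurable_toLp 2 _).comp_aemeasurable (aemeasurable_pi_lambda _ fun j => h1 j N)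
    have h3 := h.tendsto_integral_cexp_linearPart hψ hφ hz hL c t
    simp only [ProbabilityMeasure.coe_mk, Measure.map_id']
    rw [charFun_stdGaussian]
    have h4 : Complex.exp (-((∑ j, c j ^ 2) / 2 : ℝ)) = Complex.exp (-‖c‖ ^ 2 / 2) := by
      rw [← Complex.ofReal_pow, EuclideanSpace.real_norm_sq_eq]
      congr 1
      push_cast
      ring
    rw [← h4]
    refine h3.congr fun N => ?_
    rw [charFun_apply, integral_map (h2 N) (by fun_prop)]
    refine integral_congr_ae (Eventually.of_forall fun ω => ?_)
    simp only
    rw [linearPart_eq_sum]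
    congr 3

end VectorLimits

section Model

variable {Ω : Type*} [MeasurableSpace Ω] {μ : Measure Ω} [IsProbabilityMeasure μ] {p : ℕ}
  {T Z : Ω → S2 → ℤ → ℝ} {CZ : ℕ → ℝ} {k : Fin p → ℝ → ℝ} {φ : ℕ → Fin p → ℝ}
  {Y : (l : ℕ) → Fin (2 * l + 1) → C(S2, ℝ)}

/-- The harmonic coefficients of the field, standardized by the innovation spectrum. -/
noncomputable def stdCoef (Y : (l : ℕ) → Fin (2 * l + 1) → C(S2, ℝ)) (CZ : ℕ → ℝ)
    (T : Ω → S2 → ℤ → ℝ) (i : Σ l : ℕ, Fin (2 * l + 1)) (t : ℤ) (ω : Ω) : ℝ :=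
  (√(CZ i.1))⁻¹ * coef (Y i.1 i.2) (fun ω x => T ω x t) ω

/-- The standardized harmonic coefficients form a system of scalar autoregressions. -/
lemma IsSPHAR.isARSystem (hTZ : IsSPHAR k T Z μ) (hT : IsGaussianIsotropicStationary T μ)
    (hZ : IsSphericalWhiteNoise Z CZ μ) (hC : ∀ l, 0 < CZ l) (hY : IsHarmonicSystem Y)
    (hk : ∀ j, HasLegendreExpansion (k j) fun l => φ l j)
    (hφ : ∀ j, Summable fun l => |φ l j| * (2 * (l : ℝ) + 1)) :
    IsARSystem (fun i : Σ l : ℕ, Fin (2 * l + 1) => φ i.1) (stdCoef Y CZ T) μ := by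
  obtain ⟨B, hB⟩ := hT.exists_isSquareField
  refine ⟨?_, fun i t => ?_, fun i => ?_, fun i j t s => ?_⟩
  · exact (hT.isGaussianProcess_coef
      fun i : Σ l : ℕ, Fin (2 * l + 1) => Y i.1 i.2).smul fun q => (√(CZ q.1.1))⁻¹
  · simp_rw [stdCoef]
    rw [integral_const_mul, (hB t).integral_coef _ fun x => hT.mean_zero x t, mul_zero]
  · refine ⟨((√(CZ i.1))⁻¹) ^ 2 * (B * (4 * Real.pi) * ∫ x, Y i.1 i.2 x ^ 2 ∂surface), fun t => ?_⟩
    simp_rw [stdCoef, mul_pow]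
    rw [integral_const_mul]
    exact mul_le_mul_of_nonneg_left ((hB t).integrable_coef_sq _).2 (sq_nonneg _)
  · have h1 : ∀ (i : Σ l : ℕ, Fin (2 * l + 1)) (t : ℤ),
        innovation (φ i.1) (stdCoef Y CZ T i) t =ᵐ[μ]
          fun ω => (√(CZ i.1))⁻¹ * coef (Y i.1 i.2) (fun ω x => Z ω x t) ω := by
      intro i t
      filter_upwards [hTZ.coef_recursion hT hY hk hφ i t] with ω hω
      rw [← hω, innovation, lagSum, mul_sub, Finset.mul_sum]
      simp only [stdCoef]
      congr 1
      exact Finset.sum_congr rfl fun j _ => by ring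
    have h2 : ∫ ω, innovation (φ i.1) (stdCoef Y CZ T i) t ω *
        innovation (φ j.1) (stdCoef Y CZ T j) s ω ∂μ =
        (√(CZ i.1))⁻¹ * (√(CZ j.1))⁻¹ * ∫ ω, coef (Y i.1 i.2) (fun ω x => Z ω x t) ω *
          coef (Y j.1 j.2) (fun ω x => Z ω x s) ω ∂μ := by
      rw [← integral_const_mul]
      refine integral_congr_ae ?_
      filter_upwards [h1 i t, h1 j s] with ω h3 h4
      rw [h3, h4]; ring
    rw [h2, hZ.integral_coef_mul_coef hC hY]
    split_ifs with hij
    · obtain ⟨rfl, -⟩ := hij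
      have := Real.sqrt_pos.2 (hC i.1)
      have h5 := Real.mul_self_sqrt (hC i.1).le
      rw [← mul_inv, h5, inv_mul_cancel₀ (hC i.1).ne']
    · rw [mul_zero]

/-- The coefficients of the estimator solve the empirical normal equations. -/
lemma IsHarmonicSystem.empCov_mul (hY : IsHarmonicSystem Y) (hC : ∀ l, 0 < CZ l) {N L : ℕ}
    (hN : 0 < N) {ω : Ω}
    (hτ : ∀ t, MemLp (fun x => T ω x t) 2 surface) {khat : Fin p → ℝ → ℝ}
    (hest : IsKernelEstimate N L (T ω) khat) (φ : ℕ → Fin p → ℝ) :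
    ∃ x : ℕ → Fin p → ℝ,
      (∀ j z, khat j z = ∑ l ∈ Finset.range (L + 1), (φ l j + x l j) * zonal l z) ∧
      ∀ l ≤ L, ∀ i : Fin p, ∑ j : Fin p, empCov (stdCoef Y CZ T) l (p + 1) N i j ω * x l j =
        empCross (φ l) (stdCoef Y CZ T) l (p + 1) N i ω := by
  obtain ⟨h, hh, hn⟩ := hY.normal_equations hτ hest
  refine ⟨fun l j => h l j - φ l j, fun j z => by simp [hh j z], fun l hl i => ?_⟩
  have hN' : (0 : ℝ) < N := by exact_mod_cast hN
  have hs := Real.sqrt_pos.2 (hC l)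
  have hA : ∀ (m : Fin (2 * l + 1)) (s : ℤ), ∫ x, T ω x s * Y l m x ∂surface =
      √(CZ l) * stdCoef Y CZ T ⟨l, m⟩ s ω := by
    intro m s
    rw [stdCoef, mul_inv_cancel_left₀ hs.ne']
    rfl
  have h1 := hn l hl i
  simp_rw [hA] at h1
  generalize stdCoef Y CZ T = a at *
  have h2 : ∑ m, ∑ k ∈ Finset.range N, a ⟨l, m⟩ ((p : ℤ) + 1 + k - ((i : ℤ) + 1)) ω *
      (a ⟨l, m⟩ ((p : ℤ) + 1 + k) ω -
        ∑ j, h l j * a ⟨l, m⟩ ((p : ℤ) + 1 + k - ((j : ℤ) + 1)) ω) = 0 := by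
    rw [Finset.sum_comm]
    have h3 : √(CZ l) ^ 2 * ∑ k ∈ Finset.range N, ∑ m,
        a ⟨l, m⟩ ((p : ℤ) + 1 + k - ((i : ℤ) + 1)) ω * (a ⟨l, m⟩ ((p : ℤ) + 1 + k) ω -
          ∑ j, h l j * a ⟨l, m⟩ ((p : ℤ) + 1 + k - ((j : ℤ) + 1)) ω) = 0 := by
      rw [← h1, Finset.mul_sum, ← Finset.Ico_add_one_right_eq_Icc, Finset.sum_Ico_eq_sum_range,
        Nat.add_sub_cancel]
      refine Finset.sum_congr rfl fun k _ => ?_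
      rw [Finset.mul_sum]
      refine Finset.sum_congr rfl fun m _ => ?_
      -- The sum over `t = 1, …, N` becomes one over `k = t - 1`, so the scores start at time `p +
      -- 1`.
      have e1 : ((1 + k : ℕ) : ℤ) + p = p + 1 + k := by push_cast; ring
      rw [e1, sq, mul_sub, mul_sub, Finset.mul_sum, Finset.mul_sum, mul_sub, Finset.mul_sum]
      congr 1
      · ring
      · exact Finset.sum_congr rfl fun j _ => by ring
    exact (mul_eq_zero.1 h3).resolve_left (by positivity)
  have h4 : ∑ j : Fin p, (∑ m, ∑ k ∈ Finset.range N, a ⟨l, m⟩ ((p : ℤ) + 1 + k - ((i : ℤ) + 1)) ω *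
      a ⟨l, m⟩ ((p : ℤ) + 1 + k - ((j : ℤ) + 1)) ω) * (h l j - φ l j) =
      ∑ m, score (φ l) (Pi.single i 1) (a ⟨l, m⟩) (p + 1) N ω := by
    rw [← sub_eq_zero, ← neg_eq_zero, ← h2]
    simp_rw [score, lagSum_single, innovation, lagSum, Finset.sum_mul]
    rw [Finset.sum_comm, neg_sub, ← Finset.sum_sub_distrib]
    refine Finset.sum_congr rfl fun m _ => ?_
    rw [Finset.sum_comm, ← Finset.sum_sub_distrib]
    refine Finset.sum_congr rfl fun k _ => ?_
    have e1 : ∀ j : Fin p, a ⟨l, m⟩ ((p : ℤ) + 1 + k - ((i : ℤ) + 1)) ω *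
        a ⟨l, m⟩ ((p : ℤ) + 1 + k - ((j : ℤ) + 1)) ω * (h l j - φ l j) =
        a ⟨l, m⟩ ((p : ℤ) + 1 + k - ((i : ℤ) + 1)) ω *
          (h l j * a ⟨l, m⟩ ((p : ℤ) + 1 + k - ((j : ℤ) + 1)) ω) -
        a ⟨l, m⟩ ((p : ℤ) + 1 + k - ((i : ℤ) + 1)) ω *
          (φ l j * a ⟨l, m⟩ ((p : ℤ) + 1 + k - ((j : ℤ) + 1)) ω) := fun j => by ring
    simp_rw [e1]
    rw [Finset.sum_sub_distrib, ← Finset.mul_sum, ← Finset.mul_sum]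
    ring
  rw [empCross, ← h4, Finset.sum_div]
  refine Finset.sum_congr rfl fun j _ => ?_
  rw [empCov]
  ring

end Model

end SPHAR

/-! ### Assembly of the limit theorem. -/

theorem mainTheorem3
    {Ω : Type*} [MeasurableSpace Ω] (μ : Measure Ω) [IsProbabilityMeasure μ]
    (p : ℕ) (hp : 1 ≤ p)
    -- the true kernels and their eigenvalues
    (k : Fin p → ℝ → ℝ) (φ : ℕ → Fin p → ℝ)
    (hk : ∀ j, SPHAR.HasLegendreExpansion (k j) (fun l => φ l j))
    -- the autoregressive field and its innovations
    (T Z : Ω → SPHAR.S2 → ℤ → ℝ) (CZ : ℕ → ℝ)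
    (hT : SPHAR.IsGaussianIsotropicStationary T μ)
    (hZ : SPHAR.IsSphericalWhiteNoise Z CZ μ)
    (hTZ : SPHAR.IsSPHAR k T Z μ)
    -- stationarity, identifiability, strong smoothness
    (hstat : SPHAR.StationarityCondition φ)
    (hident : ∀ l, 0 < CZ l)
    (β γ : Fin p → ℝ) (hsmooth : SPHAR.StrongSmoothness φ β γ)
    -- the truncation levels
    (L : ℕ → ℕ) (d : ℝ) (hd : 1 / (2 * (⨅ j, β j) - 2) < d)
    (hL : (fun N : ℕ => (L N : ℝ)) =Θ[atTop] (fun N : ℕ => (N : ℝ) ^ d))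
    -- the estimators
    (khat : ℕ → Ω → Fin p → ℝ → ℝ)
    (hkhat : ∀ N, p < N → ∀ᵐ ω ∂μ, SPHAR.IsKernelEstimate N (L N) (T ω) (khat N ω))
    (z : ℝ) (hz : z ∈ Set.Icc (-1 : ℝ) 1)
    (hmeas : ∀ N j, AEMeasurable (fun ω => khat N ω j z) μ) :
    TendstoInDistribution
      (fun (N : ℕ) (ω : Ω) =>
        (WithLp.toLp 2 (fun j : Fin p =>
          Real.sqrt ((N : ℝ) / SPHAR.normalizer (L N) z) * (khat N ω j z - k j z)) :
          EuclideanSpace ℝ (Fin p)))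
      atTop
      (fun v : EuclideanSpace ℝ (Fin p) => v)
      (fun _ => μ)
      (stdGaussian (EuclideanSpace ℝ (Fin p))) := by
  have hβ : ∀ j, 2 < β j := fun j => (hsmooth j).1
  have hφb : ∀ j, ∀ l : ℕ, 0 < l → |φ l j| ≤ γ j / (l : ℝ) ^ (β j) := fun j => (hsmooth j).2.2
  have hsum : ∀ j, Summable fun l => |φ l j| * (2 * (l : ℝ) + 1) := fun j =>
    SPHAR.summable_of_smooth (hβ j) (hφb j)
  have hφ0 : ∀ j, Tendsto (fun l => φ l j) atTop (𝓝 0) := by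
    intro j
    refine squeeze_zero_norm (fun l => ?_) (hsum j).tendsto_atTop_zero
    exact le_mul_of_one_le_right (abs_nonneg _) (by linarith [(Nat.cast_nonneg l : (0 : ℝ) ≤ l)])
  have hinf : ∀ j, ⨅ j, β j ≤ β j := fun j => ciInf_le (Set.finite_range β).bddBelow j
  have hne : Nonempty (Fin p) := ⟨⟨0, hp⟩⟩
  have hinf2 : 2 < ⨅ j, β j := by
    obtain ⟨j, hj⟩ := exists_eq_ciInf_of_finite (f := β)
    rw [← hj]; exact hβ j
  have hdj : ∀ j, 1 / (2 * β j - 2) < d := fun j =>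
    (one_div_le_one_div_of_le (by linarith) (by linarith [hinf j])).trans_lt hd
  have hd0 : 0 < d := lt_trans (one_div_pos.2 (by linarith)) hd
  obtain ⟨δ, hδ, hroot⟩ := hstat
  choose ψ hψ using fun l => SPHAR.exists_isCausalInverse (φ l) hδ (hroot l)
  obtain ⟨Y, hY⟩ := SPHAR.exists_isHarmonicSystem
  have hAR := hTZ.isARSystem hT hZ hident hY hk hsum
  have hLtop := SPHAR.tendsto_of_isTheta_rpow hd0 hL
  have hLsum := SPHAR.tendsto_sum_inv_div hL
  classical
  have hex : ∀ (N : ℕ) (ω : Ω), ∃ x : ℕ → Fin p → ℝ, 0 < N →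
      (∀ t, MemLp (fun x => T ω x t) 2 SPHAR.surface) →
      SPHAR.IsKernelEstimate N (L N) (T ω) (khat N ω) →
      (∀ j z, khat N ω j z = ∑ l ∈ Finset.range (L N + 1), (φ l j + x l j) * SPHAR.zonal l z) ∧
      ∀ l ≤ L N, ∀ i : Fin p,
        ∑ j : Fin p, SPHAR.empCov (SPHAR.stdCoef Y CZ T) l (p + 1) N i j ω * x l j =
          SPHAR.empCross (φ l) (SPHAR.stdCoef Y CZ T) l (p + 1) N i ω := by
    intro N ω
    by_cases hc : 0 < N ∧ (∀ t, MemLp (fun x => T ω x t) 2 SPHAR.surface) ∧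
      SPHAR.IsKernelEstimate N (L N) (T ω) (khat N ω)
    · obtain ⟨x, hx⟩ := hY.empCov_mul hident hc.1 hc.2.1 hc.2.2 φ
      exact ⟨x, fun _ _ _ => hx⟩
    · exact ⟨0, fun h1 h2 h3 => (hc ⟨h1, h2, h3⟩).elim⟩
  -- The errors `x` are chosen pointwise and need not be measurable: they are only compared almost
  -- surely with an integrable majorant.
  choose x hx using hex
  have hae : ∀ᶠ N in atTop, ∀ᵐ ω ∂μ,
      (∀ j z, khat N ω j z = ∑ l ∈ Finset.range (L N + 1), (φ l j + x N ω l j) * SPHAR.zonal l z) ∧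
      ∀ l ≤ L N, ∀ i : Fin p,
        ∑ j : Fin p, SPHAR.empCov (SPHAR.stdCoef Y CZ T) l (p + 1) N i j ω * x N ω l j =
          SPHAR.empCross (φ l) (SPHAR.stdCoef Y CZ T) l (p + 1) N i ω := by
    filter_upwards [eventually_gt_atTop p] with N hN
    filter_upwards [hkhat N hN, hT.ae_memLp] with ω h1 h2
    exact hx N ω (lt_of_le_of_lt (Nat.zero_le p) hN) h2 h1
  have hlin := hAR.tendstoInDistribution_linearPart hψ hφ0 hz hLtop (p + 1)
  -- Slutsky's lemma: it remains to show that the standardized error differs from its linear part by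
  -- a term vanishing in measure.
  refine tendstoInDistribution_of_tendstoInMeasure_sub _ _ hlin ?_ fun N =>
    (WithLp.measurable_toLp 2 _).comp_aemeasurable (aemeasurable_pi_lambda _ fun j =>
      ((hmeas N j).sub_const _).const_mul _)
  have hrem : ∀ j, TendstoInMeasure μ (fun (N : ℕ) ω =>
      √(N / SPHAR.normalizer (L N) z) * (khat N ω j z - k j z) -
        SPHAR.linearPart φ ψ (SPHAR.stdCoef Y CZ T) (L N) z (Pi.single j 1) (p + 1) N ω) atTop
      (fun _ => 0) := by
    intro j
    have h1 := hAR.tendstoInMeasure_sub_linearPart hψ hφ0 hp (z := z) hLsum (p + 1)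
      (hae.mono fun N hN => hN.mono fun ω hω => hω.2) j
    have h2 := SPHAR.tendsto_bias hz (hβ j) (hφb j) (hk j z hz) (hdj j) hL
    refine TendstoInMeasure.congr' ?_ (ae_eq_refl _)
      -- The remainder is the linearization error minus the deterministic standardized tail of `k
      -- j`.
      (SPHAR.tendstoInMeasure_sub_of_tendsto h1 h2)
    filter_upwards [hae] with N hN
    filter_upwards [hN] with ω hω
    rw [hω.1 j z]
    simp_rw [add_mul, Finset.sum_add_distrib, mul_comm (SPHAR.zonal _ z) (x N ω _ j)]
    ring
  exact SPHAR.tendstoInMeasure_toLp hrem
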